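/- Let $a,b,\alpha>0$ and $\xi\in(0,1)$ be real numbers with $\alpha b<6$ and $\xi\notin\mathbb Q$. On the complex energy space $\mathcal H=[H^2(0,1)\cap H^1_0(0,1)]\times L^2(0,1)$ consider the unbounded operator $$\mathcal A(u,v)=\bigl(v,\,-a\,u_{xxxx}-b\,v-\alpha\,v(\xi)\,\delta_\xi\bigr)$$ (derivatives in the sense of distributions on $(0,1)$), whose domain $D(\mathcal A)$ consists of all $(u,v)$ with $u\in H^4(0,\xi)\cap H^4(\xi,1)\cap H^2(0,1)$, $v\in H^2(0,1)$, $u(0)=u(1)=v(0)=v(1)=0$, $u_{xx}(0)=u_{xx}(1)=0$, $u_{xx}(\xi^-)=u_{xx}(\xi^+)$ and $u_{xxx}(\xi^+)-u_{xxx}(\xi^-)=-\frac{\alpha}{a}v(\xi)$. To a complex number $\mu$ associate the complex numbers $\lambda$ with $\lambda^4=-\frac{b\mu+\mu^2}{a}$. The solutions of the asymptotic characteristic equation $$\sinh(z)\sin(z)=0 \tag{1}$$ are exactly the numbers $z=n\pi$ and $z=in\pi$, $n\in\mathbb Z$. Moreover there are constants $C,\rho,R>0$ (depending on $a,b,\alpha,\xi$)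 such that: 1. An eigenvalue $\mu$ of $\mathcal A$ is large, in the sense that $|\mu|>R$, if and only if each of the corresponding $\lambda$'s is close to a large root of (1), in the sense that there is a root $z$ of (1) with $|z|\ge\rho$ and $|\lambda-z|\le C/|z|$. 2. Conversely, for every root $z$ of (1) with $|z|\ge\rho$ there are exactly one pair $(\mu,\lambda)$ with $\operatorname{Im}\mu>0$ and exactly one pair $(\mu,\lambda)$ with $\operatorname{Im}\mu<0$ such that $\mu$ is an eigenvalue of $\mathcal A$, $\lambda^4=-\frac{b\mu+\mu^2}{a}$ and $|\lambda-z|\le C/|z|$. 3. Every eigenvalue $\mu$ of $\mathcal A$ with $|\mu|>R$ has geometric multiplicity $\dim\ker(\mathcal A-\mu)=1$ and algebraic multiplicity $\dim\bigcup_{k}\ker(\mathcal A-\mu)^k=1$. -/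

import Mathlib

open MeasureTheory Set
open scoped ContDiff

/-- `g` is a weak derivative of order `k` of `f` on the open interval `(c, d)`. -/
def HasWeakDeriv (k : ℕ) (c d : ℝ) (f g : ℝ → ℂ) : Prop :=
  ∀ φ : ℝ → ℝ, ContDiff ℝ ∞ φ → HasCompactSupport φ → tsupport φ ⊆ Ioo c d →
    ∫ x in Ioo c d, iteratedDeriv k φ x • f x = (-1 : ℂ) ^ k * ∫ x in Ioo c d, φ x • g x

/-- The Sobolev space `H^m(c, d)` of complex-valued functions: `f` and its weak derivatives of order
at most `m` are square integrable on `(c, d)`. -/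
def MemSobolev (m : ℕ) (c d : ℝ) (f : ℝ → ℂ) : Prop :=
  MemLp f 2 (volume.restrict (Ioo c d)) ∧
    ∀ k ≤ m, ∃ g : ℝ → ℂ, MemLp g 2 (volume.restrict (Ioo c d)) ∧ HasWeakDeriv k c d f g

/-- `g` is the representative of the `k`-th weak derivative of `f` on `(c, d)` that is continuous on
the closed interval `[c, d]`. For `c < d` its values on `[c, d]`, the (one-sided) boundary values
included, are determined by `f`. For `k = 0` it is the continuous representative of `f` itself. -/
def IsContinuousRep (k : ℕ) (c d : ℝ) (f g : ℝ → ℂ) : Prop :=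
  ContinuousOn g (Icc c d) ∧ HasWeakDeriv k c d f g

/-- The complex Lebesgue space `L²(0, 1)`. -/
abbrev L2 : Type := Lp ℂ 2 (volume.restrict (Ioo (0 : ℝ) 1))

theorem tsupport_iteratedDeriv_subset' (φ : ℝ → ℝ) (k : ℕ) :
    tsupport (iteratedDeriv k φ) ⊆ tsupport φ := by
  induction k with
  | zero => simp
  | succ k ih =>
    rw [iteratedDeriv_succ]
    exact tsupport_deriv_subset.trans ih

theorem integrable_smooth_smul {c d : ℝ} {f : ℝ → ℂ} (hf : IntegrableOn f (Ioo c d))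
    {φ : ℝ → ℝ} (hφ : Continuous φ) :
    IntegrableOn (fun x => φ x • f x) (Ioo c d) := by
  obtain ⟨C, hC⟩ := (isCompact_Icc (a := c) (b := d)).exists_bound_of_continuousOn hφ.continuousOn
  refine Integrable.bdd_smul (C := C) hf hφ.aestronglyMeasurable ?_
  filter_upwards [ae_restrict_mem measurableSet_Ioo] with x hx using hC x (Ioo_subset_Icc_self hx)

theorem continuous_iteratedDeriv_of_smooth {φ : ℝ → ℝ} (hφ : ContDiff ℝ ∞ φ) (k : ℕ) :
    Continuous (iteratedDeriv k φ) :=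
  hφ.continuous_iteratedDeriv k (by exact_mod_cast le_top)

namespace HasWeakDeriv
variable {k : ℕ} {c d : ℝ} {f f' g g' : ℝ → ℂ}

theorem congr_ae (h : HasWeakDeriv k c d f g) (hf : f =ᵐ[volume.restrict (Ioo c d)] f')
    (hg : g =ᵐ[volume.restrict (Ioo c d)] g') : HasWeakDeriv k c d f' g' := by
  intro φ h1 h2 h3
  have e1 : ∫ x in Ioo c d, iteratedDeriv k φ x • f' x
      = ∫ x in Ioo c d, iteratedDeriv k φ x • f x :=
    integral_congr_ae (by filter_upwards [hf] with x hx; rw [hx])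
  have e2 : ∫ x in Ioo c d, φ x • g' x = ∫ x in Ioo c d, φ x • g x :=
    integral_congr_ae (by filter_upwards [hg] with x hx; rw [hx])
  rw [e1, e2]; exact h φ h1 h2 h3

theorem add (h : HasWeakDeriv k c d f g) (h' : HasWeakDeriv k c d f' g')
    (hf : IntegrableOn f (Ioo c d)) (hf' : IntegrableOn f' (Ioo c d))
    (hg : IntegrableOn g (Ioo c d)) (hg' : IntegrableOn g' (Ioo c d)) :
    HasWeakDeriv k c d (f + f') (g + g') := by
  intro φ h1 h2 h3
  have hk := continuous_iteratedDeriv_of_smooth h1 k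
  simp only [Pi.add_apply, smul_add]
  rw [integral_add (integrable_smooth_smul hf hk) (integrable_smooth_smul hf' hk),
    integral_add (integrable_smooth_smul hg h1.continuous)
      (integrable_smooth_smul hg' h1.continuous), h φ h1 h2 h3, h' φ h1 h2 h3, mul_add]

theorem const_smul (h : HasWeakDeriv k c d f g) (z : ℂ) :
    HasWeakDeriv k c d (z • f) (z • g) := by
  intro φ h1 h2 h3
  simp only [Pi.smul_apply, smul_comm _ z]
  rw [integral_smul, integral_smul, h φ h1 h2 h3, smul_eq_mul, smul_eq_mul]; ring

theorem zero : HasWeakDeriv k c d 0 0 := by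
  intro φ _ _ _; simp

theorem mono (h : HasWeakDeriv k c d f g) {c' d' : ℝ} (hc : c ≤ c') (hd : d' ≤ d) :
    HasWeakDeriv k c' d' f g := by
  intro φ h1 h2 h3
  have hs : Ioo c' d' ⊆ Ioo c d := Ioo_subset_Ioo hc hd
  have key := h φ h1 h2 (h3.trans hs)
  have e (ψ : ℝ → ℝ) (hψ : tsupport ψ ⊆ tsupport φ) (F : ℝ → ℂ) :
      ∫ x in Ioo c d, ψ x • F x = ∫ x in Ioo c' d', ψ x • F x := by
    refine (setIntegral_eq_of_subset_of_forall_sdiff_eq_zero measurableSet_Ioo hs ?_)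
    intro x hx
    rw [image_eq_zero_of_notMem_tsupport (fun hx' => hx.2 (h3 (hψ hx'))), zero_smul]
  rwa [e _ (tsupport_iteratedDeriv_subset' φ k), e _ subset_rfl] at key

theorem ae_unique (h : HasWeakDeriv k c d f g) (h' : HasWeakDeriv k c d f g')
    (hg : IntegrableOn g (Ioo c d)) (hg' : IntegrableOn g' (Ioo c d)) :
    g =ᵐ[volume.restrict (Ioo c d)] g' := by
  have key := IsOpen.ae_eq_zero_of_integral_contDiff_smul_eq_zero (μ := volume) (f := g - g')
    (isOpen_Ioo (a := c) (b := d)) (hg.sub hg').locallyIntegrableOn ?_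
  · filter_upwards [(ae_restrict_iff' measurableSet_Ioo).2 key] with x hx
    exact sub_eq_zero.1 hx
  · intro φ h1 h2 h3
    have e := (h φ h1 h2 h3).symm.trans (h' φ h1 h2 h3)
    have e' := mul_left_cancel₀ (pow_ne_zero k (by norm_num)) e
    rw [← setIntegral_eq_integral_of_forall_compl_eq_zero (s := Ioo c d)]
    · simp only [Pi.sub_apply, smul_sub]
      rw [integral_sub (integrable_smooth_smul hg h1.continuous)
        (integrable_smooth_smul hg' h1.continuous), e', sub_self]
    · intro x hx
      rw [image_eq_zero_of_notMem_tsupport (fun hx' => hx (h3 hx')), zero_smul]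

/-- A function with vanishing weak derivative is constant. -/
theorem exists_const (h : HasWeakDeriv 1 c d f 0) (hcd : c < d) (hf : IntegrableOn f (Ioo c d)) :
    ∃ C : ℂ, f =ᵐ[volume.restrict (Ioo c d)] fun _ => C := by
  -- a bump function supported in the interval
  obtain ⟨θ, hθs, hθc, hθd, hθ1⟩ : ∃ θ : ℝ → ℝ, tsupport θ ⊆ Ioo c d ∧ HasCompactSupport θ ∧
      ContDiff ℝ ∞ θ ∧ ∫ x, θ x = 1 := by
    let b : ContDiffBump ((c + d) / 2) :=
      ⟨(d - c) / 8, (d - c) / 4, by linarith, by linarith⟩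
    refine ⟨b.normed volume, ?_, b.hasCompactSupport_normed, b.contDiff_normed,
      b.integral_normed⟩
    rw [b.tsupport_normed_eq, Real.closedBall_eq_Icc]
    intro x hx
    have : b.rOut = (d - c) / 4 := rfl
    rw [this] at hx
    exact ⟨by linarith [hx.1], by linarith [hx.2]⟩
  refine ⟨∫ x in Ioo c d, θ x • f x, ?_⟩
  refine ae_unique (k := 0) (f := f) (fun φ _ _ _ => by simp) ?_ hf (by simp)
  intro φ h1 h2 h3
  set m : ℝ := ∫ x, φ x with hm
  set ρ : ℝ → ℝ := fun x => φ x - m * θ x with hρ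
  have hρd : ContDiff ℝ ∞ ρ := h1.sub (contDiff_const.mul hθd)
  set ψ : ℝ → ℝ := fun x => ∫ t in c..x, ρ t with hψ
  have hψ' : deriv ψ = ρ := by
    ext x; exact hρd.continuous.deriv_integral _ _ _
  have hψd : ContDiff ℝ ∞ ψ := by
    rw [contDiff_infty_iff_deriv, hψ']
    exact ⟨fun x => (intervalIntegral.integral_hasDerivAt_right
      (hρd.continuous.intervalIntegrable _ _)
      (hρd.continuous.stronglyMeasurableAtFilter _ _) hρd.continuous.continuousAt).differentiableAt, hρd⟩
  have hρs : tsupport ρ ⊆ tsupport φ ∪ tsupport θ := by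
    refine closure_minimal ?_ ((isClosed_tsupport φ).union (isClosed_tsupport θ))
    intro x hx
    by_contra hx'
    rw [mem_union, not_or] at hx'
    exact hx (by simp [hρ, image_eq_zero_of_notMem_tsupport hx'.1,
      image_eq_zero_of_notMem_tsupport hx'.2])
  have hK : IsCompact (tsupport φ ∪ tsupport θ) := h2.isCompact.union hθc.isCompact
  have hKs : tsupport φ ∪ tsupport θ ⊆ Ioo c d := union_subset h3 hθs
  obtain ⟨c', d', hcc, hdd, hcd', hK'⟩ : ∃ c' d', c < c' ∧ d' < d ∧ c' ≤ d' ∧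
      tsupport φ ∪ tsupport θ ⊆ Icc c' d' := by
    rcases (tsupport φ ∪ tsupport θ).eq_empty_or_nonempty with h0 | h0
    · exact ⟨(c + d) / 2, (c + d) / 2, by linarith, by linarith, le_rfl, by simp [h0]⟩
    · obtain ⟨x, hx, hx'⟩ := hK.exists_isLeast h0
      obtain ⟨y, hy, hy'⟩ := hK.exists_isGreatest h0
      exact ⟨x, y, (hKs hx).1, (hKs hy).2, hx' hy, fun z hz => ⟨hx' hz, hy' hz⟩⟩
  have hρ0 : ∀ x, x ∉ Icc c' d' → ρ x = 0 := fun x hx =>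
    image_eq_zero_of_notMem_tsupport (fun h' => hx (hK' (hρs h')))
  have hθi : Integrable θ := hθd.continuous.integrable_of_hasCompactSupport hθc
  have hφi : Integrable φ := h1.continuous.integrable_of_hasCompactSupport h2
  have hρi : ∫ x, ρ x = 0 := by
    simp only [hρ]
    rw [integral_sub hφi (hθi.const_mul m), integral_const_mul, hθ1]; simp [hm]
  have hψs : ∀ x, x ∉ Icc c' d' → ψ x = 0 := by
    intro x hx
    rw [mem_Icc, not_and_or, not_le, not_le] at hx
    rcases hx with hx | hx
    · refine (intervalIntegral.integral_congr (g := fun _ => (0 : ℝ)) ?_).trans (by simp)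
      intro t ht
      refine hρ0 t (fun h' => ?_)
      have := ht.2
      rcases le_total c x with h | h <;> simp [h] at this <;> linarith [h'.1]
    · have hcx : c ≤ x := by linarith
      rw [hψ]; simp only
      rw [intervalIntegral.integral_of_le hcx, ← hρi]
      refine setIntegral_eq_integral_of_forall_compl_eq_zero ?_
      intro t ht
      refine hρ0 t (fun h' => ht ⟨by linarith [h'.1], by linarith [h'.2]⟩)
  have hψs' : tsupport ψ ⊆ Icc c' d' := by
    refine closure_minimal ?_ isClosed_Icc
    intro x hx
    by_contra hx'
    exact hx (hψs x hx')
  have key := h ψ hψd (HasCompactSupport.of_support_subset_isCompact isCompact_Icc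
    ((subset_tsupport ψ).trans hψs')) (hψs'.trans (fun x hx => ⟨by linarith [hx.1],
      by linarith [hx.2]⟩))
  rw [iteratedDeriv_one, hψ'] at key
  simp only [hρ, Pi.zero_apply, smul_zero, integral_zero, mul_zero, sub_smul, mul_smul] at key
  have hθf : Integrable (fun x => m • θ x • f x) (volume.restrict (Ioo c d)) :=
    (integrable_smooth_smul hf hθd.continuous).smul m
  rw [integral_sub (integrable_smooth_smul hf h1.continuous) hθf, integral_smul,
    sub_eq_zero] at key
  simp only [iteratedDeriv_zero, pow_zero, one_mul]
  rw [key, integral_smul_const]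
  congr 1
  rw [hm, setIntegral_eq_integral_of_forall_compl_eq_zero]
  intro x hx
  exact image_eq_zero_of_notMem_tsupport (fun h' => hx (h3 h'))

end HasWeakDeriv

theorem integral_primitive_real {c d : ℝ} {q φ : ℝ → ℝ}
    (hq : IntervalIntegrable q volume c d) (hφ : ContDiff ℝ ∞ φ) :
    ∫ x in c..d, deriv φ x * (∫ t in c..x, q t) =
      φ d * (∫ t in c..d, q t) - ∫ x in c..d, φ x * q x := by
  have h1 := hq.absolutelyContinuousOnInterval_intervalIntegral (c := c) (by simp)
  have h2 : AbsolutelyContinuousOnInterval φ c d :=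
    (hφ.of_le (by exact_mod_cast le_top)).contDiffOn.absolutelyContinuousOnInterval
  have h3 := h1.integral_mul_deriv_eq_deriv_mul h2
  have h4 : ∫ x in c..d, deriv (fun x => ∫ t in c..x, q t) x * φ x = ∫ x in c..d, φ x * q x := by
    refine intervalIntegral.integral_congr_ae ?_
    filter_upwards [hq.ae_hasDerivAt_integral] with x hx hx'
    rw [(hx (uIoc_subset_uIcc hx') c (by simp)).deriv, mul_comm]
  rw [h4] at h3
  simp only [intervalIntegral.integral_same, zero_mul, sub_zero] at h3
  rw [mul_comm (φ d), ← h3]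
  simp only [mul_comm]

theorem integral_primitive {c d : ℝ} {q : ℝ → ℂ} {φ : ℝ → ℝ}
    (hq : IntervalIntegrable q volume c d) (hφ : ContDiff ℝ ∞ φ) :
    ∫ x in c..d, deriv φ x • (∫ t in c..x, q t) =
      φ d • (∫ t in c..d, q t) - ∫ x in c..d, φ x • q x := by
  have hφ' : Continuous (deriv φ) := hφ.continuous_deriv (by exact_mod_cast le_top)
  have hre : IntervalIntegrable (fun x => (q x).re) volume c d := ⟨hq.1.re, hq.2.re⟩
  have him : IntervalIntegrable (fun x => (q x).im) volume c d := ⟨hq.1.im, hq.2.im⟩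
  have hF : ContinuousOn (fun x => ∫ t in c..x, q t) (uIcc c d) :=
    intervalIntegral.continuousOn_primitive_interval' hq (by simp)
  have i1 : IntervalIntegrable (fun x => deriv φ x • (∫ t in c..x, q t)) volume c d :=
    (hφ'.continuousOn.smul hF).intervalIntegrable
  have i2 : IntervalIntegrable (fun x => φ x • q x) volume c d :=
    hq.continuousOn_smul hφ.continuous.continuousOn
  have sub (x : ℝ) (hx : x ∈ uIcc c d) : IntervalIntegrable q volume c x :=
    hq.mono_set (uIcc_subset_uIcc_left hx)
  apply Complex.ext
  · have e := integral_primitive_real hre hφ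
    have a1 := Complex.reCLM.intervalIntegral_comp_comm i1
    have a2 := Complex.reCLM.intervalIntegral_comp_comm i2
    have a3 := Complex.reCLM.intervalIntegral_comp_comm hq
    simp only [Complex.reCLM_apply, Complex.smul_re] at a1 a2 a3
    rw [Complex.sub_re, ← a1, ← a2, Complex.smul_re, ← a3]
    refine Eq.trans ?_ e
    refine intervalIntegral.integral_congr (fun x hx => ?_)
    have a4 := Complex.reCLM.intervalIntegral_comp_comm (sub x hx)
    simp only [Complex.reCLM_apply] at a4
    simp only [a4, smul_eq_mul]
  · have e := integral_primitive_real him hφ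
    have a1 := Complex.imCLM.intervalIntegral_comp_comm i1
    have a2 := Complex.imCLM.intervalIntegral_comp_comm i2
    have a3 := Complex.imCLM.intervalIntegral_comp_comm hq
    simp only [Complex.imCLM_apply, Complex.smul_im] at a1 a2 a3
    rw [Complex.sub_im, ← a1, ← a2, Complex.smul_im, ← a3]
    refine Eq.trans ?_ e
    refine intervalIntegral.integral_congr (fun x hx => ?_)
    have a4 := Complex.imCLM.intervalIntegral_comp_comm (sub x hx)
    simp only [Complex.imCLM_apply] at a4
    simp only [a4, smul_eq_mul]

/-- Integration by parts up to the boundary. -/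
theorem IsContinuousRep.integral_deriv_smul {k : ℕ} {c d : ℝ} {f p q : ℝ → ℂ} (hcd : c < d)
    (hp : IsContinuousRep k c d f p) (hq : HasWeakDeriv (k + 1) c d f q)
    (hqi : IntegrableOn q (Ioo c d)) {φ : ℝ → ℝ} (hφ : ContDiff ℝ ∞ φ) :
    ∫ x in Ioo c d, deriv φ x • p x =
      φ d • p d - φ c • p c - ∫ x in Ioo c d, φ x • q x := by
  have hqI : IntervalIntegrable q volume c d := by
    rwa [intervalIntegrable_iff_integrableOn_Ioo_of_le hcd.le]
  set F : ℝ → ℂ := fun x => ∫ t in c..x, q t with hF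
  have hFc : ContinuousOn F (Icc c d) := by
    rw [← uIcc_of_le hcd.le]
    exact intervalIntegral.continuousOn_primitive_interval' hqI (by simp)
  have hpi : IntegrableOn p (Ioo c d) := (hp.1.integrableOn_Icc).mono_set Ioo_subset_Icc_self
  have hFi : IntegrableOn F (Ioo c d) := (hFc.integrableOn_Icc).mono_set Ioo_subset_Icc_self
  have smooth_deriv {ψ : ℝ → ℝ} (hψ : ContDiff ℝ ∞ ψ) : ContDiff ℝ ∞ (deriv ψ) :=
    (contDiff_infty_iff_deriv.1 hψ).2
  have prim {ψ : ℝ → ℝ} (hψ : ContDiff ℝ ∞ ψ) : ∫ x in Ioo c d, deriv ψ x • F x =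
      ψ d • F d - ∫ x in Ioo c d, ψ x • q x := by
    have := integral_primitive hqI hψ
    rwa [intervalIntegral.integral_of_le hcd.le, integral_Ioc_eq_integral_Ioo,
      intervalIntegral.integral_of_le (f := fun x => ψ x • q x) hcd.le,
      integral_Ioc_eq_integral_Ioo] at this
  have w1 : HasWeakDeriv 1 c d p q := by
    intro ψ h1 h2 h3
    have e1 := hp.2 (deriv ψ) (smooth_deriv h1) h2.deriv (tsupport_deriv_subset.trans h3)
    have e2 := hq ψ h1 h2 h3
    rw [iteratedDeriv_succ', e1, pow_succ, mul_assoc] at e2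
    rw [iteratedDeriv_one, pow_one]
    exact mul_left_cancel₀ (pow_ne_zero k (by norm_num)) e2
  have w2 : HasWeakDeriv 1 c d F q := by
    intro ψ h1 h2 h3
    have hd0 : ψ d = 0 := image_eq_zero_of_notMem_tsupport fun h' => lt_irrefl _ (h3 h').2
    rw [iteratedDeriv_one, prim h1, hd0]; simp
  have w3 : HasWeakDeriv 1 c d (p + (-1 : ℂ) • F) 0 := by
    have := w1.add (w2.const_smul (-1)) hpi (hFi.smul (-1 : ℂ)) hqi (hqi.smul (-1 : ℂ))
    simpa using this
  obtain ⟨C, hC⟩ := w3.exists_const hcd (hpi.add (hFi.smul (-1 : ℂ)))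
  have hC' : EqOn (p + (-1 : ℂ) • F) (fun _ => C) (Icc c d) := by
    refine Measure.eqOn_Icc_of_ae_eq (μ := volume) hcd.ne ?_ (hp.1.add (hFc.const_smul (-1 : ℂ)))
      continuousOn_const
    rwa [← restrict_Ioo_eq_restrict_Icc]
  have hpF : ∀ x ∈ Icc c d, p x = F x + C := by
    intro x hx
    have := hC' hx
    simp only [Pi.add_apply, Pi.smul_apply, smul_eq_mul] at this
    linear_combination this
  have hφ' : Continuous (deriv φ) := (smooth_deriv hφ).continuous
  have e1 : ∫ x in Ioo c d, deriv φ x • p x =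
      ∫ x in Ioo c d, (deriv φ x • F x + deriv φ x • C) := by
    refine setIntegral_congr_fun measurableSet_Ioo (fun x hx => ?_)
    rw [hpF x (Ioo_subset_Icc_self hx), smul_add]
  have e2 : ∫ x in Ioo c d, deriv φ x • C = (φ d - φ c) • C := by
    rw [integral_smul_const, ← integral_Ioc_eq_integral_Ioo,
      ← intervalIntegral.integral_of_le hcd.le, intervalIntegral.integral_deriv_eq_sub]
    · intro x _; exact (hφ.differentiable (by simp)) x
    · exact hφ'.intervalIntegrable _ _
  have hFz : F c = 0 := by simp [hF]
  rw [e1, integral_add (integrable_smooth_smul hFi hφ')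
    (integrable_smooth_smul (by simp) hφ'), prim hφ, e2,
    hpF d (right_mem_Icc.2 hcd.le), hpF c (left_mem_Icc.2 hcd.le), hFz]
  simp only [smul_add, sub_smul, smul_zero]
  ring

namespace MemSobolev
variable {m : ℕ} {c d : ℝ} {f f' : ℝ → ℂ}

theorem integrableOn (h : MemSobolev m c d f) : IntegrableOn f (Ioo c d) :=
  h.1.integrable (by norm_num)

theorem zero : MemSobolev m c d 0 :=
  ⟨MemLp.zero', fun _ _ => ⟨0, MemLp.zero', HasWeakDeriv.zero⟩⟩

theorem add (h : MemSobolev m c d f) (h' : MemSobolev m c d f') : MemSobolev m c d (f + f') := by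
  refine ⟨h.1.add h'.1, fun k hk => ?_⟩
  obtain ⟨g, hg, hw⟩ := h.2 k hk
  obtain ⟨g', hg', hw'⟩ := h'.2 k hk
  exact ⟨g + g', hg.add hg', hw.add hw' h.integrableOn h'.integrableOn
    (hg.integrable (by norm_num)) (hg'.integrable (by norm_num))⟩

theorem const_smul (h : MemSobolev m c d f) (z : ℂ) : MemSobolev m c d (z • f) := by
  refine ⟨h.1.const_smul z, fun k hk => ?_⟩
  obtain ⟨g, hg, hw⟩ := h.2 k hk
  exact ⟨z • g, hg.const_smul z, hw.const_smul z⟩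

theorem congr_ae (h : MemSobolev m c d f) (hf : f =ᵐ[volume.restrict (Ioo c d)] f') :
    MemSobolev m c d f' := by
  refine ⟨(memLp_congr_ae hf).1 h.1, fun k hk => ?_⟩
  obtain ⟨g, hg, hw⟩ := h.2 k hk
  exact ⟨g, hg, hw.congr_ae hf Filter.EventuallyEq.rfl⟩

end MemSobolev

namespace IsContinuousRep
variable {k : ℕ} {c d : ℝ} {f f' g g' : ℝ → ℂ}

theorem integrableOn (h : IsContinuousRep k c d f g) : IntegrableOn g (Ioo c d) :=
  h.1.integrableOn_Icc.mono_set Ioo_subset_Icc_self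

theorem zero : IsContinuousRep k c d 0 0 := ⟨continuousOn_const, HasWeakDeriv.zero⟩

theorem add (h : IsContinuousRep k c d f g) (h' : IsContinuousRep k c d f' g')
    (hf : IntegrableOn f (Ioo c d)) (hf' : IntegrableOn f' (Ioo c d)) :
    IsContinuousRep k c d (f + f') (g + g') :=
  ⟨h.1.add h'.1, h.2.add h'.2 hf hf' h.integrableOn h'.integrableOn⟩

theorem const_smul (h : IsContinuousRep k c d f g) (z : ℂ) :
    IsContinuousRep k c d (z • f) (z • g) :=
  ⟨h.1.const_smul z, h.2.const_smul z⟩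

theorem congr_ae (h : IsContinuousRep k c d f g) (hf : f =ᵐ[volume.restrict (Ioo c d)] f') :
    IsContinuousRep k c d f' g :=
  ⟨h.1, h.2.congr_ae hf Filter.EventuallyEq.rfl⟩

theorem eqOn (h : IsContinuousRep k c d f g) (h' : IsContinuousRep k c d f g') (hcd : c < d) :
    EqOn g g' (Icc c d) := by
  refine Measure.eqOn_Icc_of_ae_eq (μ := volume) hcd.ne ?_ h.1 h'.1
  rw [← restrict_Ioo_eq_restrict_Icc]
  exact h.2.ae_unique h'.2 h.integrableOn h'.integrableOn

end IsContinuousRep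

theorem L2.ae_zero {c d : ℝ} (hc : 0 ≤ c) (hd : d ≤ 1) :
    (0 : ℝ → ℂ) =ᵐ[volume.restrict (Ioo c d)] ((0 : L2) : ℝ → ℂ) :=
  ae_mono (Measure.restrict_mono (Ioo_subset_Ioo hc hd) le_rfl) (Lp.coeFn_zero ℂ 2 _).symm

theorem L2.ae_add {c d : ℝ} (hc : 0 ≤ c) (hd : d ≤ 1) (f g : L2) :
    (f + g : ℝ → ℂ) =ᵐ[volume.restrict (Ioo c d)] ((f + g : L2) : ℝ → ℂ) :=
  ae_mono (Measure.restrict_mono (Ioo_subset_Ioo hc hd) le_rfl) (Lp.coeFn_add f g).symm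

theorem L2.ae_smul {c d : ℝ} (hc : 0 ≤ c) (hd : d ≤ 1) (z : ℂ) (f : L2) :
    (z • (f : ℝ → ℂ)) =ᵐ[volume.restrict (Ioo c d)] ((z • f : L2) : ℝ → ℂ) :=
  ae_mono (Measure.restrict_mono (Ioo_subset_Ioo hc hd) le_rfl) (Lp.coeFn_smul z f).symm

theorem L2.integrableOn {c d : ℝ} (hc : 0 ≤ c) (hd : d ≤ 1) (f : L2) :
    IntegrableOn f (Ioo c d) :=
  IntegrableOn.mono_set ((Lp.memLp f).integrable (by norm_num)) (Ioo_subset_Ioo hc hd)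

/-- `u ∈ H²(0, 1) ∩ H¹₀(0, 1)`: in one dimension, the functions of `H²(0, 1)` whose continuous
representative vanishes at `0` and at `1`. -/
def MemH2H10 (u : ℝ → ℂ) : Prop :=
  MemSobolev 2 0 1 u ∧ ∃ u₀ : ℝ → ℂ, IsContinuousRep 0 0 1 u u₀ ∧ u₀ 0 = 0 ∧ u₀ 1 = 0

/-- The vector space underlying the energy space `[H²(0, 1) ∩ H¹₀(0, 1)] × L²(0, 1)`. -/
def energySpace : Submodule ℂ (L2 × L2) where
  carrier := {U | MemH2H10 U.1}
  zero_mem' := ⟨MemSobolev.zero.congr_ae (L2.ae_zero le_rfl le_rfl), 0,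
    IsContinuousRep.zero.congr_ae (L2.ae_zero le_rfl le_rfl), rfl, rfl⟩
  add_mem' := by
    rintro U V ⟨hU, u₀, hu, hu0, hu1⟩ ⟨hV, v₀, hv, hv0, hv1⟩
    exact ⟨(hU.add hV).congr_ae (L2.ae_add le_rfl le_rfl _ _), u₀ + v₀,
      (hu.add hv hU.integrableOn hV.integrableOn).congr_ae (L2.ae_add le_rfl le_rfl _ _),
      by simp [hu0, hv0], by simp [hu1, hv1]⟩
  smul_mem' := by
    rintro z U ⟨hU, u₀, hu, hu0, hu1⟩
    exact ⟨(hU.const_smul z).congr_ae (L2.ae_smul le_rfl le_rfl _ _), z • u₀,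
      (hu.const_smul z).congr_ae (L2.ae_smul le_rfl le_rfl _ _), by simp [hu0], by simp [hu1]⟩

/-- The conditions that define the domain of the beam operator. Here `u₀`, `v₀` are the continuous
representatives of `u`, `v` on `[0, 1]`, while `l₂`, `l₃` (resp. `r₂`, `r₃`) are those of `u_xx`,
`u_xxx` on `[0, ξ]` (resp. on `[ξ, 1]`), so that for instance `u_xxx(ξ⁻) = l₃ ξ` and
`u_xxx(ξ⁺) = r₃ ξ`. -/
def IsInBeamDomain (a α ξ : ℝ) (u v : ℝ → ℂ) : Prop :=
  MemSobolev 4 0 ξ u ∧ MemSobolev 4 ξ 1 u ∧ MemSobolev 2 0 1 u ∧ MemSobolev 2 0 1 v ∧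
  ∃ u₀ v₀ l₂ r₂ l₃ r₃ : ℝ → ℂ,
    IsContinuousRep 0 0 1 u u₀ ∧ IsContinuousRep 0 0 1 v v₀ ∧
    IsContinuousRep 2 0 ξ u l₂ ∧ IsContinuousRep 2 ξ 1 u r₂ ∧
    IsContinuousRep 3 0 ξ u l₃ ∧ IsContinuousRep 3 ξ 1 u r₃ ∧
    u₀ 0 = 0 ∧ v₀ 0 = 0 ∧ u₀ 1 = 0 ∧ v₀ 1 = 0 ∧
    l₂ 0 = 0 ∧ r₂ 1 = 0 ∧
    l₂ ξ = r₂ ξ ∧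
    r₃ ξ - l₃ ξ = -((α / a : ℝ) : ℂ) * v₀ ξ

/-- The domain of the beam operator, a subspace of the energy space. -/
def beamDomain (a α : ℝ) (ξ : Ioo (0 : ℝ) 1) : Submodule ℂ energySpace where
  carrier := {U | IsInBeamDomain a α ξ U.1.1 U.1.2}
  zero_mem' := by
    have z {c d : ℝ} := @L2.ae_zero c d
    have h0 := ξ.2.1.le
    have h1 := ξ.2.2.le
    exact ⟨MemSobolev.zero.congr_ae (z le_rfl h1), MemSobolev.zero.congr_ae (z h0 le_rfl),
      MemSobolev.zero.congr_ae (z le_rfl le_rfl), MemSobolev.zero.congr_ae (z le_rfl le_rfl),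
      0, 0, 0, 0, 0, 0, IsContinuousRep.zero.congr_ae (z le_rfl le_rfl),
      IsContinuousRep.zero.congr_ae (z le_rfl le_rfl), IsContinuousRep.zero.congr_ae (z le_rfl h1),
      IsContinuousRep.zero.congr_ae (z h0 le_rfl), IsContinuousRep.zero.congr_ae (z le_rfl h1),
      IsContinuousRep.zero.congr_ae (z h0 le_rfl), by simp⟩
  add_mem' := by
    rintro U V ⟨s1, s2, s3, s4, u₀, v₀, l₂, r₂, l₃, r₃, c1, c2, c3, c4, c5, c6, e1, e2, e3, e4,
      e5, e6, e7, e8⟩ ⟨s1', s2', s3', s4', u₀', v₀', l₂', r₂', l₃', r₃', c1', c2', c3', c4', c5',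
      c6', e1', e2', e3', e4', e5', e6', e7', e8'⟩
    have z {c d : ℝ} := @L2.ae_add c d
    have h0 := ξ.2.1.le
    have h1 := ξ.2.2.le
    refine ⟨(s1.add s1').congr_ae (z le_rfl h1 _ _), (s2.add s2').congr_ae (z h0 le_rfl _ _),
      (s3.add s3').congr_ae (z le_rfl le_rfl _ _), (s4.add s4').congr_ae (z le_rfl le_rfl _ _),
      u₀ + u₀', v₀ + v₀', l₂ + l₂', r₂ + r₂', l₃ + l₃', r₃ + r₃',
      (c1.add c1' s3.integrableOn s3'.integrableOn).congr_ae (z le_rfl le_rfl _ _),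
      (c2.add c2' s4.integrableOn s4'.integrableOn).congr_ae (z le_rfl le_rfl _ _),
      (c3.add c3' s1.integrableOn s1'.integrableOn).congr_ae (z le_rfl h1 _ _),
      (c4.add c4' s2.integrableOn s2'.integrableOn).congr_ae (z h0 le_rfl _ _),
      (c5.add c5' s1.integrableOn s1'.integrableOn).congr_ae (z le_rfl h1 _ _),
      (c6.add c6' s2.integrableOn s2'.integrableOn).congr_ae (z h0 le_rfl _ _),
      by simp [e1, e1'], by simp [e2, e2'], by simp [e3, e3'], by simp [e4, e4'],
      by simp [e5, e5'], by simp [e6, e6'], by simp [e7, e7'], ?_⟩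
    simp only [Pi.add_apply]
    linear_combination e8 + e8'
  smul_mem' := by
    rintro w U ⟨s1, s2, s3, s4, u₀, v₀, l₂, r₂, l₃, r₃, c1, c2, c3, c4, c5, c6, e1, e2, e3, e4,
      e5, e6, e7, e8⟩
    have z {c d : ℝ} := @L2.ae_smul c d
    have h0 := ξ.2.1.le
    have h1 := ξ.2.2.le
    refine ⟨(s1.const_smul w).congr_ae (z le_rfl h1 _ _),
      (s2.const_smul w).congr_ae (z h0 le_rfl _ _),
      (s3.const_smul w).congr_ae (z le_rfl le_rfl _ _),
      (s4.const_smul w).congr_ae (z le_rfl le_rfl _ _),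
      w • u₀, w • v₀, w • l₂, w • r₂, w • l₃, w • r₃,
      (c1.const_smul w).congr_ae (z le_rfl le_rfl _ _),
      (c2.const_smul w).congr_ae (z le_rfl le_rfl _ _),
      (c3.const_smul w).congr_ae (z le_rfl h1 _ _),
      (c4.const_smul w).congr_ae (z h0 le_rfl _ _),
      (c5.const_smul w).congr_ae (z le_rfl h1 _ _),
      (c6.const_smul w).congr_ae (z h0 le_rfl _ _),
      by simp [e1], by simp [e2], by simp [e3], by simp [e4],
      by simp [e5], by simp [e6], by simp [e7], ?_⟩
    simp only [Pi.smul_apply, smul_eq_mul]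
    linear_combination w * e8

/-- The identity `F = -a u_xxxx - b v - α v(ξ) δ_ξ` of distributions on `(0, 1)`. -/
def IsBeamImage (a b α ξ : ℝ) (u v F : ℝ → ℂ) : Prop :=
  ∃ v₀ : ℝ → ℂ, IsContinuousRep 0 0 1 v v₀ ∧
    ∀ φ : ℝ → ℝ, ContDiff ℝ ∞ φ → HasCompactSupport φ → tsupport φ ⊆ Ioo 0 1 →
      ∫ x in Ioo (0 : ℝ) 1, φ x • F x =
        -(a : ℂ) * (∫ x in Ioo (0 : ℝ) 1, iteratedDeriv 4 φ x • u x)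
          - b * (∫ x in Ioo (0 : ℝ) 1, φ x • v x) - α * (φ ξ • v₀ ξ)

theorem IsBeamImage.congr_ae {a b α ξ : ℝ} {u v F u' v' F' : ℝ → ℂ} (h : IsBeamImage a b α ξ u v F)
    (hu : u =ᵐ[volume.restrict (Ioo 0 1)] u') (hv : v =ᵐ[volume.restrict (Ioo 0 1)] v')
    (hF : F =ᵐ[volume.restrict (Ioo 0 1)] F') : IsBeamImage a b α ξ u' v' F' := by
  obtain ⟨v₀, c, e⟩ := h
  refine ⟨v₀, c.congr_ae hv, fun φ h1 h2 h3 => ?_⟩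
  have I (ψ : ℝ → ℝ) {g g' : ℝ → ℂ} (hg : g =ᵐ[volume.restrict (Ioo 0 1)] g') :
      ∫ x in Ioo (0 : ℝ) 1, ψ x • g' x = ∫ x in Ioo (0 : ℝ) 1, ψ x • g x :=
    integral_congr_ae (by filter_upwards [hg] with x hx; rw [hx])
  rw [I _ hu, I _ hv, I _ hF]
  exact e φ h1 h2 h3

/-- The graph of the beam operator `(u, v) ↦ (v, -a u_xxxx - b v - α v(ξ) δ_ξ)`. -/
def beamGraph (a b α : ℝ) (ξ : Ioo (0 : ℝ) 1) : Submodule ℂ (energySpace × energySpace) where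
  carrier := {p | p.1 ∈ beamDomain a α ξ ∧ p.2.1.1 = p.1.1.2 ∧
    IsBeamImage a b α ξ p.1.1.1 p.1.1.2 p.2.1.2}
  zero_mem' := by
    refine ⟨Submodule.zero_mem _, rfl, ?_⟩
    have z := L2.ae_zero (c := 0) (d := 1) le_rfl le_rfl
    exact IsBeamImage.congr_ae (u := 0) (v := 0) (F := 0)
      ⟨0, IsContinuousRep.zero, fun φ _ _ _ => by simp⟩ z z z
  add_mem' := by
    rintro p q ⟨hp, hp', v₀, c, e⟩ ⟨hq, hq', v₀', c', e'⟩
    refine ⟨Submodule.add_mem _ hp hq, congrArg₂ (· + ·) hp' hq', ?_⟩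
    have z := L2.ae_add (c := 0) (d := 1) le_rfl le_rfl
    have i := L2.integrableOn (c := 0) (d := 1) le_rfl le_rfl
    refine IsBeamImage.congr_ae ⟨v₀ + v₀', c.add c' (i _) (i _), fun φ h1 h2 h3 => ?_⟩
      (z _ _) (z _ _) (z _ _)
    have I {ψ : ℝ → ℝ} (hψ : Continuous ψ) (g g' : L2) :
        ∫ x in Ioo (0 : ℝ) 1, ψ x • (g + g' : ℝ → ℂ) x =
          (∫ x in Ioo (0 : ℝ) 1, ψ x • g x) + ∫ x in Ioo (0 : ℝ) 1, ψ x • g' x := by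
      simp only [Pi.add_apply, smul_add]
      exact integral_add (integrable_smooth_smul (i g) hψ) (integrable_smooth_smul (i g') hψ)
    rw [I h1.continuous, I h1.continuous, I (continuous_iteratedDeriv_of_smooth h1 4),
      e φ h1 h2 h3, e' φ h1 h2 h3, Pi.add_apply, smul_add]
    ring
  smul_mem' := by
    rintro w p ⟨hp, hp', v₀, c, e⟩
    refine ⟨Submodule.smul_mem _ _ hp, congrArg (w • ·) hp', ?_⟩
    have z := L2.ae_smul (c := 0) (d := 1) le_rfl le_rfl w
    refine IsBeamImage.congr_ae ⟨w • v₀, c.const_smul w, fun φ h1 h2 h3 => ?_⟩ (z _) (z _) (z _)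
    have I (ψ : ℝ → ℝ) (g : L2) : ∫ x in Ioo (0 : ℝ) 1, ψ x • (w • (g : ℝ → ℂ)) x =
        w * ∫ x in Ioo (0 : ℝ) 1, ψ x • g x := by
      simp only [Pi.smul_apply, smul_comm _ w]
      exact integral_smul w _
    rw [I, I, I, e φ h1 h2 h3, Pi.smul_apply, smul_comm, smul_eq_mul w]
    ring

/-- The graph is single-valued. -/
theorem beamGraph_singleValued (a b α : ℝ) (ξ : Ioo (0 : ℝ) 1) :
    ∀ p ∈ beamGraph a b α ξ, p.1 = 0 → p.2 = 0 := by
  rintro ⟨U, W⟩ ⟨-, h2, v₀, c, e⟩ hU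
  simp only at hU h2 c e
  subst hU
  have z := L2.ae_zero (c := 0) (d := 1) le_rfl le_rfl
  have hv : v₀ ξ = 0 :=
    (c.congr_ae z.symm).eqOn IsContinuousRep.zero one_pos (Ioo_subset_Icc_self ξ.2)
  have I (ψ : ℝ → ℝ) : ∫ x in Ioo (0 : ℝ) 1, ψ x • ((0 : L2) : ℝ → ℂ) x = 0 := by
    rw [← integral_zero (α := ℝ) (G := ℂ) (μ := volume.restrict (Ioo 0 1))]
    refine integral_congr_ae ?_
    filter_upwards [z] with x hx
    exact (congrArg (ψ x • ·) hx.symm).trans (smul_zero _)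
  have w : HasWeakDeriv 0 0 1 0 (W.1.2 : ℝ → ℂ) := by
    intro φ h1 h2 h3
    have e' := e φ h1 h2 h3
    have I1 := I φ
    have I4 := I (iteratedDeriv 4 φ)
    rw [hv, smul_zero, mul_zero, sub_zero] at e'
    erw [I1, I4] at e'
    rw [e']; simp
  have w' := w.ae_unique HasWeakDeriv.zero (L2.integrableOn le_rfl le_rfl _)
    (integrable_zero ℝ ℂ _)
  refine Subtype.ext (Prod.ext h2 (Lp.ext (w'.trans z)))

/-- The beam operator `𝒜(u, v) = (v, -a u_xxxx - b v - α v(ξ) δ_ξ)`, as an unbounded (partially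
defined) linear operator on the energy space. -/
noncomputable def beamOperator (a b α : ℝ) (ξ : Ioo (0 : ℝ) 1) : energySpace →ₗ.[ℂ] energySpace :=
  (beamGraph a b α ξ).toLinearPMap

theorem beamOperator_graph (a b α : ℝ) (ξ : Ioo (0 : ℝ) 1) :
    (beamOperator a b α ξ).graph = beamGraph a b α ξ :=
  Submodule.toLinearPMap_graph_eq _ (beamGraph_singleValued a b α ξ)

/-- The domain of the beam operator is exactly `beamDomain`: the jump condition on `u_xxx` makes the
Dirac masses cancel, so that `-a u_xxxx - b v - α v(ξ) δ_ξ` is square integrable. -/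
theorem beamOperator_domain {a : ℝ} (ha : 0 < a) (b α : ℝ) (ξ : Ioo (0 : ℝ) 1) :
    (beamOperator a b α ξ).domain = beamDomain a α ξ := by
  refine le_antisymm ?_ ?_
  · rintro U ⟨p, hp, rfl⟩
    exact hp.1
  intro U hU
  obtain ⟨s1, s2, s3, s4, u₀, v₀, l₂, r₂, l₃, r₃, c1, c2, c3, c4, c5, c6, e1, e2, e3, e4,
    e5, e6, e7, e8⟩ := hU
  have h0 := ξ.2.1
  have h1 := ξ.2.2
  obtain ⟨x, hx⟩ := ξ
  simp only at *
  obtain ⟨gl, hgl, wl⟩ := s1.2 4 le_rfl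
  obtain ⟨gr, hgr, wr⟩ := s2.2 4 le_rfl
  obtain ⟨g₂, hg₂, w₂⟩ := s3.2 2 le_rfl
  have split (F : ℝ → ℂ) (hF : IntegrableOn F (Ioo 0 1)) : ∫ t in Ioo (0 : ℝ) 1, F t =
      (∫ t in Ioo 0 x, F t) + ∫ t in Ioo x 1, F t := by
    have hI {c d : ℝ} (hc : 0 ≤ c) (hd : d ≤ 1) (hcd : c ≤ d) : IntervalIntegrable F volume c d :=
      (intervalIntegrable_iff_integrableOn_Ioo_of_le hcd).2 (hF.mono_set (Ioo_subset_Ioo hc hd))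
    rw [← integral_Ioc_eq_integral_Ioo, ← integral_Ioc_eq_integral_Ioo,
      ← integral_Ioc_eq_integral_Ioo, ← intervalIntegral.integral_of_le zero_le_one,
      ← intervalIntegral.integral_of_le h0.le, ← intervalIntegral.integral_of_le h1.le]
    exact (intervalIntegral.integral_add_adjacent_intervals (hI le_rfl h1.le h0.le)
      (hI h0.le le_rfl h1.le)).symm
  -- the piecewise fourth derivative
  set w : ℝ → ℂ := (Iio x).indicator gl + (Ici x).indicator gr with hw
  have hwl : ∀ t ∈ Ioo 0 x, w t = gl t := fun t ht => by simp [hw, ht.2]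
  have hwr : ∀ t ∈ Ioo x 1, w t = gr t := fun t ht => by simp [hw, ht.1.le]
  have hwm : MemLp w 2 (volume.restrict (Ioo 0 1)) := by
    refine MemLp.add ?_ ?_
    · rw [memLp_indicator_iff_restrict measurableSet_Iio, Measure.restrict_restrict
        measurableSet_Iio]
      refine hgl.mono_measure (Measure.restrict_mono ?_ le_rfl)
      rintro t ⟨ht, ht'⟩
      exact ⟨ht'.1, ht⟩
    · rw [memLp_indicator_iff_restrict measurableSet_Ici, Measure.restrict_restrict
        measurableSet_Ici]
      have : Ici x ∩ Ioo 0 1 = Ico x 1 := by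
        ext t; simp only [mem_inter_iff, mem_Ici, mem_Ioo, mem_Ico]
        exact ⟨fun h => ⟨h.1, h.2.2⟩, fun h => ⟨h.1, h0.trans_le h.1, h.2⟩⟩
      rw [this, restrict_Ico_eq_restrict_Ioc, ← restrict_Ioo_eq_restrict_Ioc]
      exact hgr
  have hwi : IntegrableOn w (Ioo 0 1) := hwm.integrable (by norm_num)
  have hgli : IntegrableOn gl (Ioo 0 x) := hgl.integrable (by norm_num)
  have hgri : IntegrableOn gr (Ioo x 1) := hgr.integrable (by norm_num)
  have hg₂i : IntegrableOn g₂ (Ioo 0 1) := hg₂.integrable (by norm_num)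
  have hgl₂ : g₂ =ᵐ[volume.restrict (Ioo 0 x)] l₂ := (w₂.mono le_rfl h1.le).ae_unique c3.2
    (hg₂i.mono_set (Ioo_subset_Ioo le_rfl h1.le)) c3.integrableOn
  have hgr₂ : g₂ =ᵐ[volume.restrict (Ioo x 1)] r₂ := (w₂.mono h0.le le_rfl).ae_unique c4.2
    (hg₂i.mono_set (Ioo_subset_Ioo h0.le le_rfl)) c4.integrableOn
  set v : L2 := U.1.2 with hv
  have hFm : MemLp ((-(a : ℂ)) • w + (-(b : ℂ)) • (v : ℝ → ℂ)) 2 (volume.restrict (Ioo 0 1)) :=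
    (hwm.const_smul _).add ((Lp.memLp v).const_smul _)
  refine ⟨⟨U, ⟨(v, hFm.toLp _), s4, v₀, c2, e2, e4⟩⟩, ⟨?_, rfl, ?_⟩, rfl⟩
  · exact ⟨s1, s2, s3, s4, u₀, v₀, l₂, r₂, l₃, r₃, c1, c2, c3, c4, c5, c6, e1, e2, e3, e4,
      e5, e6, e7, e8⟩
  refine IsBeamImage.congr_ae ?_ Filter.EventuallyEq.rfl Filter.EventuallyEq.rfl
    hFm.coeFn_toLp.symm
  refine ⟨v₀, c2, fun φ f1 f2 f3 => ?_⟩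
  have smooth_deriv {ψ : ℝ → ℝ} (hψ : ContDiff ℝ ∞ ψ) : ContDiff ℝ ∞ (deriv ψ) :=
    (contDiff_infty_iff_deriv.1 hψ).2
  have d1 := smooth_deriv f1
  have d2 := smooth_deriv d1
  have z (ψ : ℝ → ℝ) (hψ : tsupport ψ ⊆ Ioo 0 1) : ψ 0 = 0 ∧ ψ 1 = 0 :=
    ⟨image_eq_zero_of_notMem_tsupport fun h' => lt_irrefl _ (hψ h').1,
      image_eq_zero_of_notMem_tsupport fun h' => lt_irrefl _ (hψ h').2⟩
  have t1 : tsupport (deriv φ) ⊆ Ioo 0 1 := tsupport_deriv_subset.trans f3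
  have t2 : tsupport (deriv (deriv φ)) ⊆ Ioo 0 1 := tsupport_deriv_subset.trans t1
  have k1 := w₂ (deriv (deriv φ)) d2 f2.deriv.deriv t2
  have k2 : iteratedDeriv 2 (deriv (deriv φ)) = iteratedDeriv 4 φ := by
    rw [← iteratedDeriv_succ', ← iteratedDeriv_succ']
  have J1 : ∫ t in Ioo 0 x, deriv (deriv φ) t • g₂ t
      = ∫ t in Ioo 0 x, deriv (deriv φ) t • l₂ t :=
    integral_congr_ae (by filter_upwards [hgl₂] with t ht; rw [ht])
  have J2 : ∫ t in Ioo x 1, deriv (deriv φ) t • g₂ t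
      = ∫ t in Ioo x 1, deriv (deriv φ) t • r₂ t :=
    integral_congr_ae (by filter_upwards [hgr₂] with t ht; rw [ht])
  have J3 : ∫ t in Ioo 0 x, φ t • w t = ∫ t in Ioo 0 x, φ t • gl t :=
    setIntegral_congr_fun measurableSet_Ioo (fun t ht => by simp only [hwl t ht])
  have J4 : ∫ t in Ioo x 1, φ t • w t = ∫ t in Ioo x 1, φ t • gr t :=
    setIntegral_congr_fun measurableSet_Ioo (fun t ht => by simp only [hwr t ht])
  rw [k2, split _ (integrable_smooth_smul hg₂i d2.continuous), J1, J2,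
    c3.integral_deriv_smul h0 c5.2 c5.integrableOn d1,
    c4.integral_deriv_smul h1 c6.2 c6.integrableOn d1,
    c5.integral_deriv_smul h0 wl hgli f1, c6.integral_deriv_smul h1 wr hgri f1,
    (z _ t1).1, (z _ t1).2, (z _ f3).1, (z _ f3).2, ← J3, ← J4, e7] at k1
  have k3 := split _ (integrable_smooth_smul hwi f1.continuous)
  have hvi : IntegrableOn v (Ioo 0 1) := L2.integrableOn le_rfl le_rfl v
  have k4 : ∫ t in Ioo (0 : ℝ) 1, φ t • ((-(a : ℂ)) • w + (-(b : ℂ)) • (v : ℝ → ℂ)) t =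
      -(a : ℂ) * (∫ t in Ioo (0 : ℝ) 1, φ t • w t) - b * ∫ t in Ioo (0 : ℝ) 1, φ t • v t := by
    have i1 : Integrable (fun t => -(a : ℂ) • φ t • w t) (volume.restrict (Ioo 0 1)) :=
      (integrable_smooth_smul hwi f1.continuous).smul (-(a : ℂ))
    have i2 : Integrable (fun t => -(b : ℂ) • φ t • v t) (volume.restrict (Ioo 0 1)) :=
      (integrable_smooth_smul hvi f1.continuous).smul (-(b : ℂ))
    rw [sub_eq_add_neg, ← neg_mul, ← smul_eq_mul, ← smul_eq_mul, ← integral_smul,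
      ← integral_smul, ← integral_add i1 i2]
    refine integral_congr_ae (Filter.Eventually.of_forall fun t => ?_)
    simp only [Pi.add_apply, Pi.smul_apply, smul_add, smul_comm (φ t)]
  have ha' : (a : ℂ) ≠ 0 := by exact_mod_cast ha.ne'
  have e9 : (a : ℂ) * (r₃ x - l₃ x) = -(α * v₀ x) := by
    rw [e8]; push_cast; field_simp
  rw [k4, k1, k3]
  simp only [Complex.real_smul, Complex.ofReal_zero]
  linear_combination (φ x : ℂ) * e9

/-- The kernel of `(T - μ)^k` for a partially defined operator `T`, where `(T - μ)^(k+1) x = 0`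
means that `x` belongs to the domain of `T` and `(T - μ)^k (T x - μ x) = 0`. -/
def kerPow {E : Type*} [AddCommGroup E] [Module ℂ E] (T : E →ₗ.[ℂ] E) (μ : ℂ) : ℕ → Submodule ℂ E
  | 0 => ⊥
  | k + 1 => ((kerPow T μ k).comap (T.toFun - μ • T.domain.subtype)).map T.domain.subtype

/-- The eigenspace of `T` for `μ`: the vectors `x` of the domain with `T x = μ x`. -/
def eigenspaceOf {E : Type*} [AddCommGroup E] [Module ℂ E] (T : E →ₗ.[ℂ] E) (μ : ℂ) :
    Submodule ℂ E :=
  kerPow T μ 1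

theorem mem_eigenspaceOf {E : Type*} [AddCommGroup E] [Module ℂ E] {T : E →ₗ.[ℂ] E} {μ : ℂ}
    {x : E} : x ∈ eigenspaceOf T μ ↔ ∃ h : x ∈ T.domain, T ⟨x, h⟩ = μ • x := by
  simp only [eigenspaceOf, kerPow, Submodule.mem_map, Submodule.mem_comap, Submodule.mem_bot,
    LinearMap.sub_apply, LinearMap.smul_apply, Submodule.subtype_apply, sub_eq_zero]
  constructor
  · rintro ⟨y, hy, rfl⟩
    exact ⟨y.2, hy⟩
  · rintro ⟨h, hx⟩
    exact ⟨⟨x, h⟩, hx, rfl⟩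

/-- The generalized eigenspace (root subspace) of `T` for `μ`. -/
def rootSpaceOf {E : Type*} [AddCommGroup E] [Module ℂ E] (T : E →ₗ.[ℂ] E) (μ : ℂ) :
    Submodule ℂ E :=
  ⨆ k : ℕ, kerPow T μ k

/-- `μ` is an eigenvalue of `T`. -/
def IsEigenvalueOf {E : Type*} [AddCommGroup E] [Module ℂ E] (T : E →ₗ.[ℂ] E) (μ : ℂ) : Prop :=
  ∃ x : T.domain, (x : E) ≠ 0 ∧ T x = μ • (x : E)

/-- The geometric multiplicity of `μ`: the dimension of the eigenspace. -/
noncomputable def geomMult {E : Type*} [AddCommGroup E] [Module ℂ E] (T : E →ₗ.[ℂ] E) (μ : ℂ) :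
    Cardinal :=
  Module.rank ℂ (eigenspaceOf T μ)

/-- The algebraic multiplicity of `μ`: the dimension of the generalized eigenspace. -/
noncomputable def algMult {E : Type*} [AddCommGroup E] [Module ℂ E] (T : E →ₗ.[ℂ] E) (μ : ℂ) :
    Cardinal :=
  Module.rank ℂ (rootSpaceOf T μ)

/-!
Away from `ξ` the damper is invisible, so an eigenfunction solves `u'''' = λ⁴ u` on either side of
`ξ`, and the hinged ends leave a combination of `sinh` and `sin` on each side. Since `ξ` is
irrational, `sin (λ ξ)` and `sin (λ (1 - ξ))` do not both vanish for `λ ≠ 0`, and the conditions at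
`ξ` then leave a single mode, subject to the characteristic equation
`2 a λ³ sinh λ sin λ = α μ (sin λ sinh (λ ξ) sinh (λ (1 - ξ)) - sinh λ sin (λ ξ) sin (λ (1 - ξ)))`.

The equation is invariant under `λ ↦ i λ`, so one may assume `|Im λ| ≤ Re λ`. Division by `sinh λ`
turns it into `sin λ = ε (O(|sin λ|) - sin (λ ξ) sin (λ (1 - ξ)))` with
`ε = α μ / (2 a λ³) = O(1 / |λ|)`, because `μ ∼ ± i √a λ²`. Hence `λ` lies within `O(1 / |λ|)` of
some `n π`; conversely, for each sign of `Im μ`, a contraction argument gives exactly one solution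
near every large `n π`.

By Green's formula a Jordan chain over `μ` would force `(2 μ + b) ∫ u² + α u(ξ)² = 0`, which fails
for large `μ` since the first term dominates.
-/

theorem continuousOn_primitive_of_integrableOn_Ioo {c d : ℝ} {q : ℝ → ℂ} (hcd : c ≤ d)
    (hq : IntegrableOn q (Ioo c d)) : ContinuousOn (fun x => ∫ t in c..x, q t) (Icc c d) := by
  rw [← integrableOn_Icc_iff_integrableOn_Ioo, ← uIcc_of_le hcd] at hq
  exact uIcc_of_le hcd ▸ intervalIntegral.continuousOn_primitive_interval hq

namespace HasWeakDeriv
variable {k : ℕ} {c d : ℝ} {f p q : ℝ → ℂ}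

theorem order_zero (c d : ℝ) (f : ℝ → ℂ) : HasWeakDeriv 0 c d f f := fun φ _ _ _ => by simp

theorem succ_iff (hp : HasWeakDeriv k c d f p) :
    HasWeakDeriv (k + 1) c d f q ↔ HasWeakDeriv 1 c d p q := by
  refine forall_congr' fun φ => forall_congr' fun hφ => forall_congr' fun hφc =>
    forall_congr' fun hφs => ?_
  have hp' := hp (deriv φ) (contDiff_infty_iff_deriv.1 hφ).2 hφc.deriv
    (tsupport_deriv_subset.trans hφs)
  rw [iteratedDeriv_succ', hp', iteratedDeriv_one, pow_one, pow_succ, mul_assoc]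
  exact mul_right_inj' (pow_ne_zero k (by norm_num))

theorem of_hasDerivAt_off_countable (hcd : c ≤ d) {s : Set ℝ} (hs : s.Countable)
    (hp : ContinuousOn p (Icc c d)) (hpq : ∀ x ∈ Ioo c d \ s, HasDerivAt p (q x) x)
    (hq : IntegrableOn q (Ioo c d)) : HasWeakDeriv 1 c d p q := by
  intro φ hφ _ hφs
  have hφ' : Continuous (deriv φ) := hφ.continuous_deriv (by exact_mod_cast le_top)
  have int_p := integrable_smooth_smul (hp.integrableOn_Icc.mono_set Ioo_subset_Icc_self) hφ'
  have int_q := integrable_smooth_smul hq hφ.continuous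
  have hφp : ∀ x ∈ Ioo c d \ s,
      HasDerivAt (fun x => φ x • p x) (deriv φ x • p x + φ x • q x) x := fun x hx => by
    rw [add_comm]
    exact ((hφ.differentiable (by simp)) x).hasDerivAt.smul (hpq x hx)
  have ftc := integral_eq_of_hasDerivAt_off_countable_of_le (fun x => φ x • p x) _ hcd hs
    (hφ.continuous.continuousOn.smul hp) hφp
    ((intervalIntegrable_iff_integrableOn_Ioo_of_le hcd).2 (int_p.add int_q))
  have φ_c : φ c = 0 := image_eq_zero_of_notMem_tsupport fun hc => lt_irrefl _ (hφs hc).1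
  have φ_d : φ d = 0 := image_eq_zero_of_notMem_tsupport fun hd => lt_irrefl _ (hφs hd).2
  rw [intervalIntegral.integral_of_le hcd, integral_Ioc_eq_integral_Ioo, integral_add int_p int_q,
    φ_c, φ_d, zero_smul, zero_smul, sub_zero] at ftc
  rw [iteratedDeriv_one, pow_one]
  linear_combination ftc

theorem primitive (hcd : c ≤ d) (hq : IntegrableOn q (Ioo c d)) :
    HasWeakDeriv 1 c d (fun x => ∫ t in c..x, q t) q := by
  intro φ hφ _ hφs
  have φ_d : φ d = 0 := image_eq_zero_of_notMem_tsupport fun hd => lt_irrefl _ (hφs hd).2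
  have parts :=
    integral_primitive ((intervalIntegrable_iff_integrableOn_Ioo_of_le hcd).2 hq) hφ
  simpa [intervalIntegral.integral_of_le hcd, integral_Ioc_eq_integral_Ioo, φ_d] using parts

theorem exists_ae_eq_primitive (h : HasWeakDeriv 1 c d p q) (hcd : c < d)
    (hp : IntegrableOn p (Ioo c d)) (hq : IntegrableOn q (Ioo c d)) :
    ∃ C : ℂ, p =ᵐ[volume.restrict (Ioo c d)] fun x => C + ∫ t in c..x, q t := by
  have int_Q : IntegrableOn ((-1 : ℂ) • fun x => ∫ t in c..x, q t) (Ioo c d) :=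
    ((continuousOn_primitive_of_integrableOn_Ioo hcd.le hq).integrableOn_Icc.mono_set
      Ioo_subset_Icc_self).smul _
  have deriv_zero : HasWeakDeriv 1 c d (p + (-1 : ℂ) • fun x => ∫ t in c..x, q t) 0 := by
    simpa using h.add ((primitive hcd.le hq).const_smul (-1)) hp int_Q hq (hq.smul (-1 : ℂ))
  obtain ⟨C, hC⟩ := deriv_zero.exists_const hcd (hp.add int_Q)
  refine ⟨C, ?_⟩
  filter_upwards [hC] with x hx
  simp only [Pi.add_apply, Pi.smul_apply, smul_eq_mul] at hx
  linear_combination hx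

theorem exists_isContinuousRep_primitive (hp : HasWeakDeriv k c d f p)
    (hq : HasWeakDeriv (k + 1) c d f q) (hcd : c < d) (hpi : IntegrableOn p (Ioo c d))
    (hqi : IntegrableOn q (Ioo c d)) :
    ∃ C : ℂ, IsContinuousRep k c d f fun x => C + ∫ t in c..x, q t := by
  obtain ⟨C, hC⟩ := (hp.succ_iff.1 hq).exists_ae_eq_primitive hcd hpi hqi
  exact ⟨C, continuousOn_const.add (continuousOn_primitive_of_integrableOn_Ioo hcd.le hqi),
    hp.congr_ae .rfl hC⟩

end HasWeakDeriv

theorem MemSobolev.exists_isContinuousRep {m k : ℕ} {c d : ℝ} {f : ℝ → ℂ} (h : MemSobolev m c d f)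
    (hk : k < m) (hcd : c < d) : ∃ g, IsContinuousRep k c d f g := by
  obtain ⟨p, hp, wp⟩ := h.2 k hk.le
  obtain ⟨q, hq, wq⟩ := h.2 (k + 1) hk
  obtain ⟨C, hC⟩ := wp.exists_isContinuousRep_primitive wq hcd (hp.integrable (by norm_num))
    (hq.integrable (by norm_num))
  exact ⟨_, hC⟩

theorem memLp_two_of_continuousOn_Icc {c d : ℝ} {f : ℝ → ℂ} (hf : ContinuousOn f (Icc c d)) :
    MemLp f 2 (volume.restrict (Ioo c d)) := by
  obtain ⟨C, hC⟩ := (isCompact_Icc (a := c) (b := d)).exists_bound_of_continuousOn hf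
  refine MemLp.of_bound ((hf.mono Ioo_subset_Icc_self).aestronglyMeasurable measurableSet_Ioo) C ?_
  filter_upwards [ae_restrict_mem measurableSet_Ioo] with x hx using hC x (Ioo_subset_Icc_self hx)

theorem ae_restrict_Ioo_mono {P : ℝ → Prop} {c d c' d' : ℝ} (hc : c ≤ c') (hd : d' ≤ d)
    (h : ∀ᵐ x ∂volume.restrict (Ioo c d), P x) : ∀ᵐ x ∂volume.restrict (Ioo c' d'), P x :=
  ae_mono (Measure.restrict_mono (Ioo_subset_Ioo hc hd) le_rfl) h

theorem ae_restrict_Ioo_of_ae_pieces {c ξ d : ℝ} {P : ℝ → Prop}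
    (hl : ∀ᵐ x ∂volume.restrict (Ioo c ξ), P x) (hr : ∀ᵐ x ∂volume.restrict (Ioo ξ d), P x) :
    ∀ᵐ x ∂volume.restrict (Ioo c d), P x := by
  rw [ae_restrict_iff' measurableSet_Ioo] at hl hr ⊢
  filter_upwards [hl, hr, Measure.ae_ne volume ξ] with x hxl hxr hx hxcd
  rcases lt_or_gt_of_ne hx with h | h
  · exact hxl ⟨hxcd.1, h⟩
  · exact hxr ⟨h, hxcd.2⟩

namespace IsContinuousRep
variable {k : ℕ} {c d : ℝ} {f p q : ℝ → ℂ}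

theorem of_continuousOn (hf : ContinuousOn f (Icc c d)) : IsContinuousRep 0 c d f f :=
  ⟨hf, .order_zero c d f⟩

theorem mono (h : IsContinuousRep k c d f p) {c' d' : ℝ} (hc : c ≤ c') (hd : d' ≤ d) :
    IsContinuousRep k c' d' f p :=
  ⟨h.1.mono (Icc_subset_Icc hc hd), h.2.mono hc hd⟩

theorem ae_eq (h : IsContinuousRep 0 c d f p) (hf : IntegrableOn f (Ioo c d)) :
    f =ᵐ[volume.restrict (Ioo c d)] p :=
  (HasWeakDeriv.order_zero c d f).ae_unique h.2 hf h.integrableOn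

theorem congr_eqOn (h : IsContinuousRep k c d f p) (hpq : EqOn p q (Icc c d)) :
    IsContinuousRep k c d f q := by
  refine ⟨h.1.congr hpq.symm, h.2.congr_ae .rfl ?_⟩
  filter_upwards [ae_restrict_mem measurableSet_Ioo] with x hx using hpq (Ioo_subset_Icc_self hx)

theorem hasDerivAt (hp : IsContinuousRep k c d f p) (hq : IsContinuousRep (k + 1) c d f q) {x : ℝ}
    (hx : x ∈ Ioo c d) : HasDerivAt p (q x) x := by
  have hcd : c < d := hx.1.trans hx.2
  have hIcc : Icc c d ∈ nhds x := Icc_mem_nhds hx.1 hx.2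
  obtain ⟨C, hC⟩ :=
    hp.2.exists_isContinuousRep_primitive hq.2 hcd hp.integrableOn hq.integrableOn
  have hqI : IntervalIntegrable q volume c x :=
    (hq.1.mono (by rw [uIcc_of_le hx.1.le]; exact Icc_subset_Icc le_rfl hx.2.le)).intervalIntegrable
  have deriv_primitive : HasDerivAt (fun x => ∫ t in c..x, q t) (q x) x :=
    intervalIntegral.integral_hasDerivAt_right hqI
      ((hq.1.mono Ioo_subset_Icc_self).stronglyMeasurableAtFilter isOpen_Ioo x hx)
      (hq.1.continuousAt hIcc)
  exact (deriv_primitive.const_add C).congr_of_eventuallyEq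
    (Filter.eventuallyEq_of_mem hIcc (hp.eqOn hC hcd))

end IsContinuousRep

theorem memSobolev_of_isContinuousRep {c d : ℝ} {m : ℕ} {f : ℝ → ℂ} {g : ℕ → ℝ → ℂ}
    (hf : MemLp f 2 (volume.restrict (Ioo c d))) (h : ∀ k ≤ m, IsContinuousRep k c d f (g k)) :
    MemSobolev m c d f :=
  ⟨hf, fun k hk => ⟨g k, memLp_two_of_continuousOn_Icc (h k hk).1, (h k hk).2⟩⟩

theorem isContinuousRep_of_hasDerivAt_off_countable {m : ℕ} {c d : ℝ} (hcd : c ≤ d) {s : Set ℝ}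
    (hs : s.Countable) {p : ℕ → ℝ → ℂ} (hc : ∀ k ≤ m, ContinuousOn (p k) (Icc c d))
    (hd : ∀ k < m, ∀ x ∈ Ioo c d \ s, HasDerivAt (p k) (p (k + 1) x) x) :
    ∀ k ≤ m, IsContinuousRep k c d (p 0) (p k)
  | 0, hk => .of_continuousOn (hc 0 hk)
  | k + 1, hk => by
    have rep_k := isContinuousRep_of_hasDerivAt_off_countable hcd hs hc hd k (by omega)
    exact ⟨hc _ hk, rep_k.2.succ_iff.2 <| .of_hasDerivAt_off_countable hcd hs rep_k.1 (hd k hk) <|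
      (hc _ hk).integrableOn_Icc.mono_set Ioo_subset_Icc_self⟩

/-- `p 0, p 1, …, p m` are successive derivatives on `(c, d)`, all continuous up to the boundary:
`p 0` is a function of class `C^m` on `[c, d]` and `p k` is its `k`-th derivative. Recording the
derivatives as data makes their one-sided boundary values available. -/
structure IsDerivChain (m : ℕ) (c d : ℝ) (p : ℕ → ℝ → ℂ) : Prop where
  continuousOn : ∀ k ≤ m, ContinuousOn (p k) (Icc c d)
  hasDerivAt : ∀ k < m, ∀ x ∈ Ioo c d, HasDerivAt (p k) (p (k + 1) x) x

/-- The derivatives of `x ↦ p 0 (1 - x)`, given the derivatives `p k` of `p 0`. -/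
def reflectChain (p : ℕ → ℝ → ℂ) (k : ℕ) (x : ℝ) : ℂ :=
  (-1) ^ k * p k (1 - x)

/-- The derivatives of the function that is `p 0` up to `ξ` and `r 0` from there on. -/
noncomputable def glueChain (ξ : ℝ) (p r : ℕ → ℝ → ℂ) (k : ℕ) (x : ℝ) : ℂ :=
  if x ≤ ξ then p k x else r k x

@[simp]
theorem reflectChain_zero (p : ℕ → ℝ → ℂ) : reflectChain p 0 = fun x => p 0 (1 - x) := by
  funext x
  simp [reflectChain]

theorem glueChain_of_le {ξ : ℝ} (p r : ℕ → ℝ → ℂ) (k : ℕ) {x : ℝ} (hx : x ≤ ξ) :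
    glueChain ξ p r k x = p k x := if_pos hx

theorem glueChain_of_gt {ξ : ℝ} (p r : ℕ → ℝ → ℂ) (k : ℕ) {x : ℝ} (hx : ξ < x) :
    glueChain ξ p r k x = r k x := if_neg hx.not_ge

theorem glueChain_of_ge {ξ : ℝ} {p r : ℕ → ℝ → ℂ} {k : ℕ} (hk : p k ξ = r k ξ) {x : ℝ}
    (hx : ξ ≤ x) : glueChain ξ p r k x = r k x := by
  rcases hx.eq_or_lt with rfl | hx
  · rw [glueChain_of_le p r k le_rfl, hk]
  · exact glueChain_of_gt p r k hx

namespace IsDerivChain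
variable {m : ℕ} {c d : ℝ} {p r : ℕ → ℝ → ℂ}

theorem isContinuousRep (h : IsDerivChain m c d p) (hcd : c ≤ d) :
    ∀ k ≤ m, IsContinuousRep k c d (p 0) (p k) :=
  isContinuousRep_of_hasDerivAt_off_countable hcd countable_empty h.continuousOn
    fun k hk x hx => h.hasDerivAt k hk x hx.1

theorem of_isContinuousRep {f : ℝ → ℂ} (h : ∀ k ≤ m, IsContinuousRep k c d f (p k)) :
    IsDerivChain m c d p :=
  ⟨fun k hk => (h k hk).1, fun k hk _ hx => (h k hk.le).hasDerivAt (h (k + 1) hk) hx⟩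

theorem eqOn_zero (h : IsDerivChain m c d p) (hcd : c < d) (h0 : EqOn (p 0) 0 (Icc c d)) :
    ∀ k ≤ m, EqOn (p k) 0 (Icc c d) := fun k hk =>
  ((h.isContinuousRep hcd.le k hk).congr_ae
    (by filter_upwards [ae_restrict_mem measurableSet_Ioo] with x hx
        using h0 (Ioo_subset_Icc_self hx))).eqOn .zero hcd

theorem reflect (h : IsDerivChain m c d p) : IsDerivChain m (1 - d) (1 - c) (reflectChain p) where
  continuousOn k hk := continuousOn_const.mul <| (h.continuousOn k hk).comp (by fun_prop)
    fun x hx => ⟨by linarith [hx.2], by linarith [hx.1]⟩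
  hasDerivAt k hk x hx := by
    have := (HasDerivAt.comp_const_sub 1 x (h.hasDerivAt k hk (1 - x)
      ⟨by linarith [hx.2], by linarith [hx.1]⟩)).const_mul ((-1 : ℂ) ^ k)
    exact this.congr_deriv (by simp only [reflectChain, pow_succ]; ring)

theorem isContinuousRep_glueChain {ξ : ℝ} (hp : IsDerivChain m c ξ p) (hr : IsDerivChain m ξ d r)
    (hc : c ≤ ξ) (hd : ξ ≤ d) (match_ξ : ∀ k ≤ m, p k ξ = r k ξ) :
    ∀ k ≤ m, IsContinuousRep k c d (glueChain ξ p r 0) (glueChain ξ p r k) := by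
  refine isContinuousRep_of_hasDerivAt_off_countable (hc.trans hd) (countable_singleton ξ)
    (fun k hk => ?_) ?_
  · rw [← Icc_union_Icc_eq_Icc hc hd]
    exact ((hp.continuousOn k hk).congr fun x hx => glueChain_of_le p r k hx.2).union_of_isClosed
      ((hr.continuousOn k hk).congr fun x hx => glueChain_of_ge (match_ξ k hk) hx.1)
      isClosed_Icc isClosed_Icc
  · rintro k hk x ⟨hx, hxξ⟩
    rcases lt_or_gt_of_ne hxξ with h | h
    · rw [glueChain_of_le p r _ h.le]
      exact (hp.hasDerivAt k hk x ⟨hx.1, h⟩).congr_of_eventuallyEq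
        (Filter.eventuallyEq_of_mem (Iic_mem_nhds h) fun y hy => glueChain_of_le p r k hy)
    · rw [glueChain_of_gt p r _ h]
      exact (hr.hasDerivAt k hk x ⟨h, hx.2⟩).congr_of_eventuallyEq
        (Filter.eventuallyEq_of_mem (Ioi_mem_nhds h) fun y hy => glueChain_of_gt p r k hy)

end IsDerivChain

theorem L2.ext_of_ae_eq_pieces {ξ : ℝ} {f g : L2}
    (hl : (f : ℝ → ℂ) =ᵐ[volume.restrict (Ioo 0 ξ)] g)
    (hr : (f : ℝ → ℂ) =ᵐ[volume.restrict (Ioo ξ 1)] g) : f = g :=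
  Lp.ext (ae_restrict_Ioo_of_ae_pieces hl hr)

theorem setIntegral_Ioo_eq_of_tsupport_subset {c d c' d' : ℝ} (hc : c ≤ c') (hd : d' ≤ d)
    {φ : ℝ → ℝ} (hφ : tsupport φ ⊆ Ioo c' d') (f : ℝ → ℂ) :
    ∫ x in Ioo c d, φ x • f x = ∫ x in Ioo c' d', φ x • f x := by
  refine setIntegral_eq_of_subset_of_forall_sdiff_eq_zero measurableSet_Ioo
    (Ioo_subset_Ioo hc hd) fun x hx => ?_
  rw [image_eq_zero_of_notMem_tsupport (fun hx' => hx.2 (hφ hx')), zero_smul]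

/-- Away from `ξ` the Dirac mass in the definition of the operator is not seen. -/
theorem IsBeamImage.hasWeakDeriv {a b α ξ : ℝ} {u v F : ℝ → ℂ} (h : IsBeamImage a b α ξ u v F)
    (ha : a ≠ 0) {c d : ℝ} (hc : 0 ≤ c) (hd : d ≤ 1) (hξ : ξ ∉ Ioo c d)
    (hv : IntegrableOn v (Ioo c d)) (hF : IntegrableOn F (Ioo c d)) :
    HasWeakDeriv 4 c d u (-(a : ℂ)⁻¹ • (F + (b : ℂ) • v)) := by
  obtain ⟨v₀, -, image⟩ := h
  intro φ hφ hφc hφs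
  have hφF := image φ hφ hφc (hφs.trans (Ioo_subset_Ioo hc hd))
  have φ_ξ : φ ξ = 0 := image_eq_zero_of_notMem_tsupport fun hx => hξ (hφs hx)
  rw [φ_ξ, setIntegral_Ioo_eq_of_tsupport_subset hc hd hφs,
    setIntegral_Ioo_eq_of_tsupport_subset hc hd hφs,
    setIntegral_Ioo_eq_of_tsupport_subset hc hd
      ((tsupport_iteratedDeriv_subset' φ 4).trans hφs)] at hφF
  have ha' : (a : ℂ) ≠ 0 := by exact_mod_cast ha
  have split : ∫ x in Ioo c d, φ x • (-(a : ℂ)⁻¹ • (F + (b : ℂ) • v)) x =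
      -(a : ℂ)⁻¹ * ((∫ x in Ioo c d, φ x • F x) + b * ∫ x in Ioo c d, φ x • v x) := by
    rw [← integral_const_mul, ← integral_add (integrable_smooth_smul hF hφ.continuous)
      ((integrable_smooth_smul hv hφ.continuous).const_mul _), ← integral_const_mul]
    simp only [Pi.smul_apply, Pi.add_apply, smul_eq_mul, Complex.real_smul]
    congr! 2
    ring
  rw [split, hφF]
  simp only [zero_smul]
  field_simp
  ring

section Graph
variable {a b α : ℝ} {ξ : Ioo (0 : ℝ) 1} {U W : energySpace}

theorem hasWeakDeriv_of_mem_beamOperator_graph (ha : a ≠ 0)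
    (h : (U, W) ∈ (beamOperator a b α ξ).graph) {c d : ℝ} (hc : 0 ≤ c) (hd : d ≤ 1)
    (hξ : (ξ : ℝ) ∉ Ioo c d) :
    HasWeakDeriv 4 c d U.1.1 (-(a : ℂ)⁻¹ • (W.1.2 + (b : ℂ) • U.1.2) : L2) := by
  rw [beamOperator_graph] at h
  refine (h.2.2.hasWeakDeriv ha hc hd hξ (L2.integrableOn hc hd _)
    (L2.integrableOn hc hd _)).congr_ae .rfl ?_
  filter_upwards [L2.ae_smul hc hd (-(a : ℂ)⁻¹) (W.1.2 + (b : ℂ) • U.1.2),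
    L2.ae_add hc hd W.1.2 ((b : ℂ) • U.1.2), L2.ae_smul hc hd (b : ℂ) U.1.2] with x h₁ h₂ h₃
  rw [← h₁, Pi.smul_apply, Pi.smul_apply, ← h₂, Pi.add_apply, Pi.add_apply, ← h₃]

theorem mem_beamOperator_graph_iff (ha : 0 < a) : (U, W) ∈ (beamOperator a b α ξ).graph ↔
    U ∈ beamDomain a α ξ ∧ W.1.1 = U.1.2 ∧
      HasWeakDeriv 4 0 ξ U.1.1 (-(a : ℂ)⁻¹ • (W.1.2 + (b : ℂ) • U.1.2) : L2) ∧
      HasWeakDeriv 4 ξ 1 U.1.1 (-(a : ℂ)⁻¹ • (W.1.2 + (b : ℂ) • U.1.2) : L2) := by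
  have h0 := ξ.2.1.le
  have h1 := ξ.2.2.le
  have forward {W : energySpace} (h : (U, W) ∈ (beamOperator a b α ξ).graph) :=
    And.intro (hasWeakDeriv_of_mem_beamOperator_graph ha.ne' h le_rfl h1 (by simp))
      (hasWeakDeriv_of_mem_beamOperator_graph ha.ne' h h0 le_rfl (by simp))
  constructor
  · intro h
    have hU := h
    rw [beamOperator_graph] at hU
    exact ⟨hU.1, hU.2.1, forward h⟩
  · rintro ⟨hU, hW, wl, wr⟩
    rw [← beamOperator_domain ha b α ξ] at hU
    have graph := (beamOperator a b α ξ).mem_graph ⟨U, hU⟩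
    set W' := beamOperator a b α ξ ⟨U, hU⟩
    have hW' : W'.1.1 = U.1.2 := by
      rw [beamOperator_graph] at graph
      exact graph.2.1
    have image_eq := L2.ext_of_ae_eq_pieces
      ((forward graph).1.ae_unique wl (L2.integrableOn le_rfl h1 _) (L2.integrableOn le_rfl h1 _))
      ((forward graph).2.ae_unique wr (L2.integrableOn h0 le_rfl _) (L2.integrableOn h0 le_rfl _))
    have ha' : -(a : ℂ)⁻¹ ≠ 0 := by simpa using ha.ne'
    have hWW' : W' = W := Subtype.ext <| Prod.ext (hW'.trans hW.symm) <|
      add_right_cancel (smul_right_injective _ ha' image_eq)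
    rwa [hWW'] at graph

theorem mem_beamOperator_graph_smul_add_iff (ha : 0 < a) {μ Λ : ℂ}
    (hΛ : a * Λ = -(b * μ + μ ^ 2)) (hW : W.1.2 = μ • W.1.1) :
    (U, μ • U + W) ∈ (beamOperator a b α ξ).graph ↔
      U ∈ beamDomain a α ξ ∧ U.1.2 = μ • U.1.1 + W.1.1 ∧
        HasWeakDeriv 4 0 ξ U.1.1 (Λ • U.1.1 + -((2 * μ + b) / a) • W.1.1 : L2) ∧
        HasWeakDeriv 4 ξ 1 U.1.1 (Λ • U.1.1 + -((2 * μ + b) / a) • W.1.1 : L2) := by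
  have ha' : (a : ℂ) ≠ 0 := by exact_mod_cast ha.ne'
  have image_eq (hU : U.1.2 = μ • U.1.1 + W.1.1) :
      -(a : ℂ)⁻¹ • ((μ • U + W : energySpace).1.2 + (b : ℂ) • U.1.2) =
        Λ • U.1.1 + -((2 * μ + b) / a) • W.1.1 := by
    change -(a : ℂ)⁻¹ • (μ • U.1.2 + W.1.2 + (b : ℂ) • U.1.2) = _
    rw [hW, hU, show Λ = -(a : ℂ)⁻¹ * (b * μ + μ ^ 2) by field_simp; linear_combination hΛ]
    module
  rw [mem_beamOperator_graph_iff ha]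
  change _ ∧ μ • U.1.1 + W.1.1 = U.1.2 ∧ _ ↔ _
  rw [eq_comm (b := U.1.2)]
  refine and_congr_right fun _ => and_congr_right fun hU => ?_
  rw [image_eq hU]

end Graph

/-- `p 0` solves `u'''' = Λ u + g` on `[0, c]` and has a hinged end `u(0) = u''(0) = 0`; the `p k`
are its derivatives. -/
structure IsHingedSolution (c : ℝ) (Λ : ℂ) (g : ℝ → ℂ) (p : ℕ → ℝ → ℂ) : Prop
    extends IsDerivChain 4 0 c p where
  zero : p 0 0 = 0
  two : p 2 0 = 0
  eqn : ∀ x ∈ Icc 0 c, p 4 x = Λ * p 0 x + g x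

/-- The equation `(𝒜 - μ)(u, v) = (w, μ w)` in classical form, with `Λ = -(b μ + μ²) / a`. The first
component `u` is `p 0` on `[0, ξ]` and is described on `[ξ, 1]` by `q 0` in the reflected variable
`1 - x`, so that both pieces have their hinged end at the origin; `f`, `g` describe `w` in the same
way. -/
structure IsBeamSolution (a b α ξ : ℝ) (μ Λ : ℂ) (f g : ℝ → ℂ) (p q : ℕ → ℝ → ℂ) : Prop where
  left : IsHingedSolution ξ Λ (-((2 * μ + b) / a) • f) p
  right : IsHingedSolution (1 - ξ) Λ (-((2 * μ + b) / a) • g) q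
  match_zero : p 0 ξ = q 0 (1 - ξ)
  match_one : p 1 ξ = -q 1 (1 - ξ)
  match_two : p 2 ξ = q 2 (1 - ξ)
  jump : a * (p 3 ξ + q 3 (1 - ξ)) = α * (μ * p 0 ξ + f ξ)

/-- On `[0, ξ]` the function `u` is represented by the continuous function `f`, on `[ξ, 1]` by
`x ↦ g (1 - x)` with `g` continuous. -/
def HasProfile (ξ : ℝ) (u f g : ℝ → ℂ) : Prop :=
  IsContinuousRep 0 0 ξ u f ∧ IsContinuousRep 0 ξ 1 u fun x => g (1 - x)

namespace HasProfile
variable {ξ : ℝ} {u f g f' g' : ℝ → ℂ}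

theorem eqOn (h : HasProfile ξ u f g) (h' : HasProfile ξ u f' g') (h0 : 0 < ξ) (h1 : ξ < 1) :
    EqOn f f' (Icc 0 ξ) ∧ EqOn g g' (Icc 0 (1 - ξ)) := by
  refine ⟨h.1.eqOn h'.1 h0, fun x hx => ?_⟩
  simpa using h.2.eqOn h'.2 h1 (x := 1 - x) ⟨by linarith [hx.2], by linarith [hx.1]⟩

theorem congr_eqOn (h : HasProfile ξ u f g) (hf : EqOn f f' (Icc 0 ξ))
    (hg : EqOn g g' (Icc 0 (1 - ξ))) : HasProfile ξ u f' g' :=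
  ⟨h.1.congr_eqOn hf, h.2.congr_eqOn fun x hx => hg ⟨by linarith [hx.2], by linarith [hx.1]⟩⟩

theorem zero_L2 (h0 : 0 ≤ ξ) (h1 : ξ ≤ 1) : HasProfile ξ (0 : L2) 0 0 :=
  ⟨IsContinuousRep.zero.congr_ae (L2.ae_zero le_rfl h1),
    IsContinuousRep.zero.congr_ae (L2.ae_zero h0 le_rfl)⟩

theorem smul_L2 {u : L2} (h : HasProfile ξ u f g) (h0 : 0 ≤ ξ) (h1 : ξ ≤ 1) (z : ℂ) :
    HasProfile ξ (z • u : L2) (z • f) (z • g) :=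
  ⟨(h.1.const_smul z).congr_ae (L2.ae_smul le_rfl h1 z u),
    (h.2.const_smul z).congr_ae (L2.ae_smul h0 le_rfl z u)⟩

theorem eq_of_L2 {u v : L2} (hu : HasProfile ξ u f g) (hv : HasProfile ξ v f g) (h0 : 0 ≤ ξ)
    (h1 : ξ ≤ 1) : u = v :=
  L2.ext_of_ae_eq_pieces
    ((hu.1.ae_eq (L2.integrableOn le_rfl h1 u)).trans
      (hv.1.ae_eq (L2.integrableOn le_rfl h1 v)).symm)
    ((hu.2.ae_eq (L2.integrableOn h0 le_rfl u)).trans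
      (hv.2.ae_eq (L2.integrableOn h0 le_rfl v)).symm)

end HasProfile

theorem IsContinuousRep.smul_add_smul_L2 {k : ℕ} {c d : ℝ} (hc : 0 ≤ c) (hd : d ≤ 1) {u w : L2}
    {f g : ℝ → ℂ} (hu : IsContinuousRep k c d u f) (hw : IsContinuousRep k c d w g) (y z : ℂ) :
    IsContinuousRep k c d (y • u + z • w : L2) (y • f + z • g) :=
  (((hu.const_smul y).congr_ae (L2.ae_smul hc hd y u)).add
    ((hw.const_smul z).congr_ae (L2.ae_smul hc hd z w)) (L2.integrableOn hc hd _)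
    (L2.integrableOn hc hd _)).congr_ae (L2.ae_add hc hd _ _)

/-- The derivatives of a function whose fourth derivative is `h`. -/
def fourthOrderChain (u₀ u₁ u₂ u₃ h : ℝ → ℂ) : ℕ → ℝ → ℂ
  | 0 => u₀ | 1 => u₁ | 2 => u₂ | 3 => u₃ | _ => h

theorem isDerivChain_fourthOrderChain {c d : ℝ} (hc : 0 ≤ c) (hd : d ≤ 1) {u w : L2}
    {u₀ u₁ u₂ u₃ f : ℝ → ℂ} {y z : ℂ} (r₀ : IsContinuousRep 0 c d u u₀)
    (r₁ : IsContinuousRep 1 c d u u₁) (r₂ : IsContinuousRep 2 c d u u₂)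
    (r₃ : IsContinuousRep 3 c d u u₃) (hw : IsContinuousRep 0 c d w f)
    (w₄ : HasWeakDeriv 4 c d u (y • u + z • w : L2)) :
    IsDerivChain 4 c d (fourthOrderChain u₀ u₁ u₂ u₃ (y • u₀ + z • f)) := by
  have rep_image := r₀.smul_add_smul_L2 hc hd hw y z
  have r₄ : IsContinuousRep 4 c d u (y • u₀ + z • f) :=
    ⟨rep_image.1, w₄.congr_ae .rfl (rep_image.ae_eq (L2.integrableOn hc hd _))⟩
  refine .of_isContinuousRep (f := u) fun k hk => ?_
  interval_cases k
  exacts [r₀, r₁, r₂, r₃, r₄]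

theorem exists_isBeamSolution {a b α : ℝ} (ha : 0 < a) {ξ : Ioo (0 : ℝ) 1} {μ Λ : ℂ}
    (hΛ : a * Λ = -(b * μ + μ ^ 2)) {U W : energySpace} {f g : ℝ → ℂ}
    (hUW : (U, μ • U + W) ∈ (beamOperator a b α ξ).graph) (hW : W.1.2 = μ • W.1.1)
    (hfg : HasProfile ξ W.1.1 f g) :
    ∃ p q, IsBeamSolution a b α ξ μ Λ f g p q ∧ HasProfile ξ U.1.1 (p 0) (q 0) := by
  have h0 : (0 : ℝ) < ξ := ξ.2.1
  have h1 : (ξ : ℝ) < 1 := ξ.2.2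
  have ha' : (a : ℂ) ≠ 0 := by exact_mod_cast ha.ne'
  obtain ⟨⟨-, -, hu, -, u₀, v₀, l₂, r₂, l₃, r₃, rep_u, rep_v, rep_l₂, rep_r₂, rep_l₃, rep_r₃,
    u_zero, -, u_one, -, l₂_zero, r₂_one, l₂_r₂, jump⟩, hv, weak_l, weak_r⟩ :=
    (mem_beamOperator_graph_smul_add_iff ha hΛ hW).1 hUW
  obtain ⟨u₁, rep_u₁⟩ := hu.exists_isContinuousRep (k := 1) one_lt_two one_pos
  have chain_l := isDerivChain_fourthOrderChain le_rfl h1.le (rep_u.mono le_rfl h1.le)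
    (rep_u₁.mono le_rfl h1.le) rep_l₂ rep_l₃ hfg.1 weak_l
  have chain_r := (isDerivChain_fourthOrderChain h0.le le_rfl (rep_u.mono h0.le le_rfl)
    (rep_u₁.mono h0.le le_rfl) rep_r₂ rep_r₃ hfg.2 weak_r).reflect
  rw [sub_self] at chain_r
  have v_ξ : v₀ ξ = μ * u₀ ξ + f ξ := by
    have rep_v' := (rep_u.mono le_rfl h1.le).smul_add_smul_L2 le_rfl h1.le hfg.1 μ 1
    rw [one_smul, ← hv] at rep_v'
    simpa using (rep_v.mono le_rfl h1.le).eqOn rep_v' h0 ⟨h0.le, le_rfl⟩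
  refine ⟨_, _, ⟨⟨chain_l, u_zero, l₂_zero, fun x _ => rfl⟩, ⟨chain_r, ?_, ?_, fun x _ => ?_⟩,
    ?_, ?_, ?_, ?_⟩, rep_u.mono le_rfl h1.le, ?_⟩
  · simpa [fourthOrderChain] using u_one
  · simpa [reflectChain, fourthOrderChain] using r₂_one
  · norm_num [reflectChain, fourthOrderChain]
  · simp [fourthOrderChain]
  · simp [reflectChain, fourthOrderChain]
  · simpa [reflectChain, fourthOrderChain] using l₂_r₂
  · simp only [reflectChain, fourthOrderChain, sub_sub_cancel]
    rw [v_ξ] at jump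
    push_cast at jump
    field_simp at jump
    linear_combination -jump
  · simpa [fourthOrderChain] using rep_u.mono h0.le le_rfl

theorem IsInBeamDomain.congr_ae {a α ξ : ℝ} {u v u' v' : ℝ → ℂ} (h : IsInBeamDomain a α ξ u v)
    (h0 : 0 ≤ ξ) (h1 : ξ ≤ 1) (hu : u =ᵐ[volume.restrict (Ioo 0 1)] u')
    (hv : v =ᵐ[volume.restrict (Ioo 0 1)] v') : IsInBeamDomain a α ξ u' v' := by
  have hul : u =ᵐ[volume.restrict (Ioo 0 ξ)] u' := ae_restrict_Ioo_mono le_rfl h1 hu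
  have hur : u =ᵐ[volume.restrict (Ioo ξ 1)] u' := ae_restrict_Ioo_mono h0 le_rfl hu
  obtain ⟨sl, sr, su, sv, u₀, v₀, l₂, r₂, l₃, r₃, cu, cv, cl₂, cr₂, cl₃, cr₃, conditions⟩ := h
  exact ⟨sl.congr_ae hul, sr.congr_ae hur, su.congr_ae hu, sv.congr_ae hv, u₀, v₀, l₂, r₂, l₃, r₃,
    cu.congr_ae hu, cv.congr_ae hv, cl₂.congr_ae hul, cr₂.congr_ae hur, cl₃.congr_ae hul,
    cr₃.congr_ae hur, conditions⟩

theorem ae_restrict_glueChain_eq_left (c ξ : ℝ) (p r : ℕ → ℝ → ℂ) (k : ℕ) :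
    glueChain ξ p r k =ᵐ[volume.restrict (Ioo c ξ)] p k := by
  filter_upwards [ae_restrict_mem measurableSet_Ioo] with x hx using glueChain_of_le p r k hx.2.le

theorem ae_restrict_glueChain_eq_right (ξ d : ℝ) (p r : ℕ → ℝ → ℂ) (k : ℕ) :
    glueChain ξ p r k =ᵐ[volume.restrict (Ioo ξ d)] r k := by
  filter_upwards [ae_restrict_mem measurableSet_Ioo] with x hx using glueChain_of_gt p r k hx.1

theorem IsDerivChain.of_le {m n : ℕ} {c d : ℝ} {p : ℕ → ℝ → ℂ} (h : IsDerivChain n c d p)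
    (hmn : m ≤ n) : IsDerivChain m c d p :=
  ⟨fun k hk => h.continuousOn k (hk.trans hmn), fun k hk => h.hasDerivAt k (hk.trans_le hmn)⟩

theorem IsDerivChain.hasWeakDeriv_smul_L2 {m : ℕ} {c d : ℝ} {p : ℕ → ℝ → ℂ} {Λ : ℂ} {u : L2}
    (h : IsDerivChain m c d p) (hc : 0 ≤ c) (hd : d ≤ 1) (hcd : c ≤ d)
    (hu : p 0 =ᵐ[volume.restrict (Ioo c d)] u) (eqn : ∀ x ∈ Icc c d, p m x = Λ * p 0 x) :
    HasWeakDeriv m c d u (Λ • u : L2) := by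
  refine (h.isContinuousRep hcd m le_rfl).2.congr_ae hu ?_
  filter_upwards [hu, L2.ae_smul hc hd Λ u, ae_restrict_mem measurableSet_Ioo] with x hux hΛux hx
  rw [← hΛux, Pi.smul_apply, ← hux, eqn x (Ioo_subset_Icc_self hx), smul_eq_mul]

namespace IsBeamSolution
variable {a b α : ℝ} {μ Λ : ℂ} {p q : ℕ → ℝ → ℂ}

section
variable {ξ : ℝ} {f g : ℝ → ℂ} (h : IsBeamSolution a b α ξ μ Λ f g p q)
include h

theorem isDerivChain_right : IsDerivChain 4 ξ 1 (reflectChain q) := by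
  simpa using h.right.toIsDerivChain.reflect

theorem isContinuousRep_glue (h0 : 0 ≤ ξ) (h1 : ξ ≤ 1) : ∀ k ≤ 2,
    IsContinuousRep k 0 1 (glueChain ξ p (reflectChain q) 0)
      (glueChain ξ p (reflectChain q) k) := by
  refine (h.left.toIsDerivChain.of_le (by norm_num)).isContinuousRep_glueChain
    (h.isDerivChain_right.of_le (by norm_num)) h0 h1 fun k hk => ?_
  interval_cases k <;>
    simp [reflectChain, h.match_zero, h.match_one, h.match_two]

end

theorem isInBeamDomain_glue (ha : a ≠ 0) {ξ : ℝ} (h0 : 0 < ξ) (h1 : ξ < 1)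
    (h : IsBeamSolution a b α ξ μ Λ 0 0 p q) :
    IsInBeamDomain a α ξ (glueChain ξ p (reflectChain q) 0)
      (μ • glueChain ξ p (reflectChain q) 0) := by
  have ha' : (a : ℂ) ≠ 0 := by exact_mod_cast ha
  have glue_l := (ae_restrict_glueChain_eq_left 0 ξ p (reflectChain q) 0).symm
  have glue_r := (ae_restrict_glueChain_eq_right ξ 1 p (reflectChain q) 0).symm
  have rep_l := h.left.toIsDerivChain.isContinuousRep h0.le
  have rep_r := h.isDerivChain_right.isContinuousRep h1.le
  have rep := h.isContinuousRep_glue h0.le h1.le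
  have sobolev {c d : ℝ} {m : ℕ} {f : ℕ → ℝ → ℂ} (hf : ∀ k ≤ m, IsContinuousRep k c d (f 0) (f k)) :
      MemSobolev m c d (f 0) :=
    memSobolev_of_isContinuousRep (memLp_two_of_continuousOn_Icc (hf 0 m.zero_le).1) hf
  have at_zero : glueChain ξ p (reflectChain q) 0 0 = 0 := by
    rw [glueChain_of_le _ _ _ h0.le, h.left.zero]
  have at_one : glueChain ξ p (reflectChain q) 0 1 = 0 := by
    simp [glueChain_of_gt _ _ _ h1, h.right.zero]
  refine ⟨(sobolev rep_l).congr_ae glue_l, (sobolev rep_r).congr_ae glue_r, sobolev rep,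
    (sobolev rep).const_smul μ, _, _, p 2, reflectChain q 2, p 3, reflectChain q 3,
    rep 0 zero_le_two, (rep 0 zero_le_two).const_smul μ,
    (rep_l 2 (by norm_num)).congr_ae glue_l, (rep_r 2 (by norm_num)).congr_ae glue_r,
    (rep_l 3 (by norm_num)).congr_ae glue_l, (rep_r 3 (by norm_num)).congr_ae glue_r,
    at_zero, by simp [at_zero], at_one, by simp [at_one], h.left.two,
    by simp [reflectChain, h.right.two], by simp [reflectChain, h.match_two], ?_⟩
  have jump := h.jump
  simp only [Pi.zero_apply, add_zero] at jump
  rw [Pi.smul_apply, glueChain_of_le _ _ _ le_rfl, smul_eq_mul, reflectChain]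
  push_cast
  field_simp
  linear_combination -jump

theorem exists_eigenvector (ha : 0 < a) {ξ : Ioo (0 : ℝ) 1} (hΛ : a * Λ = -(b * μ + μ ^ 2))
    (h : IsBeamSolution a b α ξ μ Λ 0 0 p q) :
    ∃ U : energySpace, (U, μ • U) ∈ (beamOperator a b α ξ).graph ∧
      HasProfile ξ U.1.1 (p 0) (q 0) := by
  have h0 : (0 : ℝ) < ξ := ξ.2.1
  have h1 : (ξ : ℝ) < 1 := ξ.2.2
  have domain := h.isInBeamDomain_glue ha.ne' h0 h1
  have glue_toLp := domain.2.2.1.1.coeFn_toLp.symm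
  set u : L2 := domain.2.2.1.1.toLp _
  have al := ((ae_restrict_glueChain_eq_left 0 _ _ _ 0).symm.trans
    (ae_restrict_Ioo_mono le_rfl h1.le glue_toLp))
  have ar := ((ae_restrict_glueChain_eq_right _ 1 _ _ 0).symm.trans
    (ae_restrict_Ioo_mono h0.le le_rfl glue_toLp))
  have rep_l := h.left.toIsDerivChain.isContinuousRep h0.le
  have rep_r := h.isDerivChain_right.isContinuousRep h1.le
  have domain_u : IsInBeamDomain a α ξ u (μ • u : L2) := domain.congr_ae h0.le h1.le glue_toLp
    ((glue_toLp.const_smul μ).trans (L2.ae_smul le_rfl le_rfl μ u))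
  have hu : MemH2H10 u := by
    obtain ⟨-, -, su, -, u₀, -, -, -, -, -, rep, -, -, -, -, -, u_zero, -, u_one, -⟩ := domain_u
    exact ⟨su, u₀, rep, u_zero, u_one⟩
  refine ⟨⟨(u, μ • u), hu⟩, ?_, (rep_l 0 (by norm_num)).congr_ae al, ?_⟩
  · rw [← add_zero (μ • (⟨(u, μ • u), hu⟩ : energySpace)),
      mem_beamOperator_graph_smul_add_iff ha hΛ (smul_zero μ).symm]
    refine ⟨domain_u, (add_zero _).symm, ?_, ?_⟩
    · simpa using h.left.toIsDerivChain.hasWeakDeriv_smul_L2 le_rfl h1.le h0.le al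
        (by simpa using h.left.eqn)
    · simpa using h.isDerivChain_right.hasWeakDeriv_smul_L2 h0.le le_rfl h1.le ar fun x hx => by
        simpa [reflectChain, Even.neg_pow (show Even 4 by decide)]
          using h.right.eqn (1 - x) ⟨by linarith [hx.2], by linarith [hx.1]⟩
  · simpa using (rep_r 0 (by norm_num)).congr_ae ar

end IsBeamSolution

theorem eqOn_const_of_hasDerivAt_zero {c : ℝ} {f : ℝ → ℂ} (hf : ContinuousOn f (Icc 0 c))
    (hf' : ∀ x ∈ Ioo 0 c, HasDerivAt f 0 x) : EqOn f (fun _ => f 0) (Icc 0 c) := by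
  intro x hx
  have ftc := integral_eq_of_hasDerivAt_off_countable_of_le f (fun _ => 0) hx.1 countable_empty
    (hf.mono (Icc_subset_Icc_right hx.2)) (fun t ht => hf' t ⟨ht.1.1, ht.1.2.trans_le hx.2⟩)
    (by simp)
  exact sub_eq_zero.1 (by simpa using ftc.symm)

theorem hasDerivAt_sinh_mul_ofReal (l : ℂ) (x : ℝ) :
    HasDerivAt (fun x : ℝ => Complex.sinh (l * x)) (l * Complex.cosh (l * x)) x := by
  simpa [mul_comm] using ((hasDerivAt_id (x : ℂ)).const_mul l).csinh.comp_ofReal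

theorem hasDerivAt_cosh_mul_ofReal (l : ℂ) (x : ℝ) :
    HasDerivAt (fun x : ℝ => Complex.cosh (l * x)) (l * Complex.sinh (l * x)) x := by
  simpa [mul_comm] using ((hasDerivAt_id (x : ℂ)).const_mul l).ccosh.comp_ofReal

theorem hasDerivAt_sin_mul_ofReal (l : ℂ) (x : ℝ) :
    HasDerivAt (fun x : ℝ => Complex.sin (l * x)) (l * Complex.cos (l * x)) x := by
  simpa [mul_comm] using ((hasDerivAt_id (x : ℂ)).const_mul l).csin.comp_ofReal

theorem hasDerivAt_cos_mul_ofReal (l : ℂ) (x : ℝ) :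
    HasDerivAt (fun x : ℝ => Complex.cos (l * x)) (-(l * Complex.sin (l * x))) x := by
  simpa [mul_comm] using ((hasDerivAt_id (x : ℂ)).const_mul l).ccos.comp_ofReal

theorem exists_eq_mul_sinh_of_hasDerivAt {c : ℝ} {l : ℂ} (hl : l ≠ 0) {f f' : ℝ → ℂ}
    (hf : ContinuousOn f (Icc 0 c)) (hf' : ContinuousOn f' (Icc 0 c))
    (deriv_f : ∀ x ∈ Ioo 0 c, HasDerivAt f (f' x) x)
    (deriv_f' : ∀ x ∈ Ioo 0 c, HasDerivAt f' (l ^ 2 * f x) x) (h0 : f 0 = 0) :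
    ∃ K : ℂ, ∀ x ∈ Icc 0 c, f x = K * Complex.sinh (l * x) ∧
      f' x = K * (l * Complex.cosh (l * x)) := by
  have cont_sinh : Continuous fun x : ℝ => Complex.sinh (l * x) := by fun_prop
  have cont_cosh : Continuous fun x : ℝ => Complex.cosh (l * x) := by fun_prop
  have conserved_cosh := eqOn_const_of_hasDerivAt_zero
    (f := fun x => f' x * Complex.cosh (l * x) - l * f x * Complex.sinh (l * x))
    ((hf'.mul cont_cosh.continuousOn).sub
      ((continuousOn_const.mul hf).mul cont_sinh.continuousOn))
    fun x hx => (((deriv_f' x hx).mul (hasDerivAt_cosh_mul_ofReal l x)).sub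
      (((deriv_f x hx).const_mul l).mul (hasDerivAt_sinh_mul_ofReal l x))).congr_deriv (by ring)
  have conserved_sinh := eqOn_const_of_hasDerivAt_zero
    (f := fun x => f' x * Complex.sinh (l * x) - l * f x * Complex.cosh (l * x))
    ((hf'.mul cont_sinh.continuousOn).sub
      ((continuousOn_const.mul hf).mul cont_cosh.continuousOn))
    fun x hx => (((deriv_f' x hx).mul (hasDerivAt_sinh_mul_ofReal l x)).sub
      (((deriv_f x hx).const_mul l).mul (hasDerivAt_cosh_mul_ofReal l x))).congr_deriv (by ring)
  refine ⟨f' 0 / l, fun x hx => ?_⟩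
  have ec := conserved_cosh hx
  have es := conserved_sinh hx
  simp only [h0, Complex.ofReal_zero, mul_zero, Complex.cosh_zero, Complex.sinh_zero, mul_one,
    sub_zero] at ec es
  have pythagoras := Complex.cosh_sq_sub_sinh_sq (l * x)
  constructor <;> field_simp
  · linear_combination
      Complex.sinh (l * x) * ec - Complex.cosh (l * x) * es - l * f x * pythagoras
  · linear_combination Complex.cosh (l * x) * ec - Complex.sinh (l * x) * es - f' x * pythagoras

/-- The function `A sinh(l x) + B sin(l x)` and its derivatives: the general solution of
`u'''' = l⁴ u` with a hinged end at `0`. -/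
noncomputable def hingedSol (l A B : ℂ) : ℕ → ℝ → ℂ
  | 0 => fun x => A * Complex.sinh (l * x) + B * Complex.sin (l * x)
  | 1 => fun x => l * (A * Complex.cosh (l * x) + B * Complex.cos (l * x))
  | 2 => fun x => l ^ 2 * (A * Complex.sinh (l * x) - B * Complex.sin (l * x))
  | 3 => fun x => l ^ 3 * (A * Complex.cosh (l * x) - B * Complex.cos (l * x))
  | _ => fun x => l ^ 4 * (A * Complex.sinh (l * x) + B * Complex.sin (l * x))

theorem hingedSol_mul (l k A B : ℂ) (j : ℕ) (x : ℝ) :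
    hingedSol l (k * A) (k * B) j x = k * hingedSol l A B j x := by
  rcases j with _ | _ | _ | _ | j <;> simp only [hingedSol] <;> ring

theorem isHingedSolution_hingedSol (c : ℝ) (l A B : ℂ) :
    IsHingedSolution c (l ^ 4) 0 (hingedSol l A B) := by
  refine ⟨⟨fun k hk => Continuous.continuousOn ?_, fun k hk x _ => ?_⟩, by simp [hingedSol],
    by simp [hingedSol], fun x _ => by simp [hingedSol]⟩
  · interval_cases k <;> unfold hingedSol <;> fun_prop
  · have dsinh := (hasDerivAt_sinh_mul_ofReal l x).const_mul A
    have dcosh := (hasDerivAt_cosh_mul_ofReal l x).const_mul A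
    have dsin := (hasDerivAt_sin_mul_ofReal l x).const_mul B
    have dcos := (hasDerivAt_cos_mul_ofReal l x).const_mul B
    interval_cases k
    · exact (dsinh.add dsin).congr_deriv (by simp only [hingedSol]; ring)
    · exact ((dcosh.add dcos).const_mul l).congr_deriv (by simp only [hingedSol]; ring)
    · exact ((dsinh.sub dsin).const_mul (l ^ 2)).congr_deriv (by simp only [hingedSol]; ring)
    · exact ((dcosh.sub dcos).const_mul (l ^ 3)).congr_deriv (by simp only [hingedSol]; ring)

theorem eq_zero_of_eqOn_hingedSol_zero {c : ℝ} (hc : 0 < c) {l A B : ℂ} (hl : l ≠ 0)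
    (h : EqOn (hingedSol l A B 0) 0 (Icc 0 c)) : A = 0 ∧ B = 0 := by
  have derivs := (isHingedSolution_hingedSol c l A B).toIsDerivChain.eqOn_zero hc h
  have first : A + B = 0 := by
    simpa [hingedSol, hl] using derivs 1 (by norm_num) ⟨le_rfl, hc.le⟩
  have third : A - B = 0 := by
    simpa [hingedSol, hl] using derivs 3 (by norm_num) ⟨le_rfl, hc.le⟩
  exact ⟨by linear_combination (first + third) / 2, by linear_combination (first - third) / 2⟩

namespace IsHingedSolution

-- `u'''' = l⁴ u` factors into `(u'' ± l² u)'' = ± l² (u'' ± l² u)`.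
theorem exists_eqOn_hingedSol {c : ℝ} {l : ℂ} (hl : l ≠ 0) {p : ℕ → ℝ → ℂ}
    (h : IsHingedSolution c (l ^ 4) 0 p) :
    ∃ A B, ∀ k < 4, EqOn (p k) (hingedSol l A B k) (Icc 0 c) := by
  have cont := h.continuousOn
  have deriv := h.hasDerivAt
  have eqn (x) (hx : x ∈ Ioo 0 c) : p 4 x = l ^ 4 * p 0 x := by
    simpa using h.eqn x (Ioo_subset_Icc_self hx)
  obtain ⟨K, hK⟩ := exists_eq_mul_sinh_of_hasDerivAt hl (f := fun x => p 2 x + l ^ 2 * p 0 x)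
    (f' := fun x => p 3 x + l ^ 2 * p 1 x)
    ((cont 2 (by norm_num)).add (continuousOn_const.mul (cont 0 (by norm_num))))
    ((cont 3 (by norm_num)).add (continuousOn_const.mul (cont 1 (by norm_num))))
    (fun x hx => (deriv 2 (by norm_num) x hx).add ((deriv 0 (by norm_num) x hx).const_mul _))
    (fun x hx => ((deriv 3 (by norm_num) x hx).add
      ((deriv 1 (by norm_num) x hx).const_mul _)).congr_deriv (by rw [eqn x hx]; ring))
    (by simp [h.zero, h.two])
  obtain ⟨J, hJ⟩ := exists_eq_mul_sinh_of_hasDerivAt (mul_ne_zero hl Complex.I_ne_zero)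
    (f := fun x => p 2 x - l ^ 2 * p 0 x) (f' := fun x => p 3 x - l ^ 2 * p 1 x)
    ((cont 2 (by norm_num)).sub (continuousOn_const.mul (cont 0 (by norm_num))))
    ((cont 3 (by norm_num)).sub (continuousOn_const.mul (cont 1 (by norm_num))))
    (fun x hx => (deriv 2 (by norm_num) x hx).sub ((deriv 0 (by norm_num) x hx).const_mul _))
    (fun x hx => ((deriv 3 (by norm_num) x hx).sub
      ((deriv 1 (by norm_num) x hx).const_mul _)).congr_deriv
      (by rw [eqn x hx, mul_pow, Complex.I_sq]; ring))
    (by simp [h.zero, h.two])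
  refine ⟨K / (2 * l ^ 2), -(J * Complex.I) / (2 * l ^ 2), fun k hk x hx => ?_⟩
  obtain ⟨sum₀, sum₁⟩ := hK x hx
  obtain ⟨diff₀, diff₁⟩ := hJ x hx
  rw [mul_right_comm, Complex.sinh_mul_I] at diff₀
  rw [mul_right_comm l Complex.I (x : ℂ), Complex.cosh_mul_I] at diff₁
  interval_cases k <;> simp only [hingedSol] <;> field_simp
  · linear_combination sum₀ - diff₀
  · refine mul_left_cancel₀ hl ?_
    linear_combination sum₁ - diff₁
  · linear_combination sum₀ + diff₀
  · linear_combination sum₁ + diff₁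

theorem integral_mul_eq_boundary {c : ℝ} (hc : 0 ≤ c) {Λ : ℂ} {g : ℝ → ℂ} {P p : ℕ → ℝ → ℂ}
    (hP : IsHingedSolution c Λ g P) (hp : IsHingedSolution c Λ 0 p) :
    ∫ x in (0 : ℝ)..c, p 0 x * g x =
      p 0 c * P 3 c - p 1 c * P 2 c + p 2 c * P 1 c - p 3 c * P 0 c := by
  have contP := hP.continuousOn
  have derivP := hP.hasDerivAt
  have contp := hp.continuousOn
  have derivp := hp.hasDerivAt
  have green := integral_eq_of_hasDerivAt_off_countable_of_le
    (fun x => p 0 x * P 3 x - p 1 x * P 2 x + p 2 x * P 1 x - p 3 x * P 0 x)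
    (fun x => p 0 x * P 4 x - p 4 x * P 0 x) hc countable_empty
    (((((contp 0 (by norm_num)).mul (contP 3 (by norm_num))).sub
      ((contp 1 (by norm_num)).mul (contP 2 (by norm_num)))).add
      ((contp 2 (by norm_num)).mul (contP 1 (by norm_num)))).sub
      ((contp 3 (by norm_num)).mul (contP 0 (by norm_num))))
    (fun x hx => (((((derivp 0 (by norm_num) x hx.1).mul (derivP 3 (by norm_num) x hx.1)).sub
      ((derivp 1 (by norm_num) x hx.1).mul (derivP 2 (by norm_num) x hx.1))).add
      ((derivp 2 (by norm_num) x hx.1).mul (derivP 1 (by norm_num) x hx.1))).sub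
      ((derivp 3 (by norm_num) x hx.1).mul (derivP 0 (by norm_num) x hx.1))).congr_deriv (by ring))
    (ContinuousOn.intervalIntegrable (by
      rw [uIcc_of_le hc]
      exact ((contp 0 (by norm_num)).mul (contP 4 (by norm_num))).sub
        ((contp 4 (by norm_num)).mul (contP 0 (by norm_num)))))
  simp only [hp.zero, hp.two, hP.zero, hP.two, mul_zero, zero_mul, sub_zero, add_zero] at green
  rw [← green]
  refine intervalIntegral.integral_congr fun x hx => ?_
  rw [uIcc_of_le hc] at hx
  simp only [hP.eqn x hx, hp.eqn x hx, Pi.zero_apply]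
  ring

end IsHingedSolution

-- Green's formula on both pieces; the interface conditions cancel all boundary terms but one.
theorem IsBeamSolution.solvability_condition {a b α ξ : ℝ} (ha : a ≠ 0) (h0 : 0 ≤ ξ) (h1 : ξ ≤ 1)
    {μ Λ : ℂ} {f g : ℝ → ℂ} {P Q p q : ℕ → ℝ → ℂ} (hPQ : IsBeamSolution a b α ξ μ Λ f g P Q)
    (hpq : IsBeamSolution a b α ξ μ Λ 0 0 p q) :
    (2 * μ + b) * ((∫ x in (0 : ℝ)..ξ, p 0 x * f x) + ∫ x in (0 : ℝ)..1 - ξ, q 0 x * g x) +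
      α * (p 0 ξ * f ξ) = 0 := by
  have ha' : (a : ℂ) ≠ 0 := by exact_mod_cast ha
  have factor (r h : ℝ → ℂ) (c : ℝ) :
      ∫ x in (0 : ℝ)..c, r x * (-((2 * μ + b) / a) • h) x =
        -((2 * μ + b) / a) * ∫ x in (0 : ℝ)..c, r x * h x := by
    rw [← intervalIntegral.integral_const_mul]
    exact intervalIntegral.integral_congr fun x _ => by simp only [Pi.smul_apply, smul_eq_mul]; ring
  have green_left := hPQ.left.integral_mul_eq_boundary h0 (by simpa using hpq.left)
  have green_right :=
    hPQ.right.integral_mul_eq_boundary (sub_nonneg.2 h1) (by simpa using hpq.right)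
  rw [factor] at green_left green_right
  rw [← hPQ.match_zero, ← hPQ.match_two, ← hpq.match_zero, ← hpq.match_two] at green_right
  have jumpP := hPQ.jump
  have jumpp := hpq.jump
  simp only [Pi.zero_apply, add_zero] at jumpp
  have cancel : (a : ℂ) * ((2 * μ + b) / a) = 2 * μ + b := mul_div_cancel₀ _ ha'
  rw [← cancel]
  linear_combination (-a) * (green_left + green_right) - p 0 ξ * jumpP + P 0 ξ * jumpp
    - a * p 2 ξ * hPQ.match_one + a * P 2 ξ * hpq.match_one

theorem sin_mul_ne_zero_of_sin_eq_zero {ξ : ℝ} (hξ : Irrational ξ) {l : ℂ} (hl : l ≠ 0)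
    (h : Complex.sin l = 0) : Complex.sin (l * ξ) ≠ 0 := by
  intro h'
  obtain ⟨n, rfl⟩ := Complex.sin_eq_zero_iff.1 h
  obtain ⟨m, hm⟩ := Complex.sin_eq_zero_iff.1 h'
  have hn : n ≠ 0 := by rintro rfl; simp at hl
  have hπ : (Real.pi : ℂ) ≠ 0 := by exact_mod_cast Real.pi_ne_zero
  have rational : (n : ℂ) * ξ = m := mul_right_cancel₀ hπ (by linear_combination hm)
  exact (hξ.intCast_mul hn).ne_int m (by exact_mod_cast rational)

theorem mul_add_mul_one_sub_ofReal (l : ℂ) (ξ : ℝ) : l * ξ + l * (1 - ξ : ℝ) = l := by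
  push_cast; ring

theorem sin_mul_ne_zero_or {ξ : ℝ} (hξ : Irrational ξ) {l : ℂ} (hl : l ≠ 0) :
    Complex.sin (l * ξ) ≠ 0 ∨ Complex.sin (l * (1 - ξ : ℝ)) ≠ 0 := by
  by_contra! h
  have sin_l : Complex.sin l = 0 := by
    rw [← mul_add_mul_one_sub_ofReal l ξ, Complex.sin_add, h.1, h.2]; ring
  exact sin_mul_ne_zero_of_sin_eq_zero hξ hl sin_l h.1

theorem sinh_mul_ne_zero_or {ξ : ℝ} (hξ : Irrational ξ) {l : ℂ} (hl : l ≠ 0) :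
    Complex.sinh (l * ξ) ≠ 0 ∨ Complex.sinh (l * (1 - ξ : ℝ)) ≠ 0 := by
  have rotate (r : ℝ) : Complex.sinh (l * r) = 0 ↔ Complex.sin (l * Complex.I * r) = 0 := by
    rw [mul_right_comm, Complex.sin_mul_I]; simp
  simpa only [ne_eq, rotate] using sin_mul_ne_zero_or hξ (mul_ne_zero hl Complex.I_ne_zero)

theorem sinh_ne_zero_or_sin_ne_zero {l : ℂ} (hl : l ≠ 0) :
    Complex.sinh l ≠ 0 ∨ Complex.sin l ≠ 0 := by
  by_contra! h
  obtain ⟨n, hn⟩ := Complex.sin_eq_zero_iff.1 h.2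
  have h' : Complex.sin (l * Complex.I) = 0 := by rw [Complex.sin_mul_I, h.1, zero_mul]
  obtain ⟨m, hm⟩ := Complex.sin_eq_zero_iff.1 h'
  have im_zero : l.im = 0 := by simp [hn]
  have re_zero : l.re = 0 := by simpa using congrArg Complex.im hm
  exact hl (Complex.ext re_zero im_zero)

theorem exists_eq_mul_of_mul_eq_mul {F : Type*} [Field F] {A C s t : F} (h : A * s = C * t)
    (hst : s ≠ 0 ∨ t ≠ 0) : ∃ k, A = k * t ∧ C = k * s := by
  by_cases ht : t = 0
  · subst ht
    have hs : s ≠ 0 := by simpa using hst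
    have hA : A = 0 := by simpa [hs] using h
    exact ⟨C / s, by simp [hA], by field_simp⟩
  · exact ⟨A / t, by field_simp, by field_simp; linear_combination -h⟩

/-- The characteristic equation of the beam operator; `l` is one of the numbers `λ` associated with
`μ`. -/
def BeamCharEq (a α ξ : ℝ) (μ l : ℂ) : Prop :=
  2 * a * l ^ 3 * (Complex.sinh l * Complex.sin l) =
    α * μ * (Complex.sin l * (Complex.sinh (l * ξ) * Complex.sinh (l * (1 - ξ : ℝ))) -
      Complex.sinh l * (Complex.sin (l * ξ) * Complex.sin (l * (1 - ξ : ℝ))))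

/-- The part on `[0, ξ]` of the eigenfunctions, up to a factor, with its derivatives. The part on
`[ξ, 1]` is `beamMode (1 - ξ) l` in the variable `1 - x`. -/
noncomputable def beamMode (ξ : ℝ) (l : ℂ) : ℕ → ℝ → ℂ :=
  hingedSol l (Complex.sin l * Complex.sinh (l * (1 - ξ : ℝ)))
    (-(Complex.sinh l * Complex.sin (l * (1 - ξ : ℝ))))

/-- The left side of the solvability condition for a Jordan chain of length two over the
eigenfunction `beamMode`. -/
noncomputable def jordanObstruction (b α ξ : ℝ) (μ l : ℂ) : ℂ :=
  (2 * μ + b) * ((∫ x in (0 : ℝ)..ξ, beamMode ξ l 0 x ^ 2) +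
    ∫ x in (0 : ℝ)..(1 - ξ), beamMode (1 - ξ) l 0 x ^ 2) + α * beamMode ξ l 0 ξ ^ 2

theorem sinh_eq_add (l : ℂ) (ξ : ℝ) :
    Complex.sinh l = Complex.sinh (l * ξ) * Complex.cosh (l * (1 - ξ : ℝ)) +
      Complex.cosh (l * ξ) * Complex.sinh (l * (1 - ξ : ℝ)) := by
  rw [← Complex.sinh_add, mul_add_mul_one_sub_ofReal]

theorem sin_eq_add (l : ℂ) (ξ : ℝ) :
    Complex.sin l = Complex.sin (l * ξ) * Complex.cos (l * (1 - ξ : ℝ)) +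
      Complex.cos (l * ξ) * Complex.sin (l * (1 - ξ : ℝ)) := by
  rw [← Complex.sin_add, mul_add_mul_one_sub_ofReal]

theorem not_eqOn_beamMode_zero {ξ : ℝ} (hξ : Irrational ξ) (h0 : 0 < ξ) (h1 : ξ < 1) {l : ℂ}
    (hl : l ≠ 0) :
    ¬(EqOn (beamMode ξ l 0) 0 (Icc 0 ξ) ∧ EqOn (beamMode (1 - ξ) l 0) 0 (Icc 0 (1 - ξ))) := by
  rintro ⟨left, right⟩
  obtain ⟨left_sinh, left_sin⟩ := eq_zero_of_eqOn_hingedSol_zero h0 hl left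
  obtain ⟨right_sinh, right_sin⟩ := eq_zero_of_eqOn_hingedSol_zero (sub_pos.2 h1) hl right
  rw [sub_sub_cancel] at right_sinh right_sin
  rw [neg_eq_zero] at left_sin right_sin
  rcases sinh_ne_zero_or_sin_ne_zero hl with h | h
  · rcases sin_mul_ne_zero_or hξ hl with h' | h'
    exacts [mul_ne_zero h h' right_sin, mul_ne_zero h h' left_sin]
  · rcases sinh_mul_ne_zero_or hξ hl with h' | h'
    exacts [mul_ne_zero h h' right_sinh, mul_ne_zero h h' left_sinh]

theorem isBeamSolution_hingedSol_iff {a b α ξ : ℝ} {μ l : ℂ} (hl : l ≠ 0) {A B C D : ℂ} :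
    IsBeamSolution a b α ξ μ (l ^ 4) 0 0 (hingedSol l A B) (hingedSol l C D) ↔
      A * Complex.sinh (l * ξ) = C * Complex.sinh (l * (1 - ξ : ℝ)) ∧
      B * Complex.sin (l * ξ) = D * Complex.sin (l * (1 - ξ : ℝ)) ∧
      A * Complex.cosh (l * ξ) + B * Complex.cos (l * ξ) =
        -(C * Complex.cosh (l * (1 - ξ : ℝ)) + D * Complex.cos (l * (1 - ξ : ℝ))) ∧
      a * l ^ 3 * (A * Complex.cosh (l * ξ) - B * Complex.cos (l * ξ) +
        (C * Complex.cosh (l * (1 - ξ : ℝ)) - D * Complex.cos (l * (1 - ξ : ℝ)))) =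
        α * μ * (A * Complex.sinh (l * ξ) + B * Complex.sin (l * ξ)) := by
  constructor
  · rintro ⟨-, -, m0, m1, m2, jump⟩
    simp only [hingedSol, Pi.zero_apply, add_zero, ← mul_neg] at m0 m1 m2 jump
    replace m2 := mul_left_cancel₀ (pow_ne_zero 2 hl) m2
    exact ⟨by linear_combination (m0 + m2) / 2, by linear_combination (m0 - m2) / 2,
      mul_left_cancel₀ hl m1, by linear_combination jump⟩
  · rintro ⟨hsinh, hsin, hcosh, jump⟩
    refine ⟨?_, ?_, ?_, ?_, ?_, ?_⟩
    · simpa using isHingedSolution_hingedSol ξ l A B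
    · simpa using isHingedSolution_hingedSol (1 - ξ) l C D
    all_goals simp only [hingedSol, Pi.zero_apply, add_zero]
    · linear_combination hsinh + hsin
    · linear_combination l * hcosh
    · linear_combination l ^ 2 * (hsinh - hsin)
    · linear_combination jump

theorem isBeamSolution_beamMode {a b α ξ : ℝ} {μ l : ℂ} (hl : l ≠ 0) (h : BeamCharEq a α ξ μ l) :
    IsBeamSolution a b α ξ μ (l ^ 4) 0 0 (beamMode ξ l) (beamMode (1 - ξ) l) := by
  unfold BeamCharEq at h
  rw [beamMode, beamMode, sub_sub_cancel, isBeamSolution_hingedSol_iff hl]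
  have sinh_l := sinh_eq_add l ξ
  have sin_l := sin_eq_add l ξ
  refine ⟨by ring, by ring, ?_, ?_⟩
  · linear_combination (-Complex.sin l) * sinh_l + Complex.sinh l * sin_l
  · linear_combination h - a * l ^ 3 * Complex.sin l * sinh_l - a * l ^ 3 * Complex.sinh l * sin_l

theorem IsBeamSolution.congr {a b α ξ : ℝ} (h0 : 0 ≤ ξ) (h1 : ξ ≤ 1) {μ Λ : ℂ}
    {p q p' q' : ℕ → ℝ → ℂ} (h : IsBeamSolution a b α ξ μ Λ 0 0 p q)
    (hp : ∀ k < 4, EqOn (p k) (p' k) (Icc 0 ξ)) (hq : ∀ k < 4, EqOn (q k) (q' k) (Icc 0 (1 - ξ)))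
    (hp' : IsHingedSolution ξ Λ 0 p') (hq' : IsHingedSolution (1 - ξ) Λ 0 q') :
    IsBeamSolution a b α ξ μ Λ 0 0 p' q' := by
  have mem_left : ξ ∈ Icc 0 ξ := ⟨h0, le_rfl⟩
  have mem_right : 1 - ξ ∈ Icc 0 (1 - ξ) := ⟨sub_nonneg.2 h1, le_rfl⟩
  refine ⟨by simpa using hp', by simpa using hq', ?_, ?_, ?_, ?_⟩
  · rw [← hp 0 (by norm_num) mem_left, ← hq 0 (by norm_num) mem_right, h.match_zero]
  · rw [← hp 1 (by norm_num) mem_left, ← hq 1 (by norm_num) mem_right, h.match_one]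
  · rw [← hp 2 (by norm_num) mem_left, ← hq 2 (by norm_num) mem_right, h.match_two]
  · rw [← hp 3 (by norm_num) mem_left, ← hq 3 (by norm_num) mem_right,
      ← hp 0 (by norm_num) mem_left, h.jump]

theorem IsBeamSolution.exists_eqOn_beamMode {a b α ξ : ℝ} (hξ : Irrational ξ) (h0 : 0 ≤ ξ)
    (h1 : ξ ≤ 1) {μ l : ℂ} (hl : l ≠ 0) {p q : ℕ → ℝ → ℂ}
    (h : IsBeamSolution a b α ξ μ (l ^ 4) 0 0 p q) :
    ∃ k : ℂ, EqOn (p 0) (k • beamMode ξ l 0) (Icc 0 ξ) ∧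
      EqOn (q 0) (k • beamMode (1 - ξ) l 0) (Icc 0 (1 - ξ)) ∧ (k ≠ 0 → BeamCharEq a α ξ μ l) := by
  obtain ⟨A, B, hp⟩ := (show IsHingedSolution ξ (l ^ 4) 0 p by simpa using h.left)
    |>.exists_eqOn_hingedSol hl
  obtain ⟨C, D, hq⟩ := (show IsHingedSolution (1 - ξ) (l ^ 4) 0 q by simpa using h.right)
    |>.exists_eqOn_hingedSol hl
  obtain ⟨hsinh, hsin, hcosh, jump⟩ := (isBeamSolution_hingedSol_iff hl).1 (h.congr h0 h1 hp hq
    (isHingedSolution_hingedSol _ _ _ _) (isHingedSolution_hingedSol _ _ _ _))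
  obtain ⟨s, rfl, rfl⟩ := exists_eq_mul_of_mul_eq_mul hsinh (sinh_mul_ne_zero_or hξ hl)
  obtain ⟨t, rfl, rfl⟩ := exists_eq_mul_of_mul_eq_mul hsin (sin_mul_ne_zero_or hξ hl)
  have sinh_l := sinh_eq_add l ξ
  have sin_l := sin_eq_add l ξ
  obtain ⟨k, rfl, ht⟩ := exists_eq_mul_of_mul_eq_mul (A := s) (C := -t)
    (s := Complex.sinh l) (t := Complex.sin l)
    (by rw [sinh_l, sin_l]; linear_combination hcosh) (sinh_ne_zero_or_sin_ne_zero hl)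
  obtain rfl : t = -(k * Complex.sinh l) := by rw [← ht, neg_neg]
  refine ⟨k, fun x hx => ?_, fun x hx => ?_, fun hk => mul_left_cancel₀ hk ?_⟩
  · rw [hp 0 (by norm_num) hx, Pi.smul_apply, smul_eq_mul, beamMode, ← hingedSol_mul]
    congr 1 <;> ring
  · rw [hq 0 (by norm_num) hx, Pi.smul_apply, smul_eq_mul, beamMode, ← hingedSol_mul,
      sub_sub_cancel]
    congr 1 <;> ring
  · linear_combination jump + a * l ^ 3 * k * Complex.sin l * sinh_l +
      a * l ^ 3 * k * Complex.sinh l * sin_l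

section
variable {E : Type*} [AddCommGroup E] [Module ℂ E] {T : E →ₗ.[ℂ] E} {μ : ℂ} {x : E}

theorem mem_eigenspaceOf_iff_mem_graph : x ∈ eigenspaceOf T μ ↔ (x, μ • x) ∈ T.graph := by
  rw [mem_eigenspaceOf, LinearPMap.mem_graph_iff]
  constructor
  · rintro ⟨h, e⟩
    exact ⟨⟨x, h⟩, rfl, e⟩
  · rintro ⟨y, rfl, e⟩
    exact ⟨y.2, e⟩

theorem isEigenvalueOf_iff_exists_mem_eigenspaceOf :
    IsEigenvalueOf T μ ↔ ∃ x ∈ eigenspaceOf T μ, x ≠ 0 := by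
  simp only [mem_eigenspaceOf]
  constructor
  · rintro ⟨x, hx, h⟩
    exact ⟨x, ⟨x.2, h⟩, hx⟩
  · rintro ⟨x, ⟨h, e⟩, hx⟩
    exact ⟨⟨x, h⟩, hx, e⟩

theorem rootSpaceOf_eq_eigenspaceOf
    (no_chain : ∀ x, ∀ y ∈ eigenspaceOf T μ, (x, μ • x + y) ∈ T.graph → y = 0) :
    rootSpaceOf T μ = eigenspaceOf T μ := by
  refine le_antisymm (iSup_le fun k => ?_) (le_iSup (kerPow T μ) 1)
  induction k with
  | zero => exact bot_le
  | succ k ih =>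
    rintro _ ⟨x, hx, rfl⟩
    have image_zero := no_chain x.1 _ (ih hx) (by
      rw [LinearPMap.mem_graph_iff]
      exact ⟨x, rfl, by simp [LinearPMap.toFun_eq_coe]⟩)
    exact mem_eigenspaceOf.2 ⟨x.2, by simpa [sub_eq_zero, LinearPMap.toFun_eq_coe] using image_zero⟩

theorem rank_span_singleton_eq_one (hx : x ≠ 0) : Module.rank ℂ (ℂ ∙ x) = 1 :=
  Module.rank_eq_one_iff_finrank_eq_one.2 (finrank_span_singleton hx)

end

section
variable {a b α : ℝ} {ξ : Ioo (0 : ℝ) 1} {μ l : ℂ}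

theorem snd_eq_of_mem_eigenspaceOf (ha : 0 < a) {U : energySpace}
    (hU : U ∈ eigenspaceOf (beamOperator a b α ξ) μ) : U.1.2 = μ • U.1.1 :=
  ((mem_beamOperator_graph_iff ha).1 (mem_eigenspaceOf_iff_mem_graph.1 hU)).2.1.symm

theorem eigenvector_eq_of_hasProfile (ha : 0 < a) {U V : energySpace}
    (hU : U ∈ eigenspaceOf (beamOperator a b α ξ) μ)
    (hV : V ∈ eigenspaceOf (beamOperator a b α ξ) μ) {f g : ℝ → ℂ}
    (profile_U : HasProfile ξ U.1.1 f g) (profile_V : HasProfile ξ V.1.1 f g) : U = V := by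
  have fst_eq := profile_U.eq_of_L2 profile_V ξ.2.1.le ξ.2.2.le
  refine Subtype.ext (Prod.ext fst_eq ?_)
  rw [snd_eq_of_mem_eigenspaceOf ha hU, snd_eq_of_mem_eigenspaceOf ha hV, fst_eq]

theorem exists_hasProfile_smul_beamMode (ha : 0 < a) (hξ : Irrational (ξ : ℝ)) (hl : l ≠ 0)
    (hμ : a * l ^ 4 = -(b * μ + μ ^ 2)) {U : energySpace}
    (hU : U ∈ eigenspaceOf (beamOperator a b α ξ) μ) :
    ∃ k : ℂ, HasProfile ξ U.1.1 (k • beamMode ξ l 0) (k • beamMode (1 - ξ) l 0) ∧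
      (k ≠ 0 → BeamCharEq a α ξ μ l) := by
  obtain ⟨p, q, solution, profile⟩ := exists_isBeamSolution ha hμ (W := 0)
    (by rw [add_zero]; exact mem_eigenspaceOf_iff_mem_graph.1 hU) (smul_zero μ).symm
    (HasProfile.zero_L2 ξ.2.1.le ξ.2.2.le)
  obtain ⟨k, left, right, charEq⟩ := solution.exists_eqOn_beamMode hξ ξ.2.1.le ξ.2.2.le hl
  exact ⟨k, profile.congr_eqOn left right, charEq⟩

theorem exists_eigenspaceOf_beamOperator_eq_span (ha : 0 < a) (hξ : Irrational (ξ : ℝ))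
    (hl : l ≠ 0) (hμ : a * l ^ 4 = -(b * μ + μ ^ 2)) (h : BeamCharEq a α ξ μ l) :
    ∃ U : energySpace, U ≠ 0 ∧ HasProfile ξ U.1.1 (beamMode ξ l 0) (beamMode (1 - ξ) l 0) ∧
      eigenspaceOf (beamOperator a b α ξ) μ = ℂ ∙ U := by
  have h0 := ξ.2.1
  have h1 := ξ.2.2
  obtain ⟨U, mem_graph, profile⟩ := (isBeamSolution_beamMode (b := b) hl h).exists_eigenvector ha hμ
  have hU := mem_eigenspaceOf_iff_mem_graph.2 mem_graph
  refine ⟨U, ?_, profile, le_antisymm (fun V hV => ?_) ?_⟩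
  · rintro rfl
    exact not_eqOn_beamMode_zero hξ h0 h1 hl
      (profile.eqOn (HasProfile.zero_L2 h0.le h1.le) h0 h1)
  · obtain ⟨k, profile_V, -⟩ := exists_hasProfile_smul_beamMode ha hξ hl hμ hV
    exact Submodule.mem_span_singleton.2 ⟨k, eigenvector_eq_of_hasProfile ha
      (Submodule.smul_mem _ k hU) hV (profile.smul_L2 h0.le h1.le k) profile_V⟩
  · rwa [Submodule.span_singleton_le_iff_mem]

theorem isEigenvalueOf_beamOperator_iff (ha : 0 < a) (hξ : Irrational (ξ : ℝ)) (hl : l ≠ 0)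
    (hμ : a * l ^ 4 = -(b * μ + μ ^ 2)) :
    IsEigenvalueOf (beamOperator a b α ξ) μ ↔ BeamCharEq a α ξ μ l := by
  rw [isEigenvalueOf_iff_exists_mem_eigenspaceOf]
  constructor
  · rintro ⟨U, hU, U_ne⟩
    obtain ⟨k, profile, charEq⟩ := exists_hasProfile_smul_beamMode ha hξ hl hμ hU
    refine charEq fun hk =>
      U_ne (eigenvector_eq_of_hasProfile ha hU (Submodule.zero_mem _) profile ?_)
    simpa [hk] using HasProfile.zero_L2 ξ.2.1.le ξ.2.2.le
  · intro h
    obtain ⟨U, U_ne, -, span⟩ := exists_eigenspaceOf_beamOperator_eq_span ha hξ hl hμ h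
    exact ⟨U, span ▸ Submodule.mem_span_singleton_self U, U_ne⟩

theorem geomMult_eq_one_and_algMult_eq_one (ha : 0 < a) (hξ : Irrational (ξ : ℝ)) (hl : l ≠ 0)
    (hμ : a * l ^ 4 = -(b * μ + μ ^ 2)) (h : BeamCharEq a α ξ μ l)
    (obstruction : jordanObstruction b α ξ μ l ≠ 0) :
    geomMult (beamOperator a b α ξ) μ = 1 ∧ algMult (beamOperator a b α ξ) μ = 1 := by
  have h0 := ξ.2.1
  have h1 := ξ.2.2
  obtain ⟨U, U_ne, profile, span⟩ := exists_eigenspaceOf_beamOperator_eq_span ha hξ hl hμ h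
  have no_chain : ∀ V, ∀ W ∈ eigenspaceOf (beamOperator a b α ξ) μ,
      (V, μ • V + W) ∈ (beamOperator a b α ξ).graph → W = 0 := by
    intro V W hW hVW
    obtain ⟨k, rfl⟩ := Submodule.mem_span_singleton.1 (span ▸ hW)
    obtain ⟨P, Q, solution, -⟩ := exists_isBeamSolution ha hμ hVW (snd_eq_of_mem_eigenspaceOf ha hW)
      (profile.smul_L2 h0.le h1.le k)
    have condition := solution.solvability_condition ha.ne' h0.le h1.le
      (isBeamSolution_beamMode hl h)
    have factored : k * jordanObstruction b α ξ μ l = 0 := by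
      rw [← condition, jordanObstruction]
      simp only [Pi.smul_apply, smul_eq_mul, mul_left_comm _ k, intervalIntegral.integral_const_mul,
        ← sq]
      ring
    rw [(mul_eq_zero.1 factored).resolve_right obstruction, zero_smul]
  rw [geomMult, algMult, rootSpaceOf_eq_eigenspaceOf no_chain, span,
    rank_span_singleton_eq_one U_ne]
  exact ⟨rfl, rfl⟩

end

theorem norm_sin_sq (z : ℂ) :
    ‖Complex.sin z‖ ^ 2 = Real.sin z.re ^ 2 + Real.sinh z.im ^ 2 := by
  rw [← Complex.normSq_eq_norm_sq, Complex.sin_eq, ← Complex.ofReal_sin, ← Complex.ofReal_cos,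
    ← Complex.ofReal_sinh, ← Complex.ofReal_cosh, ← Complex.ofReal_mul, ← Complex.ofReal_mul,
    Complex.normSq_add_mul_I, mul_pow, mul_pow, Real.cosh_sq, Real.cos_sq']
  ring

theorem norm_sin_le_cosh_im (z : ℂ) : ‖Complex.sin z‖ ≤ Real.cosh z.im := by
  refine le_of_sq_le_sq ?_ (Real.cosh_pos _).le
  rw [norm_sin_sq, Real.cosh_sq]
  linarith [Real.sin_sq_le_one z.re]

theorem norm_cos_le_cosh_im (z : ℂ) : ‖Complex.cos z‖ ≤ Real.cosh z.im := by
  have im_shift : (z + Real.pi / 2).im = z.im := by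
    simp [← Complex.ofReal_ofNat, ← Complex.ofReal_div]
  rw [← Complex.sin_add_pi_div_two, ← im_shift]
  exact norm_sin_le_cosh_im _

theorem norm_sinh_eq_norm_sin_mul_I (z : ℂ) :
    ‖Complex.sinh z‖ = ‖Complex.sin (z * Complex.I)‖ := by
  simp [Complex.sin_mul_I]

theorem norm_sinh_le_cosh_re (z : ℂ) : ‖Complex.sinh z‖ ≤ Real.cosh z.re := by
  simpa [norm_sinh_eq_norm_sin_mul_I] using norm_sin_le_cosh_im (z * Complex.I)

theorem sinh_re_le_norm_sinh (z : ℂ) : Real.sinh z.re ≤ ‖Complex.sinh z‖ := by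
  refine le_of_sq_le_sq ?_ (norm_nonneg _)
  rw [norm_sinh_eq_norm_sin_mul_I, norm_sin_sq, Complex.mul_I_im]
  exact le_add_of_nonneg_left (sq_nonneg _)

theorem sinh_ne_zero_of_re_pos {z : ℂ} (hz : 0 < z.re) : Complex.sinh z ≠ 0 :=
  norm_pos_iff.1 ((Real.sinh_pos_iff.2 hz).trans_le (sinh_re_le_norm_sinh z))

theorem cosh_le_two_mul_sinh {x : ℝ} (hx : 1 ≤ x) : Real.cosh x ≤ 2 * Real.sinh x := by
  have exp_le_one : Real.exp (-x) ≤ 1 := Real.exp_le_one_iff.2 (by linarith)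
  have self_le_sinh : x ≤ Real.sinh x := Real.self_le_sinh_iff.2 (by linarith)
  linarith [Real.cosh_sub_sinh x]

theorem cosh_mul_cosh_le {x y : ℝ} (hxy : 0 ≤ x * y) :
    Real.cosh x * Real.cosh y ≤ Real.cosh (x + y) := by
  have cosh_sub_le : Real.cosh (x - y) ≤ Real.cosh (x + y) :=
    Real.cosh_le_cosh.2 (sq_le_sq.1 (by linarith [add_sq x y, sub_sq x y]))
  linarith [Real.cosh_add x y, Real.cosh_sub x y]

theorem cosh_mul_mul_cosh_mul_le (x : ℝ) {s t : ℝ} (hs : 0 ≤ s) (ht : 0 ≤ t) (hst : s + t ≤ 1) :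
    Real.cosh (x * s) * Real.cosh (x * t) ≤ Real.cosh x := by
  refine (cosh_mul_cosh_le ?_).trans (Real.cosh_le_cosh.2 ?_)
  · rw [mul_mul_mul_comm]
    exact mul_nonneg (mul_self_nonneg x) (mul_nonneg hs ht)
  · rw [← mul_add, abs_mul, abs_of_nonneg (add_nonneg hs ht)]
    exact mul_le_of_le_one_right (abs_nonneg x) hst

theorem cosh_le_two {x : ℝ} (hx : |x| ≤ 1) : Real.cosh x ≤ 2 := by
  have exp_half_le : Real.exp (1 / 2) ≤ 1 / (1 - 1 / 2) :=
    Real.exp_bound_div_one_sub_of_interval (by norm_num) (by norm_num)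
  calc Real.cosh x ≤ Real.cosh 1 := Real.cosh_le_cosh.2 (by simpa using hx)
    _ ≤ Real.exp (1 ^ 2 / 2) := Real.cosh_le_exp_half_sq 1
    _ ≤ 2 := by norm_num at exp_half_le ⊢; exact exp_half_le

theorem norm_sinh_mul_sinh_div_sinh_le {l : ℂ} (hl : 1 ≤ l.re) {s t : ℝ} (hs : 0 ≤ s) (ht : 0 ≤ t)
    (hst : s + t ≤ 1) :
    ‖Complex.sinh (l * s) * Complex.sinh (l * t) / Complex.sinh l‖ ≤ 2 := by
  rw [norm_div, norm_mul,
    div_le_iff₀ (norm_pos_iff.2 (sinh_ne_zero_of_re_pos (zero_lt_one.trans_le hl)))]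
  calc ‖Complex.sinh (l * s)‖ * ‖Complex.sinh (l * t)‖
      ≤ Real.cosh (l.re * s) * Real.cosh (l.re * t) := by
        simpa only [Complex.re_mul_ofReal] using mul_le_mul (norm_sinh_le_cosh_re (l * s))
          (norm_sinh_le_cosh_re (l * t)) (norm_nonneg _) (Real.cosh_pos _).le
    _ ≤ Real.cosh l.re := cosh_mul_mul_cosh_mul_le l.re hs ht hst
    _ ≤ 2 * Real.sinh l.re := cosh_le_two_mul_sinh hl
    _ ≤ 2 * ‖Complex.sinh l‖ := by linarith [sinh_re_le_norm_sinh l]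

section
variable {l : ℂ} {x : ℝ}

theorem abs_im_mul_ofReal_le_one (hl : |l.im| ≤ 1) (h0 : 0 ≤ x) (h1 : x ≤ 1) :
    |(l * x).im| ≤ 1 := by
  rw [Complex.im_mul_ofReal, abs_mul, abs_of_nonneg h0]
  exact mul_le_one₀ hl h0 h1

theorem norm_sin_mul_le_two (hl : |l.im| ≤ 1) (h0 : 0 ≤ x) (h1 : x ≤ 1) :
    ‖Complex.sin (l * x)‖ ≤ 2 :=
  (norm_sin_le_cosh_im _).trans (cosh_le_two (abs_im_mul_ofReal_le_one hl h0 h1))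

theorem norm_cos_mul_le_two (hl : |l.im| ≤ 1) (h0 : 0 ≤ x) (h1 : x ≤ 1) :
    ‖Complex.cos (l * x)‖ ≤ 2 :=
  (norm_cos_le_cosh_im _).trans (cosh_le_two (abs_im_mul_ofReal_le_one hl h0 h1))

end

theorem exists_int_abs_sub_mul_pi_le (x : ℝ) :
    ∃ n : ℤ, |x - n * Real.pi| ≤ Real.pi / 2 * |Real.sin x| := by
  refine ⟨round (x / Real.pi), ?_⟩
  set n := round (x / Real.pi)
  have abs_le : |x - n * Real.pi| ≤ Real.pi / 2 := by
    rw [show x - n * Real.pi = (x / Real.pi - n) * Real.pi by field_simp, abs_mul,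
      abs_of_pos Real.pi_pos]
    nlinarith [abs_sub_round (x / Real.pi), Real.pi_pos]
  have jordan := Real.mul_abs_le_abs_sin abs_le
  rw [Real.sin_sub_int_mul_pi, abs_mul, abs_zpow, abs_neg, abs_one, one_zpow, one_mul] at jordan
  calc |x - n * Real.pi| = Real.pi / 2 * (2 / Real.pi * |x - n * Real.pi|) := by field_simp
    _ ≤ Real.pi / 2 * |Real.sin x| := by gcongr

section
variable {l : ℂ} {δ : ℝ}

theorem abs_sin_re_le_and_abs_im_le (h0 : 0 ≤ δ) (hδ : δ ≤ 1 / 8)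
    (h : ‖Complex.sin l‖ ≤ 2 * δ * Real.cosh l.im) :
    |Real.sin l.re| ≤ 2 * δ ∧ |l.im| ≤ 3 * δ := by
  have sq_le : ‖Complex.sin l‖ ^ 2 ≤ (2 * δ * Real.cosh l.im) ^ 2 :=
    pow_le_pow_left₀ (norm_nonneg _) h 2
  rw [norm_sin_sq, mul_pow, Real.cosh_sq] at sq_le
  have δ_sq_le : δ ^ 2 ≤ 1 / 64 := by nlinarith
  refine ⟨abs_le_of_sq_le_sq (by nlinarith [sq_nonneg (Real.sinh l.im)]) (by linarith), ?_⟩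
  calc |l.im| ≤ Real.sinh |l.im| := Real.self_le_sinh_iff.2 (abs_nonneg _)
    _ = |Real.sinh l.im| := (Real.abs_sinh _).symm
    _ ≤ 3 * δ :=
        abs_le_of_sq_le_sq (by nlinarith [sq_nonneg (Real.sin l.re)]) (by linarith)

theorem exists_int_norm_sub_mul_pi_le (h0 : 0 ≤ δ) (hδ : δ ≤ 1 / 8)
    (h : ‖Complex.sin l‖ ≤ 2 * δ * Real.cosh l.im) : ∃ n : ℤ, ‖l - n * Real.pi‖ ≤ 7 * δ := by
  obtain ⟨sin_re_le, im_le⟩ := abs_sin_re_le_and_abs_im_le h0 hδ h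
  obtain ⟨n, hn⟩ := exists_int_abs_sub_mul_pi_le l.re
  refine ⟨n, ?_⟩
  calc ‖l - n * Real.pi‖ ≤ |(l - n * Real.pi).re| + |(l - n * Real.pi).im| :=
        Complex.norm_le_abs_re_add_abs_im _
    _ = |l.re - n * Real.pi| + |l.im| := by simp
    _ ≤ Real.pi / 2 * (2 * δ) + 3 * δ := by gcongr; exact hn.trans (by gcongr)
    _ ≤ 7 * δ := by nlinarith [Real.pi_le_four]

end

theorem sinh_mul_sin_eq_zero_iff (z : ℂ) : Complex.sinh z * Complex.sin z = 0 ↔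
    ∃ n : ℤ, z = n * Real.pi ∨ z = Complex.I * n * Real.pi := by
  have sinh_eq_zero_iff : Complex.sinh z = 0 ↔ Complex.sin (z * Complex.I) = 0 := by
    simp [Complex.sin_mul_I]
  rw [mul_eq_zero, sinh_eq_zero_iff, Complex.sin_eq_zero_iff, Complex.sin_eq_zero_iff]
  constructor
  · rintro (⟨n, hn⟩ | ⟨n, hn⟩)
    · refine ⟨-n, Or.inr ?_⟩
      push_cast
      linear_combination -Complex.I * hn + z * Complex.I_sq
    · exact ⟨n, Or.inl hn⟩
  · rintro ⟨n, rfl | rfl⟩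
    · exact Or.inr ⟨n, rfl⟩
    · refine Or.inl ⟨-n, ?_⟩
      push_cast
      linear_combination (n * Real.pi) * Complex.I_sq

section
variable {l u : ℂ} (hu : u ^ 4 = 1)
include hu

theorem norm_eq_one_of_pow_four_eq_one : ‖u‖ = 1 :=
  Complex.norm_eq_one_of_pow_eq_one hu (by norm_num)

theorem pow_three_pow_four_eq_one : (u ^ 3) ^ 4 = 1 := by
  rw [← pow_mul, mul_comm, pow_mul, hu, one_pow]

theorem iff_mul_of_pow_four_eq_one {P : ℂ → Prop} (hP : ∀ l, P (l * Complex.I) ↔ P l) :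
    P (l * u) ↔ P l := by
  obtain ⟨k, -, rfl⟩ := Complex.isPrimitiveRoot_I.eq_pow_of_pow_eq_one hu
  clear hu
  induction k with
  | zero => simp
  | succ k ih => rw [pow_succ, ← mul_assoc, hP, ih]

theorem norm_natCast_mul_pi_mul (n : ℕ) : ‖(n * Real.pi * u : ℂ)‖ = n * Real.pi := by
  rw [norm_mul, norm_mul, norm_eq_one_of_pow_four_eq_one hu, Complex.norm_natCast,
    Complex.norm_real, Real.norm_of_nonneg Real.pi_pos.le, mul_one]

theorem sinh_mul_sin_int_mul_pi_mul (n : ℤ) :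
    Complex.sinh (n * Real.pi * u) * Complex.sin (n * Real.pi * u) = 0 := by
  refine (iff_mul_of_pow_four_eq_one (P := fun z => Complex.sinh z * Complex.sin z = 0) hu
    fun l => ?_).2 ((sinh_mul_sin_eq_zero_iff _).2 ⟨n, Or.inl rfl⟩)
  simp [Complex.sinh_mul_I, Complex.sin_mul_I, or_comm]

theorem beamCharEq_mul_iff {a α ξ : ℝ} {μ : ℂ} :
    BeamCharEq a α ξ μ (l * u) ↔ BeamCharEq a α ξ μ l := by
  refine iff_mul_of_pow_four_eq_one hu fun l => ?_
  have sinh_mul_I_mul (x : ℝ) :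
      Complex.sinh (l * Complex.I * x) = Complex.sin (l * x) * Complex.I := by
    rw [mul_right_comm, Complex.sinh_mul_I]
  have sin_mul_I_mul (x : ℝ) :
      Complex.sin (l * Complex.I * x) = Complex.sinh (l * x) * Complex.I := by
    rw [mul_right_comm, Complex.sin_mul_I]
  rw [BeamCharEq, BeamCharEq, Complex.sinh_mul_I, Complex.sin_mul_I, mul_pow, Complex.I_pow_three]
  simp only [sinh_mul_I_mul, sin_mul_I_mul]
  refine Iff.trans (Eq.congr ?_ ?_) (mul_right_inj' Complex.I_ne_zero)
  · linear_combination
      -Complex.I * (2 * a * l ^ 3 * (Complex.sinh l * Complex.sin l)) * Complex.I_sq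
  · linear_combination -Complex.I * (α * μ *
      (Complex.sin l * (Complex.sinh (l * ξ) * Complex.sinh (l * (1 - ξ : ℝ))) -
        Complex.sinh l * (Complex.sin (l * ξ) * Complex.sin (l * (1 - ξ : ℝ))))) * Complex.I_sq

end

theorem exists_eq_nat_mul_pi_mul_of_root {z : ℂ} (hz : Complex.sinh z * Complex.sin z = 0) :
    ∃ (n : ℕ) (u : ℂ), u ^ 4 = 1 ∧ z = n * Real.pi * u := by
  obtain ⟨n, rfl | rfl⟩ := (sinh_mul_sin_eq_zero_iff z).1 hz <;>
    rcases Int.eq_nat_or_neg n with ⟨m, rfl | rfl⟩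
  · exact ⟨m, 1, by simp, by simp⟩
  · exact ⟨m, -1, by norm_num, by simp⟩
  · exact ⟨m, Complex.I, by simp, by push_cast; ring⟩
  · exact ⟨m, -Complex.I, by simp [Even.neg_pow (show Even 4 by decide)], by push_cast; ring⟩

theorem add_pi_le_norm_of_root {z : ℂ} (hz : Complex.sinh z * Complex.sin z = 0) {N : ℕ}
    (hN : N * Real.pi < ‖z‖) : N * Real.pi + Real.pi ≤ ‖z‖ := by
  obtain ⟨n, u, hu, rfl⟩ := exists_eq_nat_mul_pi_mul_of_root hz
  rw [norm_natCast_mul_pi_mul hu] at hN ⊢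
  have lt : (N : ℝ) < n := lt_of_mul_lt_mul_right hN Real.pi_pos.le
  have succ_le : (N + 1 : ℝ) ≤ n := mod_cast lt
  linarith [mul_le_mul_of_nonneg_right succ_le Real.pi_pos.le]

theorem exists_pow_four_eq_one_abs_im_le_re (l : ℂ) :
    ∃ u : ℂ, u ^ 4 = 1 ∧ |(l * u).im| ≤ (l * u).re := by
  rcases le_total |l.im| |l.re| with h | h
  · rcases le_total 0 l.re with h' | h'
    · exact ⟨1, by simp, by simpa [abs_of_nonneg h'] using h⟩
    · exact ⟨-1, by norm_num, by simpa [abs_of_nonpos h'] using h⟩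
  · rcases le_total 0 l.im with h' | h'
    · exact ⟨-Complex.I, by simp [Even.neg_pow (show Even 4 by decide)],
        by simpa [abs_of_nonneg h'] using h⟩
    · exact ⟨Complex.I, by simp, by simpa [abs_of_nonpos h'] using h⟩

theorem norm_le_two_mul_re {l : ℂ} (h : |l.im| ≤ l.re) : ‖l‖ ≤ 2 * l.re := by
  have norm_le := Complex.norm_le_abs_re_add_abs_im l
  rw [abs_of_nonneg ((abs_nonneg _).trans h)] at norm_le
  linarith

/-- The perturbation parameter of the characteristic equation in the form
`beamCharEq_iff_sin_eq`. -/
noncomputable def dampingRatio (a α : ℝ) (μ l : ℂ) : ℂ := α * μ / (2 * a * l ^ 3)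

/-- The function `beamMode` divided by `sinh l`, which stays bounded as `Re l → ∞`. -/
noncomputable def normalizedMode (c : ℝ) (l : ℂ) (x : ℝ) : ℂ :=
  Complex.sin l * (Complex.sinh (l * (1 - c : ℝ)) * Complex.sinh (l * x) / Complex.sinh l) -
    Complex.sin (l * (1 - c : ℝ)) * Complex.sin (l * x)

/-- The leading term, up to sign, of the mode at the damper as `Re l → ∞`; it measures how far the
damper is from a node. -/
noncomputable def sinProd (c : ℝ) (l : ℂ) : ℂ :=
  Complex.sin (l * c) * Complex.sin (l * (1 - c : ℝ))

theorem beamMode_eq_sinh_mul_normalizedMode {l : ℂ} (hl : Complex.sinh l ≠ 0) (c x : ℝ) :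
    beamMode c l 0 x = Complex.sinh l * normalizedMode c l x := by
  simp only [beamMode, hingedSol, normalizedMode]
  field_simp
  ring

theorem beamCharEq_iff_sin_eq {a α ξ : ℝ} (ha : a ≠ 0) {μ l : ℂ} (hl : 0 < l.re) :
    BeamCharEq a α ξ μ l ↔ Complex.sin l = dampingRatio a α μ l * normalizedMode ξ l ξ := by
  have sinh_ne := sinh_ne_zero_of_re_pos hl
  have l_ne : l ≠ 0 := by rintro rfl; simp at hl
  have a_ne : (a : ℂ) ≠ 0 := mod_cast ha
  have factor_ne : 2 * a * l ^ 3 * Complex.sinh l ≠ 0 := by simp [sinh_ne, l_ne, a_ne]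
  refine Iff.trans (Eq.congr ?_ ?_) (mul_right_inj' factor_ne)
  · ring
  · unfold dampingRatio normalizedMode
    field_simp

section
variable {c : ℝ} {l : ℂ}

theorem sinProd_one_sub : sinProd (1 - c) l = sinProd c l := by
  rw [sinProd, sinProd, sub_sub_cancel, mul_comm]

theorem norm_sinProd_le_cosh (h0 : 0 ≤ c) (h1 : c ≤ 1) : ‖sinProd c l‖ ≤ Real.cosh l.im := by
  rw [sinProd, norm_mul]
  calc ‖Complex.sin (l * c)‖ * ‖Complex.sin (l * (1 - c : ℝ))‖
      ≤ Real.cosh (l.im * c) * Real.cosh (l.im * (1 - c)) := by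
        simpa only [Complex.im_mul_ofReal] using mul_le_mul (norm_sin_le_cosh_im (l * c))
          (norm_sin_le_cosh_im (l * (1 - c : ℝ))) (norm_nonneg _) (Real.cosh_pos _).le
    _ ≤ Real.cosh l.im := cosh_mul_mul_cosh_mul_le l.im h0 (sub_nonneg.2 h1) (by simp)

theorem norm_normalizedMode_add_le (hl : 1 ≤ l.re) (hc : c ≤ 1) {x : ℝ} (hx : x ∈ Icc 0 c) :
    ‖normalizedMode c l x + Complex.sin (l * (1 - c : ℝ)) * Complex.sin (l * x)‖ ≤
      2 * ‖Complex.sin l‖ := by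
  rw [normalizedMode, sub_add_cancel, norm_mul, mul_comm]
  gcongr
  exact norm_sinh_mul_sinh_div_sinh_le hl (sub_nonneg.2 hc) hx.1 (by linarith [hx.2])

theorem norm_normalizedMode_self_le (hl : 1 ≤ l.re) (h0 : 0 ≤ c) (h1 : c ≤ 1) :
    ‖normalizedMode c l c‖ ≤ 2 * ‖Complex.sin l‖ + ‖sinProd c l‖ := by
  rw [sinProd, mul_comm (Complex.sin (l * c))]
  calc ‖normalizedMode c l c‖
      ≤ ‖normalizedMode c l c + Complex.sin (l * (1 - c : ℝ)) * Complex.sin (l * c)‖ +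
          ‖Complex.sin (l * (1 - c : ℝ)) * Complex.sin (l * c)‖ := norm_le_add_norm_add _ _
    _ ≤ _ := add_le_add_left (norm_normalizedMode_add_le hl h1 ⟨h0, le_rfl⟩) _

end

section
variable {a b α ξ : ℝ} {μ l : ℂ}

theorem BeamCharEq.norm_sin_le (ha : a ≠ 0) (h0 : 0 ≤ ξ) (h1 : ξ ≤ 1) (hl : 1 ≤ l.re)
    (h : BeamCharEq a α ξ μ l) (hε : ‖dampingRatio a α μ l‖ ≤ 1 / 4) :
    ‖Complex.sin l‖ ≤ 2 * ‖dampingRatio a α μ l‖ * ‖sinProd ξ l‖ := by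
  have sin_eq := (beamCharEq_iff_sin_eq ha (zero_lt_one.trans_le hl)).1 h
  have norm_sin_le : ‖Complex.sin l‖ ≤
      ‖dampingRatio a α μ l‖ * (2 * ‖Complex.sin l‖ + ‖sinProd ξ l‖) := by
    calc ‖Complex.sin l‖ = ‖dampingRatio a α μ l‖ * ‖normalizedMode ξ l ξ‖ := by
          rw [← norm_mul, ← sin_eq]
      _ ≤ _ := by gcongr; exact norm_normalizedMode_self_le hl h0 h1
  nlinarith [mul_le_mul_of_nonneg_right hε (norm_nonneg (Complex.sin l))]

theorem sq_sqrt_mul_norm_sq (ha : 0 ≤ a) (hμ : a * l ^ 4 = -(b * μ + μ ^ 2)) :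
    (√a * ‖l‖ ^ 2) ^ 2 = ‖μ‖ * ‖μ + b‖ := by
  have norm_eq : ‖(a : ℂ) * l ^ 4‖ = ‖μ * (μ + b)‖ := by
    rw [hμ, norm_neg]; congr 1; ring
  rw [norm_mul, norm_mul, norm_pow, Complex.norm_real, Real.norm_of_nonneg ha] at norm_eq
  rw [← norm_eq, mul_pow, Real.sq_sqrt ha]
  ring

theorem abs_norm_sub_sqrt_mul_norm_sq_le (ha : 0 ≤ a) (hμ : a * l ^ 4 = -(b * μ + μ ^ 2)) :
    |‖μ‖ - √a * ‖l‖ ^ 2| ≤ |b| := by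
  have sq_eq := sq_sqrt_mul_norm_sq ha hμ
  have norm_diff := abs_norm_sub_norm_le (μ + b) μ
  rw [add_sub_cancel_left, Complex.norm_real, Real.norm_eq_abs, abs_le] at norm_diff
  have sqrt_nonneg : 0 ≤ √a * ‖l‖ ^ 2 := by positivity
  rw [abs_le]
  constructor <;> by_contra! h <;> nlinarith [norm_nonneg μ, norm_nonneg (μ + b)]

theorem norm_dampingRatio_le (ha : 0 < a) (hμ : a * l ^ 4 = -(b * μ + μ ^ 2)) (hl0 : l ≠ 0)
    (hl : |b| ≤ √a * ‖l‖ ^ 2) : ‖dampingRatio a α μ l‖ ≤ |α| / √a / ‖l‖ := by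
  have norm_le : ‖μ‖ ≤ 2 * (√a * ‖l‖ ^ 2) := by
    linarith [(abs_le.1 (abs_norm_sub_sqrt_mul_norm_sq_le ha.le hμ)).2]
  have : 0 < ‖l‖ := norm_pos_iff.2 hl0
  have : 0 < √a := Real.sqrt_pos.2 ha
  calc ‖dampingRatio a α μ l‖ = |α| * ‖μ‖ / (2 * √a ^ 2 * ‖l‖ ^ 3) := by
        rw [Real.sq_sqrt ha.le]
        simp [dampingRatio, abs_of_pos ha]
    _ ≤ |α| * (2 * (√a * ‖l‖ ^ 2)) / (2 * √a ^ 2 * ‖l‖ ^ 3) := by gcongr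
    _ = |α| / √a / ‖l‖ := by field_simp

end

/-- `t` is so large that the perturbative estimates hold for every `λ` with `t ≤ |λ|`. The numerical
constants are generous. -/
structure IsLargeFrequency (a b α t : ℝ) : Prop where
  hundred_le : 100 ≤ t
  pointDamping_le : 1000 * |α| ≤ √a * t
  damping_le : 2 * |b| ≤ √a * t

theorem eventually_isLargeFrequency {a : ℝ} (ha : 0 < a) (b α : ℝ) :
    ∀ᶠ t in Filter.atTop, IsLargeFrequency a b α t := by
  have tendsto : Filter.Tendsto (fun t => √a * t) Filter.atTop Filter.atTop :=
    Filter.tendsto_id.const_mul_atTop (Real.sqrt_pos.2 ha)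
  filter_upwards [Filter.eventually_ge_atTop 100, tendsto.eventually_ge_atTop (1000 * |α|),
    tendsto.eventually_ge_atTop (2 * |b|)] with t h h' h'' using ⟨h, h', h''⟩

namespace IsLargeFrequency
variable {a b α ξ t t' : ℝ} {μ l : ℂ}

theorem pos (h : IsLargeFrequency a b α t) : 0 < t := by linarith [h.hundred_le]

theorem mono (h : IsLargeFrequency a b α t) (ht : t ≤ t') : IsLargeFrequency a b α t' where
  hundred_le := h.hundred_le.trans ht
  pointDamping_le := h.pointDamping_le.trans (by gcongr)
  damping_le := h.damping_le.trans (by gcongr)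

theorem ratio_le (ha : 0 < a) (h : IsLargeFrequency a b α t) : 1000 * (|α| / √a) ≤ t := by
  rw [← mul_div_assoc, div_le_iff₀' (Real.sqrt_pos.2 ha)]
  exact h.pointDamping_le

theorem abs_le_sqrt_mul_sub_one_sq (h : IsLargeFrequency a b α t) : |b| ≤ √a * (t - 1) ^ 2 := by
  have half_le : t / 2 ≤ (t - 1) ^ 2 := by nlinarith [h.hundred_le]
  calc |b| ≤ √a * (t / 2) := by linarith [h.damping_le]
    _ ≤ √a * (t - 1) ^ 2 := by gcongr

theorem norm_dampingRatio_le (ha : 0 < a) (h : IsLargeFrequency a b α ‖l‖)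
    (hμ : a * l ^ 4 = -(b * μ + μ ^ 2)) : ‖dampingRatio a α μ l‖ ≤ |α| / √a / ‖l‖ := by
  refine _root_.norm_dampingRatio_le ha hμ (norm_pos_iff.1 h.pos) ?_
  refine h.abs_le_sqrt_mul_sub_one_sq.trans ?_
  gcongr <;> linarith [h.hundred_le]

theorem norm_dampingRatio_le_inv (ha : 0 < a) (h : IsLargeFrequency a b α ‖l‖)
    (hμ : a * l ^ 4 = -(b * μ + μ ^ 2)) : ‖dampingRatio a α μ l‖ ≤ 1 / 1000 := by
  refine (h.norm_dampingRatio_le ha hμ).trans ?_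
  rw [div_le_iff₀ h.pos]
  linarith [h.ratio_le ha]

theorem one_le_re (h : IsLargeFrequency a b α ‖l‖) (hl : |l.im| ≤ l.re) : 1 ≤ l.re := by
  linarith [norm_le_two_mul_re hl, h.hundred_le]

theorem norm_sin_le (ha : 0 < a) (h : IsLargeFrequency a b α ‖l‖)
    (hμ : a * l ^ 4 = -(b * μ + μ ^ 2)) (h0 : 0 ≤ ξ) (h1 : ξ ≤ 1) (hl : |l.im| ≤ l.re)
    (charEq : BeamCharEq a α ξ μ l) :
    ‖Complex.sin l‖ ≤ 2 * ‖dampingRatio a α μ l‖ * ‖sinProd ξ l‖ :=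
  charEq.norm_sin_le ha.ne' h0 h1 (h.one_le_re hl)
    ((h.norm_dampingRatio_le_inv ha hμ).trans (by norm_num))

theorem norm_sin_le_cosh (ha : 0 < a) (h : IsLargeFrequency a b α ‖l‖)
    (hμ : a * l ^ 4 = -(b * μ + μ ^ 2)) (h0 : 0 ≤ ξ) (h1 : ξ ≤ 1) (hl : |l.im| ≤ l.re)
    (charEq : BeamCharEq a α ξ μ l) :
    ‖Complex.sin l‖ ≤ 2 * ‖dampingRatio a α μ l‖ * Real.cosh l.im :=
  (h.norm_sin_le ha hμ h0 h1 hl charEq).trans (by gcongr; exact norm_sinProd_le_cosh h0 h1)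

theorem exists_root (ha : 0 < a) (h : IsLargeFrequency a b α ‖l‖)
    (hμ : a * l ^ 4 = -(b * μ + μ ^ 2)) (h0 : 0 ≤ ξ) (h1 : ξ ≤ 1)
    (charEq : BeamCharEq a α ξ μ l) :
    ∃ z : ℂ, Complex.sinh z * Complex.sin z = 0 ∧ ‖l - z‖ ≤ 7 * (|α| / √a / ‖l‖) := by
  obtain ⟨u, hu, sector⟩ := exists_pow_four_eq_one_abs_im_le_re l
  have norm_u := norm_eq_one_of_pow_four_eq_one hu
  have norm_mul_u : ‖l * u‖ = ‖l‖ := by rw [norm_mul, norm_u, mul_one]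
  rw [← norm_mul_u] at h ⊢
  rw [← beamCharEq_mul_iff hu] at charEq
  replace hμ : a * (l * u) ^ 4 = -(b * μ + μ ^ 2) := by rw [mul_pow, hu, mul_one, hμ]
  obtain ⟨n, hn⟩ := exists_int_norm_sub_mul_pi_le (norm_nonneg _)
    ((h.norm_dampingRatio_le_inv ha hμ).trans (by norm_num))
    (h.norm_sin_le_cosh ha hμ h0 h1 sector charEq)
  refine ⟨n * Real.pi * u ^ 3, sinh_mul_sin_int_mul_pi_mul (pow_three_pow_four_eq_one hu) n, ?_⟩
  calc ‖l - n * Real.pi * u ^ 3‖ = ‖(l * u - n * Real.pi) * u ^ 3‖ := by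
        congr 1; linear_combination -l * hu
    _ = ‖l * u - n * Real.pi‖ := by rw [norm_mul, norm_pow, norm_u, one_pow, mul_one]
    _ ≤ 7 * ‖dampingRatio a α μ (l * u)‖ := hn
    _ ≤ 7 * (|α| / √a / ‖l * u‖) := by gcongr; exact h.norm_dampingRatio_le ha hμ

end IsLargeFrequency

theorem norm_integral_sq_sub_integral_sq_le {f g : ℝ → ℂ} (hf : Continuous f) (hg : Continuous g)
    {c ε M : ℝ} (hc : 0 ≤ c) (hε : 0 ≤ ε) (h : ∀ x ∈ Icc 0 c, ‖f x + g x‖ ≤ ε)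
    (hM : ∀ x ∈ Icc 0 c, ‖g x‖ ≤ M) :
    ‖(∫ x in (0 : ℝ)..c, f x ^ 2) - ∫ x in (0 : ℝ)..c, g x ^ 2‖ ≤ ε * (ε + 2 * M) * c := by
  rw [← intervalIntegral.integral_sub (Continuous.intervalIntegrable (by fun_prop) _ _)
    (Continuous.intervalIntegrable (by fun_prop) _ _)]
  refine (intervalIntegral.norm_integral_le_of_norm_le_const fun x hx => ?_).trans_eq
    (by rw [sub_zero, abs_of_nonneg hc])
  rw [uIoc_of_le hc] at hx
  replace hx := Ioc_subset_Icc_self hx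
  rw [sq_sub_sq, norm_mul]
  refine mul_le_mul (h x hx) ?_ (norm_nonneg _) hε
  calc ‖f x - g x‖ = ‖(f x + g x) - 2 * g x‖ := by congr 1; ring
    _ ≤ ‖f x + g x‖ + 2 * ‖g x‖ := by simpa using norm_sub_le (f x + g x) (2 * g x)
    _ ≤ ε + 2 * M := by gcongr; exacts [h x hx, hM x hx]

theorem integral_sin_sq_mul {l : ℂ} (hl : l ≠ 0) (c : ℝ) :
    ∫ x in (0 : ℝ)..c, Complex.sin (l * x) ^ 2 =
      c / 2 - Complex.sin (l * c) * Complex.cos (l * c) / (2 * l) := by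
  rw [intervalIntegral.integral_eq_sub_of_hasDerivAt
    (f := fun x : ℝ => (x : ℂ) / 2 - Complex.sin (l * x) * Complex.cos (l * x) / (2 * l))
    (fun x _ => ?_) (Continuous.intervalIntegrable (by fun_prop) _ _)]
  · simp
  · have deriv_id : HasDerivAt (fun x : ℝ => (x : ℂ) / 2) (1 / 2) x :=
      (Complex.ofRealCLM.hasDerivAt (x := x)).div_const 2
    have deriv_prod := (hasDerivAt_sin_mul_ofReal l x).mul (hasDerivAt_cos_mul_ofReal l x)
    refine (deriv_id.sub (deriv_prod.div_const (2 * l))).congr_deriv ?_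
    field_simp
    linear_combination -Complex.sin_sq_add_cos_sq (l * x)

theorem sin_mul_one_sub_sq (c : ℝ) (l : ℂ) : Complex.sin (l * (1 - c : ℝ)) ^ 2 =
    Complex.sin l * (Complex.cos (l * c) * Complex.sin (l * (1 - c : ℝ))) -
      Complex.cos l * sinProd c l := by
  have sin_eq : Complex.sin (l * (1 - c : ℝ)) =
      Complex.sin l * Complex.cos (l * c) - Complex.cos l * Complex.sin (l * c) := by
    rw [← Complex.sin_sub]; congr 1; push_cast; ring
  rw [sinProd]
  linear_combination Complex.sin (l * (1 - c : ℝ)) * sin_eq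

section
variable {c : ℝ} {l : ℂ} (h0 : 0 ≤ c) (h1 : c ≤ 1) (him : |l.im| ≤ 1)
include h0 h1 him

theorem norm_sinProd_le_two : ‖sinProd c l‖ ≤ 2 :=
  (norm_sinProd_le_cosh h0 h1).trans (cosh_le_two him)

theorem norm_sin_mul_one_sub_sq_add_le :
    ‖Complex.sin (l * (1 - c : ℝ)) ^ 2 + Complex.cos l * sinProd c l‖ ≤ 4 * ‖Complex.sin l‖ := by
  rw [sin_mul_one_sub_sq, sub_add_cancel, norm_mul, norm_mul, mul_comm]
  gcongr
  calc ‖Complex.cos (l * c)‖ * ‖Complex.sin (l * (1 - c : ℝ))‖ ≤ 2 * 2 := by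
        gcongr
        exacts [norm_cos_mul_le_two him h0 h1,
          norm_sin_mul_le_two him (sub_nonneg.2 h1) (by linarith)]
    _ = 4 := by norm_num

theorem norm_integral_sin_sq_sub_le (hl : l ≠ 0) :
    ‖(∫ x in (0 : ℝ)..c, Complex.sin (l * x) ^ 2) - c / 2‖ ≤ 2 / ‖l‖ := by
  rw [integral_sin_sq_mul hl, sub_sub_cancel_left, norm_neg, norm_div, norm_mul, norm_mul,
    Complex.norm_ofNat]
  calc ‖Complex.sin (l * c)‖ * ‖Complex.cos (l * c)‖ / (2 * ‖l‖) ≤ 2 * 2 / (2 * ‖l‖) := by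
        gcongr
        exacts [norm_sin_mul_le_two him h0 h1, norm_cos_mul_le_two him h0 h1]
    _ = 2 / ‖l‖ := mul_div_mul_left _ _ two_ne_zero

theorem norm_integral_normalizedMode_sq_sub_le (hre : 1 ≤ l.re)
    (hs : 4 * ‖Complex.sin l‖ ≤ ‖sinProd c l‖) :
    ‖(∫ x in (0 : ℝ)..c, normalizedMode c l x ^ 2) - Complex.sin (l * (1 - c : ℝ)) ^ 2 *
      ∫ x in (0 : ℝ)..c, Complex.sin (l * x) ^ 2‖ ≤ 18 * ‖Complex.sin l‖ := by
  have continuous_mode : Continuous (normalizedMode c l) := by unfold normalizedMode; fun_prop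
  have sin_mul_sin_le (x : ℝ) (hx : x ∈ Icc 0 c) :
      ‖Complex.sin (l * (1 - c : ℝ)) * Complex.sin (l * x)‖ ≤ 2 * 2 := by
    rw [norm_mul]
    gcongr
    exacts [norm_sin_mul_le_two him (sub_nonneg.2 h1) (by linarith),
      norm_sin_mul_le_two him hx.1 (hx.2.trans h1)]
  have diff_le := norm_integral_sq_sub_integral_sq_le continuous_mode (by fun_prop) h0
    (by positivity) (fun x hx => norm_normalizedMode_add_le hre h1 hx) sin_mul_sin_le
  simp only [mul_pow, intervalIntegral.integral_const_mul] at diff_le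
  refine (diff_le.trans (mul_le_of_le_one_right (by positivity) h1)).trans ?_
  nlinarith [norm_sinProd_le_two h0 h1 him, norm_nonneg (Complex.sin l)]

theorem norm_integral_normalizedMode_sq_add_le (hre : 1 ≤ l.re)
    (hs : 4 * ‖Complex.sin l‖ ≤ ‖sinProd c l‖) :
    ‖(∫ x in (0 : ℝ)..c, normalizedMode c l x ^ 2) + Complex.cos l * sinProd c l * (c / 2)‖ ≤
      20 * ‖Complex.sin l‖ + 6 * ‖sinProd c l‖ / ‖l‖ := by
  have l_ne : l ≠ 0 := by rintro rfl; norm_num at hre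
  have sq_add_le := norm_sin_mul_one_sub_sq_add_le h0 h1 him
  have cos_le : ‖Complex.cos l‖ ≤ 2 := by
    simpa using norm_cos_mul_le_two him zero_le_one le_rfl
  set I := ∫ x in (0 : ℝ)..c, Complex.sin (l * x) ^ 2
  set s := Complex.sin (l * (1 - c : ℝ)) ^ 2
  set m := sinProd c l
  have s_le : ‖s‖ ≤ 3 * ‖m‖ := by
    calc ‖s‖ ≤ ‖s + Complex.cos l * m‖ + ‖Complex.cos l * m‖ := norm_le_add_norm_add _ _
      _ ≤ 4 * ‖Complex.sin l‖ + 2 * ‖m‖ := by rw [norm_mul]; gcongr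
      _ ≤ 3 * ‖m‖ := by linarith
  have half_le : ‖(c / 2 : ℂ)‖ ≤ 1 / 2 := by
    rw [norm_div, Complex.norm_real, Complex.norm_ofNat, Real.norm_of_nonneg h0]
    gcongr
  calc ‖(∫ x in (0 : ℝ)..c, normalizedMode c l x ^ 2) + Complex.cos l * m * (c / 2)‖
      = ‖((∫ x in (0 : ℝ)..c, normalizedMode c l x ^ 2) - s * I) +
          (s + Complex.cos l * m) * (c / 2) + s * (I - c / 2)‖ := by congr 1; ring
    _ ≤ 18 * ‖Complex.sin l‖ + 4 * ‖Complex.sin l‖ * (1 / 2) + 3 * ‖m‖ * (2 / ‖l‖) := by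
        refine norm_add₃_le.trans (add_le_add_three
          (norm_integral_normalizedMode_sq_sub_le h0 h1 him hre hs) ?_ ?_) <;> rw [norm_mul]
        · gcongr
        · gcongr
          exact norm_integral_sin_sq_sub_le h0 h1 him l_ne
    _ = 20 * ‖Complex.sin l‖ + 6 * ‖m‖ / ‖l‖ := by ring

end

section
variable {ξ : ℝ} {l : ℂ}

theorem sinProd_ne_zero_of_sin_eq_zero (hξ : Irrational ξ) (hl : l ≠ 0) (h : Complex.sin l = 0) :
    sinProd ξ l ≠ 0 :=
  mul_ne_zero (sin_mul_ne_zero_of_sin_eq_zero hξ hl h)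
    (sin_mul_ne_zero_of_sin_eq_zero (mod_cast hξ.natCast_sub 1) hl h)

theorem nine_div_ten_le_norm_cos (h : ‖Complex.sin l‖ ≤ 1 / 10) : 9 / 10 ≤ ‖Complex.cos l‖ := by
  have one_le : ‖(1 : ℂ)‖ ≤ ‖Complex.sin l‖ ^ 2 + ‖Complex.cos l‖ ^ 2 := by
    rw [← Complex.sin_sq_add_cos_sq l, ← norm_pow, ← norm_pow]
    exact norm_add_le _ _
  rw [norm_one] at one_le
  nlinarith [norm_nonneg (Complex.cos l), norm_nonneg (Complex.sin l)]

theorem norm_sinProd_div_four_le_norm_integral_add (h0 : 0 ≤ ξ) (h1 : ξ ≤ 1) (hre : 1 ≤ l.re)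
    (him : |l.im| ≤ 1) (hl : 100 ≤ ‖l‖) (hs : 500 * ‖Complex.sin l‖ ≤ ‖sinProd ξ l‖) :
    ‖sinProd ξ l‖ / 4 ≤ ‖(∫ x in (0 : ℝ)..ξ, normalizedMode ξ l x ^ 2) +
      ∫ x in (0 : ℝ)..(1 - ξ), normalizedMode (1 - ξ) l x ^ 2‖ := by
  have left := norm_integral_normalizedMode_sq_add_le h0 h1 him hre
    (by linarith [norm_nonneg (Complex.sin l)])
  have right := norm_integral_normalizedMode_sq_add_le (c := 1 - ξ) (sub_nonneg.2 h1)
    (by linarith) him hre (by rw [sinProd_one_sub]; linarith [norm_nonneg (Complex.sin l)])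
  rw [sinProd_one_sub] at right
  have cos_ge := nine_div_ten_le_norm_cos (l := l)
    (by linarith [norm_sinProd_le_two h0 h1 him])
  set m := sinProd ξ l
  set J₁ := ∫ x in (0 : ℝ)..ξ, normalizedMode ξ l x ^ 2
  set J₂ := ∫ x in (0 : ℝ)..(1 - ξ), normalizedMode (1 - ξ) l x ^ 2
  have main_le : 9 / 10 * ‖m‖ / 2 ≤ ‖(J₁ + Complex.cos l * m * (ξ / 2)) +
      (J₂ + Complex.cos l * m * ((1 - ξ : ℝ) / 2))‖ + ‖J₁ + J₂‖ :=
    calc 9 / 10 * ‖m‖ / 2 ≤ ‖Complex.cos l‖ * ‖m‖ / 2 := by gcongr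
      _ = ‖Complex.cos l * m / 2‖ := by rw [norm_div, norm_mul, Complex.norm_ofNat]
      _ = ‖(J₁ + Complex.cos l * m * (ξ / 2)) +
            (J₂ + Complex.cos l * m * ((1 - ξ : ℝ) / 2)) - (J₁ + J₂)‖ := by
          congr 1; push_cast; ring
      _ ≤ _ := norm_sub_le _ _
  have error_le : 6 * ‖m‖ / ‖l‖ ≤ 6 * ‖m‖ / 100 := by gcongr
  linarith [norm_add_le (J₁ + Complex.cos l * m * (ξ / 2))
    (J₂ + Complex.cos l * m * ((1 - ξ : ℝ) / 2))]

theorem jordanObstruction_eq_sinh_sq_mul (hl : Complex.sinh l ≠ 0) (b α : ℝ) (μ : ℂ) :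
    jordanObstruction b α ξ μ l = Complex.sinh l ^ 2 * ((2 * μ + b) *
      ((∫ x in (0 : ℝ)..ξ, normalizedMode ξ l x ^ 2) +
        ∫ x in (0 : ℝ)..(1 - ξ), normalizedMode (1 - ξ) l x ^ 2) +
      α * normalizedMode ξ l ξ ^ 2) := by
  simp only [jordanObstruction, beamMode_eq_sinh_mul_normalizedMode hl, mul_pow (Complex.sinh l),
    intervalIntegral.integral_const_mul]
  ring

theorem norm_normalizedMode_self_sq_le (h0 : 0 ≤ ξ) (h1 : ξ ≤ 1) (hre : 1 ≤ l.re)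
    (him : |l.im| ≤ 1) (hs : 2 * ‖Complex.sin l‖ ≤ ‖sinProd ξ l‖) :
    ‖normalizedMode ξ l ξ ^ 2‖ ≤ 8 * ‖sinProd ξ l‖ := by
  have mode_le : ‖normalizedMode ξ l ξ‖ ≤ 2 * ‖sinProd ξ l‖ :=
    (norm_normalizedMode_self_le hre h0 h1).trans (by linarith)
  calc ‖normalizedMode ξ l ξ ^ 2‖ = ‖normalizedMode ξ l ξ‖ ^ 2 := norm_pow _ _
    _ ≤ (2 * ‖sinProd ξ l‖) ^ 2 := by gcongr
    _ = 4 * ‖sinProd ξ l‖ * ‖sinProd ξ l‖ := by ring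
    _ ≤ 4 * ‖sinProd ξ l‖ * 2 := by gcongr; exact norm_sinProd_le_two h0 h1 him
    _ = 8 * ‖sinProd ξ l‖ := by ring

end

namespace IsLargeFrequency
variable {a b α ξ : ℝ} {μ l : ℂ}

theorem lt_norm_two_mul_add (ha : 0 < a) (h : IsLargeFrequency a b α ‖l‖)
    (hμ : a * l ^ 4 = -(b * μ + μ ^ 2)) : 32 * |α| < ‖2 * μ + b‖ := by
  have norm_ge := (abs_le.1 (abs_norm_sub_sqrt_mul_norm_sq_le ha.le hμ)).1
  have sub_le : 2 * ‖μ‖ - |b| ≤ ‖2 * μ + b‖ := by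
    simpa using norm_sub_le_norm_add (2 * μ) (b : ℂ)
  have sqrt_mul_pos : 0 < √a * ‖l‖ := mul_pos (Real.sqrt_pos.2 ha) h.pos
  have hundred_mul_le : 100 * (√a * ‖l‖) ≤ √a * ‖l‖ ^ 2 := by nlinarith [h.hundred_le]
  linarith [h.pointDamping_le, h.damping_le, abs_nonneg α]

theorem jordanObstruction_ne_zero (ha : 0 < a) (h : IsLargeFrequency a b α ‖l‖)
    (hμ : a * l ^ 4 = -(b * μ + μ ^ 2)) (hξ : Irrational ξ) (h0 : 0 ≤ ξ) (h1 : ξ ≤ 1)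
    (hl : |l.im| ≤ l.re) (charEq : BeamCharEq a α ξ μ l) : jordanObstruction b α ξ μ l ≠ 0 := by
  have ratio_le := h.norm_dampingRatio_le_inv ha hμ
  have sin_le := h.norm_sin_le ha hμ h0 h1 hl charEq
  have l_ne : l ≠ 0 := norm_pos_iff.1 h.pos
  have hre := h.one_le_re hl
  have him : |l.im| ≤ 1 := by
    linarith [(abs_sin_re_le_and_abs_im_le (norm_nonneg _) (ratio_le.trans (by norm_num))
      (h.norm_sin_le_cosh ha hμ h0 h1 hl charEq)).2]
  have sin_le_sinProd : 500 * ‖Complex.sin l‖ ≤ ‖sinProd ξ l‖ := by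
    nlinarith [norm_nonneg (sinProd ξ l)]
  have sinProd_pos : 0 < ‖sinProd ξ l‖ := by
    refine norm_pos_iff.2 fun sinProd_eq => ?_
    rw [sinProd_eq, norm_zero, mul_zero] at sin_le
    exact sinProd_ne_zero_of_sin_eq_zero hξ l_ne (norm_le_zero_iff.1 sin_le) sinProd_eq
  have mass_ge := norm_sinProd_div_four_le_norm_integral_add h0 h1 hre him h.hundred_le
    sin_le_sinProd
  have damper_le := norm_normalizedMode_self_sq_le h0 h1 hre him
    (by linarith [norm_nonneg (Complex.sin l)])
  have sinh_ne := sinh_ne_zero_of_re_pos (zero_lt_one.trans_le hre)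
  rw [jordanObstruction_eq_sinh_sq_mul sinh_ne]
  refine mul_ne_zero (pow_ne_zero 2 sinh_ne) fun sum_eq => ?_
  have norm_eq := congrArg norm (eq_neg_of_add_eq_zero_left sum_eq)
  rw [norm_neg, norm_mul, norm_mul, Complex.norm_real, Real.norm_eq_abs] at norm_eq
  have upper := mul_le_mul_of_nonneg_left damper_le (abs_nonneg α)
  have lower := mul_le_mul_of_nonneg_left mass_ge (norm_nonneg (2 * μ + b))
  have strict := mul_lt_mul_of_pos_right (h.lt_norm_two_mul_add ha hμ) sinProd_pos
  linarith

theorem geomMult_eq_one_and_algMult_eq_one (ha : 0 < a) (h : IsLargeFrequency a b α ‖l‖)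
    {ξ : Ioo (0 : ℝ) 1} (hμ : a * l ^ 4 = -(b * μ + μ ^ 2)) (hξ : Irrational (ξ : ℝ))
    (charEq : BeamCharEq a α ξ μ l) :
    geomMult (beamOperator a b α ξ) μ = 1 ∧ algMult (beamOperator a b α ξ) μ = 1 := by
  obtain ⟨u, hu, sector⟩ := exists_pow_four_eq_one_abs_im_le_re l
  have norm_mul_u : ‖l * u‖ = ‖l‖ := by
    rw [norm_mul, norm_eq_one_of_pow_four_eq_one hu, mul_one]
  rw [← norm_mul_u] at h
  rw [← beamCharEq_mul_iff hu] at charEq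
  replace hμ : a * (l * u) ^ 4 = -(b * μ + μ ^ 2) := by rw [mul_pow, hu, mul_one, hμ]
  exact _root_.geomMult_eq_one_and_algMult_eq_one ha hξ (norm_pos_iff.1 h.pos) hμ charEq
    (h.jordanObstruction_ne_zero ha hμ hξ ξ.2.1.le ξ.2.2.le sector charEq)

end IsLargeFrequency

section PerturbedSine

open Metric

theorem exists_unique_fixed_point_closedBall {E : Type*} [MetricSpace E] [CompleteSpace E]
    {K : NNReal} {f : E → E} {c : E} {r : ℝ} (hK : K < 1)
    (hf : LipschitzOnWith K f (closedBall c r)) (hr : dist c (f c) ≤ (1 - K) * r) :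
    ∃ x ∈ closedBall c r, f x = x ∧ dist c x ≤ dist c (f c) / (1 - K) ∧
      ∀ y ∈ closedBall c r, f y = y → y = x := by
  have one_sub_pos : 0 < 1 - (K : ℝ) := sub_pos.2 (mod_cast hK)
  have c_mem : c ∈ closedBall c r :=
    mem_closedBall_self (nonneg_of_mul_nonneg_right (dist_nonneg.trans hr) one_sub_pos)
  have mapsTo : MapsTo f (closedBall c r) (closedBall c r) := fun x hx => by
    calc dist (f x) c ≤ dist (f x) (f c) + dist (f c) c := dist_triangle _ _ _
      _ ≤ K * r + (1 - K) * r := by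
        rw [dist_comm (f c)]
        exact add_le_add ((hf.dist_le_mul x hx c c_mem).trans (by gcongr; exact hx)) hr
      _ = r := by ring
  have contracting : ContractingWith K (mapsTo.restrict f _ _) :=
    ⟨hK, hf.mapsToRestrict mapsTo⟩
  have : CompleteSpace (closedBall c r) := isClosed_closedBall.completeSpace_coe
  have : Nonempty (closedBall c r) := ⟨c, c_mem⟩
  refine ⟨contracting.fixedPoint, Subtype.coe_prop _,
    congrArg Subtype.val contracting.fixedPoint_isFixedPt,
    contracting.dist_fixedPoint_le ⟨c, c_mem⟩, fun y hy fixed => ?_⟩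
  exact congrArg Subtype.val
    (contracting.fixedPoint_unique (x := ⟨y, hy⟩) (Subtype.ext fixed))

theorem norm_one_sub_cos_le {w : ℂ} (hw : ‖w‖ ≤ 1 / 2) : ‖1 - Complex.cos w‖ ≤ 1 / 4 := by
  have taylor := Complex.cos_bound (hw.trans (by norm_num))
  calc ‖1 - Complex.cos w‖ = ‖w ^ 2 / 2 - (Complex.cos w - (1 - w ^ 2 / 2))‖ := by
        congr 1; ring
    _ ≤ ‖w‖ ^ 2 / 2 + ‖w‖ ^ 4 * (5 / 96) := by
        refine (norm_sub_le _ _).trans (add_le_add (le_of_eq ?_) taylor)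
        simp
    _ ≤ (1 / 2) ^ 2 / 2 + (1 / 2) ^ 4 * (5 / 96) := by gcongr
    _ ≤ 1 / 4 := by norm_num

theorem norm_one_sub_neg_one_zpow_mul_cos_le {l : ℂ} {n : ℤ} (hl : ‖l - n * Real.pi‖ ≤ 1 / 2) :
    ‖1 - (-1) ^ n * Complex.cos l‖ ≤ 1 / 4 := by
  have cos_eq : Complex.cos (l - n * Real.pi) = (-1) ^ n * Complex.cos l := by
    rw [Complex.cos_antiperiodic.sub_int_mul_eq n, Int.cast_negOnePow]
  exact cos_eq ▸ norm_one_sub_cos_le hl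

theorem norm_deriv_le_of_norm_le_on_ball {G : ℂ → ℂ} {c l : ℂ} {M : ℝ}
    (hG : DifferentiableOn ℂ G (ball c 1)) (bound : ∀ w ∈ ball c 1, ‖G w‖ ≤ M)
    (hl : l ∈ closedBall c (1 / 2)) : ‖deriv G l‖ ≤ 4 * M := by
  have subset : closedBall l (1 / 4) ⊆ ball c 1 := by
    refine closedBall_subset_ball' ?_
    linarith [mem_closedBall.1 hl]
  calc ‖deriv G l‖ ≤ M / (1 / 4) :=
        Complex.norm_deriv_le_of_forall_mem_sphere_norm_le (by norm_num)
          ((hG.mono subset).diffContOnCl_ball subset_rfl) fun w hw =>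
            bound w (subset (sphere_subset_closedBall hw))
    _ = 4 * M := by ring

theorem lipschitzOnWith_newton_sin_add {n : ℤ} {G : ℂ → ℂ}
    (hG : DifferentiableOn ℂ G (ball (n * Real.pi : ℂ) 1))
    (bound : ∀ w ∈ ball (n * Real.pi : ℂ) 1, ‖G w‖ ≤ 1 / 16) :
    LipschitzOnWith (1 / 2) (fun l => l - (-1) ^ n * (Complex.sin l + G l))
      (closedBall (n * Real.pi : ℂ) (1 / 2)) := by
  refine (convex_closedBall _ _).lipschitzOnWith_of_nnnorm_hasDerivWithin_le
    (f' := fun l => 1 - (-1) ^ n * (Complex.cos l + deriv G l))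
    (fun l hl => ?_) (fun l hl => ?_)
  · have l_mem := closedBall_subset_ball (by norm_num : (1 / 2 : ℝ) < 1) hl
    have hasDerivAt := (hG.differentiableAt (isOpen_ball.mem_nhds l_mem)).hasDerivAt
    exact ((hasDerivAt_id l).sub
      (((Complex.hasDerivAt_sin l).add hasDerivAt).const_mul _)).hasDerivWithinAt
  · rw [← NNReal.coe_le_coe, coe_nnnorm]
    have norm_deriv_le := norm_deriv_le_of_norm_le_on_ball hG bound hl
    rw [mem_closedBall, dist_eq_norm] at hl
    calc ‖1 - (-1) ^ n * (Complex.cos l + deriv G l)‖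
        = ‖1 - (-1) ^ n * Complex.cos l - (-1) ^ n * deriv G l‖ := by congr 1; ring
      _ ≤ ‖1 - (-1) ^ n * Complex.cos l‖ + ‖(-1) ^ n * deriv G l‖ := norm_sub_le _ _
      _ = ‖1 - (-1) ^ n * Complex.cos l‖ + ‖deriv G l‖ := by simp
      _ ≤ 1 / 4 + 4 * (1 / 16) :=
        add_le_add (norm_one_sub_neg_one_zpow_mul_cos_le hl) norm_deriv_le
      _ = ((1 / 2 : NNReal) : ℝ) := by norm_num

-- The simplified Newton iteration `l ↦ l - (sin l + G l) / cos (n π)` is a contraction.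
theorem exists_unique_zero_sin_add {n : ℤ} {G : ℂ → ℂ}
    (hG : DifferentiableOn ℂ G (ball (n * Real.pi : ℂ) 1))
    (bound : ∀ w ∈ ball (n * Real.pi : ℂ) 1, ‖G w‖ ≤ 1 / 16) :
    ∃ l ∈ closedBall (n * Real.pi : ℂ) (1 / 2), Complex.sin l + G l = 0 ∧
      ‖l - n * Real.pi‖ ≤ 2 * ‖G (n * Real.pi)‖ ∧
      ∀ l' ∈ closedBall (n * Real.pi : ℂ) (1 / 2), Complex.sin l' + G l' = 0 → l' = l := by
  have fixed_iff (l : ℂ) : l - (-1) ^ n * (Complex.sin l + G l) = l ↔ Complex.sin l + G l = 0 := by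
    simp [zpow_ne_zero]
  have dist_step : dist (n * Real.pi : ℂ) (n * Real.pi - (-1) ^ n *
      (Complex.sin (n * Real.pi) + G (n * Real.pi))) = ‖G (n * Real.pi)‖ := by
    simp [Complex.sin_int_mul_pi]
  have norm_center_le := bound _ (mem_ball_self one_pos)
  obtain ⟨l, l_mem, fixed, dist_le, unique⟩ := exists_unique_fixed_point_closedBall
    (by norm_num [← NNReal.coe_lt_coe]) (lipschitzOnWith_newton_sin_add hG bound)
    (by rw [dist_step]; norm_num; linarith)
  refine ⟨l, l_mem, (fixed_iff l).1 fixed, ?_, fun l' hl' h => unique l' hl' ((fixed_iff l').2 h)⟩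
  rw [dist_step, dist_comm, dist_eq_norm] at dist_le
  exact dist_le.trans_eq (by norm_num; ring)

end PerturbedSine

section EigenvalueBranch

open Metric

variable {a b α s X : ℝ} {ξ : ℝ} {μ μ' l : ℂ}

/-- The branch of the relation `a l⁴ = -(b μ + μ²)` that solves for `μ` near the positive real axis;
`s = ± 1` is the sign of `Im μ`. -/
noncomputable def eigenvalueBranch (a b s : ℝ) (l : ℂ) : ℂ :=
  -b / 2 + s * Complex.I * √a * l ^ 2 * Complex.sqrt (1 - b ^ 2 / (4 * a * l ^ 4))

theorem norm_sqrt_one_sub_sub_one_le (t : ℂ) : ‖Complex.sqrt (1 - t) - 1‖ ≤ ‖t‖ := by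
  set q := Complex.sqrt (1 - t) with hq
  have q_sq : q ^ 2 = 1 - t := Complex.cpow_ofNat_inv_pow _ 2
  have re_nonneg : 0 ≤ q.re := by
    rw [hq, Complex.sqrt, Complex.cpow_inv_two_re]
    exact Real.sqrt_nonneg _
  have one_le : 1 ≤ ‖q + 1‖ := by
    refine le_trans ?_ (Complex.re_le_norm (q + 1))
    simpa using re_nonneg
  calc ‖q - 1‖ ≤ ‖q - 1‖ * ‖q + 1‖ := le_mul_of_one_le_right (norm_nonneg _) one_le
    _ = ‖-t‖ := by rw [← norm_mul]; congr 1; linear_combination q_sq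
    _ = ‖t‖ := norm_neg t

theorem norm_sq_div_four_mul_le (ha : 0 < a) (hl : l ≠ 0) (h : |b| ≤ √a * ‖l‖ ^ 2) :
    ‖(b : ℂ) ^ 2 / (4 * a * l ^ 4)‖ ≤ 1 / 4 := by
  have : 0 < ‖l‖ := norm_pos_iff.2 hl
  have b_sq_le : b ^ 2 ≤ a * ‖l‖ ^ 4 := by
    calc b ^ 2 = |b| ^ 2 := (sq_abs b).symm
      _ ≤ (√a * ‖l‖ ^ 2) ^ 2 := by gcongr
      _ = a * ‖l‖ ^ 4 := by rw [mul_pow, Real.sq_sqrt ha.le]; ring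
  simp only [norm_div, norm_mul, norm_pow, Complex.norm_real, Complex.norm_ofNat, Real.norm_eq_abs,
    sq_abs, abs_of_pos ha]
  rw [div_le_iff₀ (by positivity)]
  linarith

theorem eigenvalueBranch_spec (ha : 0 < a) (hs : s ^ 2 = 1) (hl : l ≠ 0) :
    a * l ^ 4 = -(b * eigenvalueBranch a b s l + eigenvalueBranch a b s l ^ 2) := by
  have a_ne : (a : ℂ) ≠ 0 := mod_cast ha.ne'
  have sqrt_a_sq : ((√a : ℝ) : ℂ) ^ 2 = a := mod_cast Real.sq_sqrt ha.le
  have s_sq : (s : ℂ) ^ 2 = 1 := mod_cast hs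
  have sqrt_sq : a * l ^ 4 * Complex.sqrt (1 - b ^ 2 / (4 * a * l ^ 4)) ^ 2 =
      a * l ^ 4 - b ^ 2 / 4 := by
    rw [Complex.sqrt, Complex.cpow_ofNat_inv_pow]
    field_simp
  rw [eigenvalueBranch]
  set q := Complex.sqrt (1 - b ^ 2 / (4 * a * l ^ 4))
  have square : ((s : ℂ) * Complex.I * √a * l ^ 2 * q) ^ 2 = -(a * l ^ 4 * q ^ 2) := by
    simp only [mul_pow, s_sq, Complex.I_sq, sqrt_a_sq]
    ring
  linear_combination square - sqrt_sq

theorem differentiableAt_eigenvalueBranch (ha : 0 < a) (hl : l ≠ 0) (h : |b| ≤ √a * ‖l‖ ^ 2) :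
    DifferentiableAt ℂ (eigenvalueBranch a b s) l := by
  have a_ne : (a : ℂ) ≠ 0 := mod_cast ha.ne'
  have mem_slitPlane : 1 - (b : ℂ) ^ 2 / (4 * a * l ^ 4) ∈ Complex.slitPlane := by
    have := (Complex.re_le_norm _).trans (norm_sq_div_four_mul_le ha hl h)
    refine Or.inl ?_
    rw [Complex.sub_re, Complex.one_re]
    linarith
  have radicand : DifferentiableAt ℂ (fun l : ℂ => 1 - (b : ℂ) ^ 2 / (4 * a * l ^ 4)) l :=
    (differentiableAt_const _).sub
      ((differentiableAt_const _).div (by fun_prop) (by simp [a_ne, hl]))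
  have factor : DifferentiableAt ℂ (fun l : ℂ => (s : ℂ) * Complex.I * √a * l ^ 2) l := by fun_prop
  exact (factor.mul (radicand.cpow_const mem_slitPlane)).const_add _

theorem mul_im_eigenvalueBranch_pos (ha : 0 < a) (hs : s ^ 2 = 1) (hl : l ≠ 0)
    (h : |b| ≤ √a * ‖l‖ ^ 2) (sector : 2 * |l.im| ≤ l.re) :
    0 < s * (eigenvalueBranch a b s l).im := by
  set q := Complex.sqrt (1 - b ^ 2 / (4 * a * l ^ 4))
  have im_eq : s * (eigenvalueBranch a b s l).im = √a * (l ^ 2 * q).re := by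
    have : eigenvalueBranch a b s l = ((-b / 2 : ℝ) : ℂ) +
        ((s * √a : ℝ) : ℂ) * (l ^ 2 * q * Complex.I) := by
      rw [eigenvalueBranch]; push_cast; ring
    rw [this, Complex.add_im, Complex.ofReal_im, Complex.im_ofReal_mul, Complex.mul_I_im]
    linear_combination √a * (l ^ 2 * q).re * hs
  have re_eq : (l ^ 2 * q).re = l.re ^ 2 - l.im ^ 2 + (l ^ 2 * (q - 1)).re := by
    have : l ^ 2 * q = l * l + l ^ 2 * (q - 1) := by ring
    rw [this, Complex.add_re, Complex.mul_re]
    ring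
  have error_le : -((l.re ^ 2 + l.im ^ 2) * (1 / 4)) ≤ (l ^ 2 * (q - 1)).re := by
    refine (abs_le.1 ((Complex.abs_re_le_norm _).trans ?_)).1
    rw [norm_mul, norm_pow, Complex.sq_norm, Complex.normSq_apply, ← sq, ← sq]
    gcongr
    exact (norm_sqrt_one_sub_sub_one_le _).trans (norm_sq_div_four_mul_le ha hl h)
  have re_pos : 0 < l.re := by
    refine lt_of_le_of_ne (by linarith [abs_nonneg l.im]) fun re_eq_zero => hl ?_
    exact Complex.ext re_eq_zero.symm (abs_nonpos_iff.1 (by linarith))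
  have im_sq_le : 4 * l.im ^ 2 ≤ l.re ^ 2 := by
    rw [← sq_abs l.im]
    nlinarith [abs_nonneg l.im]
  rw [im_eq]
  have := pow_pos re_pos 2
  exact mul_pos (Real.sqrt_pos.2 ha) (by linarith)

theorem eq_of_mul_im_pos (hμ : a * l ^ 4 = -(b * μ + μ ^ 2))
    (hμ' : a * l ^ 4 = -(b * μ' + μ' ^ 2)) (im_pos : 0 < s * μ.im) (im_pos' : 0 < s * μ'.im) :
    μ = μ' := by
  have product_eq_zero : (μ - μ') * (μ + μ' + b) = 0 := by linear_combination hμ - hμ'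
  refine sub_eq_zero.1 ((mul_eq_zero.1 product_eq_zero).resolve_right fun sum_eq_zero => ?_)
  have im_add : μ.im + μ'.im = 0 := by simpa using congrArg Complex.im sum_eq_zero
  have : s * μ.im + s * μ'.im = 0 := by rw [← mul_add, im_add, mul_zero]
  linarith

/-- The term that the damper adds to the equation `sin l = 0`, as a function of `l` alone: the
spectral parameter is eliminated by `eigenvalueBranch`. -/
noncomputable def damperPerturbation (a b α ξ s : ℝ) (l : ℂ) : ℂ :=
  -(dampingRatio a α (eigenvalueBranch a b s l) l * normalizedMode ξ l ξ)

theorem beamCharEq_eigenvalueBranch_iff (ha : a ≠ 0) (hl : 0 < l.re) :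
    BeamCharEq a α ξ (eigenvalueBranch a b s l) l ↔
      Complex.sin l + damperPerturbation a b α ξ s l = 0 := by
  rw [beamCharEq_iff_sin_eq ha hl, damperPerturbation, ← sub_eq_add_neg, sub_eq_zero]

theorem differentiableAt_damperPerturbation (ha : 0 < a) (hl : 0 < l.re)
    (h : |b| ≤ √a * ‖l‖ ^ 2) : DifferentiableAt ℂ (damperPerturbation a b α ξ s) l := by
  have a_ne : (a : ℂ) ≠ 0 := mod_cast ha.ne'
  have l_ne : l ≠ 0 := by rintro rfl; simp at hl
  have ratio : DifferentiableAt ℂ (fun l => dampingRatio a α (eigenvalueBranch a b s l) l) l :=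
    ((differentiableAt_eigenvalueBranch ha l_ne h).const_mul _).div (by fun_prop)
      (by simp [a_ne, l_ne])
  have mode : DifferentiableAt ℂ (fun l => normalizedMode ξ l ξ) l := by
    unfold normalizedMode
    have quotient := DifferentiableAt.div (𝕜 := ℂ)
      (c := fun l : ℂ => Complex.sinh (l * (1 - ξ : ℝ)) * Complex.sinh (l * ξ)) (x := l)
      (by fun_prop) (by fun_prop) (sinh_ne_zero_of_re_pos hl)
    exact (DifferentiableAt.mul (by fun_prop) quotient).sub (by fun_prop)
  exact (ratio.mul mode).neg

theorem norm_normalizedMode_self_le_six (hl : 1 ≤ l.re) (him : |l.im| ≤ 1) (h0 : 0 ≤ ξ)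
    (h1 : ξ ≤ 1) : ‖normalizedMode ξ l ξ‖ ≤ 6 := by
  have norm_sin_le : ‖Complex.sin l‖ ≤ 2 := by
    simpa using norm_sin_mul_le_two him zero_le_one le_rfl
  linarith [norm_normalizedMode_self_le hl h0 h1, norm_sinProd_le_two h0 h1 him]

theorem norm_damperPerturbation_le (ha : 0 < a) (hs : s ^ 2 = 1) (hl : 1 ≤ l.re)
    (him : |l.im| ≤ 1) (h : |b| ≤ √a * ‖l‖ ^ 2) (h0 : 0 ≤ ξ) (h1 : ξ ≤ 1) :
    ‖damperPerturbation a b α ξ s l‖ ≤ 6 * (|α| / √a / ‖l‖) := by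
  have l_ne : l ≠ 0 := by rintro rfl; norm_num at hl
  rw [damperPerturbation, norm_neg, norm_mul, mul_comm]
  exact mul_le_mul (norm_normalizedMode_self_le_six hl him h0 h1)
    (norm_dampingRatio_le ha (eigenvalueBranch_spec ha hs l_ne) l_ne h) (norm_nonneg _)
    (by norm_num)

theorem sub_one_le_re_of_mem_ball (hl : l ∈ ball (X : ℂ) 1) : X - 1 ≤ l.re := by
  have := (Complex.abs_re_le_norm (l - X)).trans (mem_ball_iff_norm.1 hl).le
  rw [Complex.sub_re, Complex.ofReal_re, abs_le] at this
  linarith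

theorem abs_im_le_one_of_mem_ball (hl : l ∈ ball (X : ℂ) 1) : |l.im| ≤ 1 := by
  simpa using (Complex.abs_im_le_norm (l - X)).trans (mem_ball_iff_norm.1 hl).le

namespace IsLargeFrequency

theorem abs_le_of_mem_ball (h : IsLargeFrequency a b α X) (hl : l ∈ ball (X : ℂ) 1) :
    |b| ≤ √a * ‖l‖ ^ 2 := by
  refine h.abs_le_sqrt_mul_sub_one_sq.trans ?_
  have := (sub_one_le_re_of_mem_ball hl).trans (Complex.re_le_norm l)
  gcongr
  linarith [h.hundred_le]

theorem norm_damperPerturbation_le_of_mem_ball (ha : 0 < a) (h : IsLargeFrequency a b α X)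
    (hs : s ^ 2 = 1) (h0 : 0 ≤ ξ) (h1 : ξ ≤ 1) (hl : l ∈ ball (X : ℂ) 1) :
    ‖damperPerturbation a b α ξ s l‖ ≤ 1 / 16 := by
  have le_re := sub_one_le_re_of_mem_ball hl
  have le_norm := le_re.trans (Complex.re_le_norm l)
  have hundred_le := h.hundred_le
  have quotient_le : |α| / √a / ‖l‖ ≤ 1 / 100 := by
    rw [div_le_iff₀ (by linarith)]
    linarith [h.ratio_le ha]
  linarith [norm_damperPerturbation_le (α := α) ha hs (by linarith) (abs_im_le_one_of_mem_ball hl)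
    (h.abs_le_of_mem_ball hl) h0 h1]

theorem beamCharEq_and_iff_of_mem_ball (ha : 0 < a) (h : IsLargeFrequency a b α X)
    (hs : s ^ 2 = 1) (hl : l ∈ ball (X : ℂ) 1) :
    (a * l ^ 4 = -(b * μ + μ ^ 2) ∧ 0 < s * μ.im ∧ BeamCharEq a α ξ μ l) ↔
      μ = eigenvalueBranch a b s l ∧ Complex.sin l + damperPerturbation a b α ξ s l = 0 := by
  have le_re := sub_one_le_re_of_mem_ball hl
  have re_pos : 0 < l.re := by linarith [h.hundred_le]
  have l_ne : l ≠ 0 := by rintro rfl; simp at re_pos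
  have branch_spec := eigenvalueBranch_spec (b := b) ha hs l_ne
  have branch_im_pos := mul_im_eigenvalueBranch_pos ha hs l_ne (h.abs_le_of_mem_ball hl)
    (by linarith [abs_im_le_one_of_mem_ball hl, h.hundred_le])
  rw [← beamCharEq_eigenvalueBranch_iff ha.ne' re_pos]
  constructor
  · rintro ⟨hμ, im_pos, charEq⟩
    obtain rfl := eq_of_mul_im_pos hμ branch_spec im_pos branch_im_pos
    exact ⟨rfl, charEq⟩
  · rintro ⟨rfl, charEq⟩
    exact ⟨branch_spec, branch_im_pos, charEq⟩

theorem exists_unique_zero_sin_add_damperPerturbation {n : ℕ} (ha : 0 < a)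
    (h : IsLargeFrequency a b α (n * Real.pi)) (hs : s ^ 2 = 1) (h0 : 0 ≤ ξ) (h1 : ξ ≤ 1) :
    ∃ l ∈ closedBall ((n * Real.pi : ℝ) : ℂ) (1 / 2),
      Complex.sin l + damperPerturbation a b α ξ s l = 0 ∧
      ‖l - (n * Real.pi : ℝ)‖ ≤ 12 * (|α| / √a) / (n * Real.pi) ∧
      ∀ l' ∈ closedBall ((n * Real.pi : ℝ) : ℂ) (1 / 2),
        Complex.sin l' + damperPerturbation a b α ξ s l' = 0 → l' = l := by
  have center_eq : ((n : ℤ) : ℂ) * Real.pi = (n * Real.pi : ℝ) := by push_cast; rfl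
  have perturbed_sine := exists_unique_zero_sin_add (n := n) (G := damperPerturbation a b α ξ s)
  rw [center_eq] at perturbed_sine
  obtain ⟨l, l_mem, zero, dist_le, unique⟩ := perturbed_sine
    (fun l hl => by
      refine (differentiableAt_damperPerturbation ha ?_
        (h.abs_le_of_mem_ball hl)).differentiableWithinAt
      linarith [sub_one_le_re_of_mem_ball hl, h.hundred_le])
    (fun l hl => h.norm_damperPerturbation_le_of_mem_ball ha hs h0 h1 hl)
  refine ⟨l, l_mem, zero, dist_le.trans ?_, unique⟩
  have norm_center_le := norm_damperPerturbation_le (α := α) (l := (n * Real.pi : ℝ)) ha hs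
    (by rw [Complex.ofReal_re]; linarith [h.hundred_le]) (by simp)
    (h.abs_le_of_mem_ball (mem_ball_self one_pos)) h0 h1
  rw [Complex.norm_real, Real.norm_of_nonneg h.pos.le] at norm_center_le
  calc _ ≤ 2 * (6 * (|α| / √a / (n * Real.pi))) := by gcongr
    _ = 12 * (|α| / √a) / (n * Real.pi) := by ring

end IsLargeFrequency

end EigenvalueBranch

section LargeEigenvalues

variable {a b α t x y : ℝ} {N : ℕ} {ξ : Ioo (0 : ℝ) 1} {μ l z u : ℂ}

theorem pow_four_eq_div_iff (ha : a ≠ 0) :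
    l ^ 4 = -(b * μ + μ ^ 2) / a ↔ a * l ^ 4 = -(b * μ + μ ^ 2) := by
  rw [eq_div_iff (mod_cast ha), mul_comm]

theorem exists_pow_four_eq_div (a b : ℝ) (μ : ℂ) : ∃ l : ℂ, l ^ 4 = -(b * μ + μ ^ 2) / a :=
  IsAlgClosed.exists_pow_nat_eq _ (by norm_num)

theorem exists_isLargeFrequency_nat_mul_pi (ha : 0 < a) (b α : ℝ) :
    ∃ N : ℕ, IsLargeFrequency a b α (N * Real.pi) :=
  ((tendsto_natCast_atTop_atTop.atTop_mul_const Real.pi_pos).eventually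
    (eventually_isLargeFrequency ha b α)).exists

/-- The constant `C` of the localization estimate `|λ - z| ≤ C / |z|`; the summand `1` keeps it
positive in the absence of a point damper. -/
noncomputable def localizationConstant (a α : ℝ) : ℝ := 16 * (|α| / √a) + 1

theorem localizationConstant_pos (a α : ℝ) : 0 < localizationConstant a α := by
  unfold localizationConstant
  positivity

namespace IsLargeFrequency

theorem localizationConstant_div_le (ha : 0 < a) (h : IsLargeFrequency a b α t) :
    localizationConstant a α / t ≤ 1 / 4 := by
  rw [div_le_iff₀ h.pos, localizationConstant]
  linarith [h.ratio_le ha, h.hundred_le]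

theorem sqrt_mul_sq_add_abs_lt (ha : 0 < a) (h : IsLargeFrequency a b α x) (hxy : x + 1 ≤ y) :
    √a * x ^ 2 + |b| < √a * y ^ 2 := by
  have sqrt_pos := Real.sqrt_pos.2 ha
  calc √a * x ^ 2 + |b| < √a * x ^ 2 + √a * (2 * x + 1) := by
        nlinarith [h.damping_le, mul_pos sqrt_pos h.pos]
    _ = √a * (x + 1) ^ 2 := by ring
    _ ≤ √a * y ^ 2 := by gcongr; linarith [h.pos]

theorem lt_norm_of_lt_norm (ha : 0 < a) (h : IsLargeFrequency a b α x) (hxy : x + 1 ≤ y)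
    (hμ : a * l ^ 4 = -(b * μ + μ ^ 2)) (norm_μ : √a * y ^ 2 < ‖μ‖) : x < ‖l‖ := by
  by_contra! norm_l_le
  have : √a * ‖l‖ ^ 2 ≤ √a * x ^ 2 := by gcongr
  linarith [(abs_le.1 (abs_norm_sub_sqrt_mul_norm_sq_le ha.le hμ)).2,
    h.sqrt_mul_sq_add_abs_lt ha hxy]

theorem lt_norm_of_add_one_le (ha : 0 < a) (h : IsLargeFrequency a b α y)
    (hμ : a * l ^ 4 = -(b * μ + μ ^ 2)) (norm_l : y + 1 ≤ ‖l‖) : √a * y ^ 2 < ‖μ‖ := by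
  linarith [(abs_le.1 (abs_norm_sub_sqrt_mul_norm_sq_le ha.le hμ)).1,
    h.sqrt_mul_sq_add_abs_lt ha norm_l]

theorem exists_root_norm_sub_le (ha : 0 < a) (h : IsLargeFrequency a b α (N * Real.pi))
    (hμ : a * l ^ 4 = -(b * μ + μ ^ 2)) (charEq : BeamCharEq a α ξ μ l)
    (norm_l : N * Real.pi + 1 / 4 < ‖l‖) :
    ∃ z : ℂ, Complex.sinh z * Complex.sin z = 0 ∧ N * Real.pi + Real.pi ≤ ‖z‖ ∧
      ‖l - z‖ ≤ localizationConstant a α / ‖z‖ := by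
  have l_large : IsLargeFrequency a b α ‖l‖ := h.mono (by linarith)
  obtain ⟨z, root, dist_le⟩ := l_large.exists_root ha hμ ξ.2.1.le ξ.2.2.le charEq
  have dist_lt : 7 * (|α| / √a / ‖l‖) ≤ 7 / 1000 := by
    rw [← mul_div_assoc, div_le_iff₀ l_large.pos]
    linarith [l_large.ratio_le ha]
  have norm_le : ‖l‖ ≤ ‖z‖ + ‖l - z‖ := by linarith [norm_sub_norm_le l z]
  have norm_le' : ‖z‖ ≤ 2 * ‖l‖ := by
    linarith [norm_sub_norm_le z l, norm_sub_rev z l, l_large.hundred_le]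
  have norm_z_pos : 0 < ‖z‖ := by linarith [h.pos]
  refine ⟨z, root, add_pi_le_norm_of_root root (by linarith), dist_le.trans ?_⟩
  calc 7 * (|α| / √a / ‖l‖) ≤ 7 * (|α| / √a / (‖z‖ / 2)) := by gcongr; linarith
    _ = 14 * (|α| / √a) / ‖z‖ := by ring
    _ ≤ localizationConstant a α / ‖z‖ := by
      rw [localizationConstant]
      gcongr
      linarith [show 0 ≤ |α| / √a by positivity]

theorem lt_norm_iff_forall_exists_root (ha : 0 < a) (h : IsLargeFrequency a b α (N * Real.pi))
    (hξ : Irrational (ξ : ℝ)) (eigenvalue : IsEigenvalueOf (beamOperator a b α ξ) μ) :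
    √a * (N * Real.pi + Real.pi / 2) ^ 2 < ‖μ‖ ↔ ∀ l : ℂ, l ^ 4 = -(b * μ + μ ^ 2) / a →
      ∃ z : ℂ, Complex.sinh z * Complex.sin z = 0 ∧ N * Real.pi + Real.pi / 2 ≤ ‖z‖ ∧
        ‖l - z‖ ≤ localizationConstant a α / ‖z‖ := by
  have pi_gt := Real.pi_gt_three
  constructor
  · intro norm_μ l hμ
    rw [pow_four_eq_div_iff ha.ne'] at hμ
    have norm_l : N * Real.pi + 1 / 4 < ‖l‖ :=
      (h.mono (by linarith)).lt_norm_of_lt_norm ha (by linarith) hμ norm_μ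
    have l_ne : l ≠ 0 := norm_pos_iff.1 (by linarith [h.pos])
    obtain ⟨z, root, norm_z, dist_le⟩ := h.exists_root_norm_sub_le ha hμ
      ((isEigenvalueOf_beamOperator_iff ha hξ l_ne hμ).1 eigenvalue) norm_l
    exact ⟨z, root, by linarith, dist_le⟩
  · intro near_roots
    obtain ⟨l, hμ⟩ := exists_pow_four_eq_div a b μ
    obtain ⟨z, root, norm_z, dist_le⟩ := near_roots l hμ
    rw [pow_four_eq_div_iff ha.ne'] at hμ
    have norm_z_ge := add_pi_le_norm_of_root root (N := N) (by linarith)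
    have dist_le' := dist_le.trans ((h.mono (by linarith)).localizationConstant_div_le ha)
    refine (h.mono (by linarith)).lt_norm_of_add_one_le ha hμ ?_
    linarith [norm_sub_norm_le z l, norm_sub_rev z l]

theorem existsUnique_eigenvalue_pair {n : ℕ} {s : ℝ} (ha : 0 < a)
    (h : IsLargeFrequency a b α (n * Real.pi)) (hξ : Irrational (ξ : ℝ)) (hs : s ^ 2 = 1) :
    ∃! p : ℂ × ℂ, IsEigenvalueOf (beamOperator a b α ξ) p.1 ∧ 0 < s * p.1.im ∧
      a * p.2 ^ 4 = -(b * p.1 + p.1 ^ 2) ∧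
      ‖p.2 - (n * Real.pi : ℝ)‖ ≤ localizationConstant a α / (n * Real.pi) := by
  have radius_le := h.localizationConstant_div_le ha
  have mem_closedBall {l : ℂ}
      (hl : ‖l - (n * Real.pi : ℝ)‖ ≤ localizationConstant a α / (n * Real.pi)) :
      l ∈ Metric.closedBall ((n * Real.pi : ℝ) : ℂ) (1 / 2) :=
    mem_closedBall_iff_norm.2 (by linarith)
  have subset := Metric.closedBall_subset_ball (x := ((n * Real.pi : ℝ) : ℂ))
    (by norm_num : (1 / 2 : ℝ) < 1)
  have ne_zero {l : ℂ} (hl : l ∈ Metric.closedBall ((n * Real.pi : ℝ) : ℂ) (1 / 2)) : l ≠ 0 := by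
    rintro rfl
    have := sub_one_le_re_of_mem_ball (subset hl)
    rw [Complex.zero_re] at this
    linarith [h.hundred_le]
  obtain ⟨l, l_mem, zero, dist_le, unique⟩ :=
    h.exists_unique_zero_sin_add_damperPerturbation ha hs ξ.2.1.le ξ.2.2.le
  obtain ⟨hμ, im_pos, charEq⟩ :=
    (h.beamCharEq_and_iff_of_mem_ball ha hs (subset l_mem)).2 ⟨rfl, zero⟩
  refine ⟨(eigenvalueBranch a b s l, l),
    ⟨(isEigenvalueOf_beamOperator_iff ha hξ (ne_zero l_mem) hμ).2 charEq, im_pos, hμ, ?_⟩, ?_⟩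
  · refine dist_le.trans ?_
    rw [localizationConstant]
    gcongr
    linarith [show 0 ≤ |α| / √a by positivity]
  · rintro ⟨μ', l'⟩ ⟨eigenvalue', im_pos', hμ', dist_le'⟩
    have l'_mem := mem_closedBall dist_le'
    have charEq' := (isEigenvalueOf_beamOperator_iff ha hξ (ne_zero l'_mem) hμ').1 eigenvalue'
    obtain ⟨μ'_eq, zero'⟩ := (h.beamCharEq_and_iff_of_mem_ball ha hs (subset l'_mem)).1
      ⟨hμ', im_pos', charEq'⟩
    obtain rfl := unique l' l'_mem zero'
    exact Prod.ext μ'_eq rfl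

-- The relation between `μ` and `λ` only involves `λ⁴`, so multiplication by `u` carries the pairs
-- near `n π` to those near `n π u`.
theorem existsUnique_eigenvalue_pair_mul {n : ℕ} {s : ℝ} (ha : 0 < a)
    (h : IsLargeFrequency a b α (n * Real.pi)) (hξ : Irrational (ξ : ℝ)) (hs : s ^ 2 = 1)
    (hu : u ^ 4 = 1) :
    ∃! p : ℂ × ℂ, IsEigenvalueOf (beamOperator a b α ξ) p.1 ∧ 0 < s * p.1.im ∧
      p.2 ^ 4 = -(b * p.1 + p.1 ^ 2) / a ∧
      ‖p.2 - n * Real.pi * u‖ ≤ localizationConstant a α / ‖(n * Real.pi * u : ℂ)‖ := by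
  have u_ne : u ≠ 0 := norm_pos_iff.1 (by rw [norm_eq_one_of_pow_four_eq_one hu]; exact one_pos)
  let rotation : ℂ × ℂ ≃ ℂ × ℂ := (Equiv.refl ℂ).prodCongr (Equiv.mulRight₀ u u_ne)
  refine (rotation.existsUnique_congr fun {p} => ?_).1 (h.existsUnique_eigenvalue_pair ha hξ hs)
  have dist_eq : ‖p.2 * u - n * Real.pi * u‖ = ‖p.2 - (n * Real.pi : ℝ)‖ := by
    rw [← sub_mul, norm_mul, norm_eq_one_of_pow_four_eq_one hu, mul_one]
    push_cast
    rfl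
  simp only [rotation, Equiv.prodCongr_apply, Prod.map_fst, Prod.map_snd, Equiv.refl_apply,
    Equiv.mulRight₀_apply, dist_eq, norm_natCast_mul_pi_mul hu, pow_four_eq_div_iff ha.ne',
    mul_pow, hu, mul_one]

theorem geomMult_eq_one_and_algMult_eq_one_of_lt_norm (ha : 0 < a) (h : IsLargeFrequency a b α t)
    (hξ : Irrational (ξ : ℝ)) (eigenvalue : IsEigenvalueOf (beamOperator a b α ξ) μ)
    (norm_μ : √a * (t + 1) ^ 2 < ‖μ‖) :
    geomMult (beamOperator a b α ξ) μ = 1 ∧ algMult (beamOperator a b α ξ) μ = 1 := by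
  obtain ⟨l, hμ⟩ := exists_pow_four_eq_div a b μ
  rw [pow_four_eq_div_iff ha.ne'] at hμ
  have l_large : IsLargeFrequency a b α ‖l‖ := h.mono (h.lt_norm_of_lt_norm ha le_rfl hμ norm_μ).le
  exact l_large.geomMult_eq_one_and_algMult_eq_one ha hμ hξ
    ((isEigenvalueOf_beamOperator_iff ha hξ (norm_pos_iff.1 l_large.pos) hμ).1 eigenvalue)

end IsLargeFrequency

end LargeEigenvalues

theorem mainTheorem5_general (a b α : ℝ) (ξ : Ioo (0 : ℝ) 1) (ha : 0 < a)
    (hξ : Irrational (ξ : ℝ)) :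
    (∀ z : ℂ, Complex.sinh z * Complex.sin z = 0 ↔
      ∃ n : ℤ, z = n * Real.pi ∨ z = Complex.I * n * Real.pi) ∧
    ∃ C ρ R : ℝ, 0 < C ∧ 0 < ρ ∧ 0 < R ∧
      (∀ μ : ℂ, IsEigenvalueOf (beamOperator a b α ξ) μ →
        (R < ‖μ‖ ↔ ∀ l : ℂ, l ^ 4 = -(b * μ + μ ^ 2) / a →
          ∃ z : ℂ, Complex.sinh z * Complex.sin z = 0 ∧ ρ ≤ ‖z‖ ∧ ‖l - z‖ ≤ C / ‖z‖)) ∧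
      (∀ z : ℂ, Complex.sinh z * Complex.sin z = 0 → ρ ≤ ‖z‖ →
        (∃! p : ℂ × ℂ, IsEigenvalueOf (beamOperator a b α ξ) p.1 ∧ 0 < p.1.im ∧
          p.2 ^ 4 = -(b * p.1 + p.1 ^ 2) / a ∧ ‖p.2 - z‖ ≤ C / ‖z‖) ∧
        (∃! p : ℂ × ℂ, IsEigenvalueOf (beamOperator a b α ξ) p.1 ∧ p.1.im < 0 ∧
          p.2 ^ 4 = -(b * p.1 + p.1 ^ 2) / a ∧ ‖p.2 - z‖ ≤ C / ‖z‖)) ∧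
      (∀ μ : ℂ, IsEigenvalueOf (beamOperator a b α ξ) μ → R < ‖μ‖ →
        geomMult (beamOperator a b α ξ) μ = 1 ∧ algMult (beamOperator a b α ξ) μ = 1) := by
  obtain ⟨N, large⟩ := exists_isLargeFrequency_nat_mul_pi ha b α
  have pi_gt := Real.pi_gt_three
  have threshold_pos : 0 < N * Real.pi + Real.pi / 2 := by linarith [large.pos]
  have R_pos : 0 < √a * (N * Real.pi + Real.pi / 2) ^ 2 := by positivity
  refine ⟨sinh_mul_sin_eq_zero_iff, localizationConstant a α, N * Real.pi + Real.pi / 2,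
    √a * (N * Real.pi + Real.pi / 2) ^ 2, localizationConstant_pos a α, threshold_pos, R_pos,
    fun μ => large.lt_norm_iff_forall_exists_root ha hξ, fun z root norm_z => ?_,
    fun μ eigenvalue norm_μ => ?_⟩
  · obtain ⟨n, u, hu, rfl⟩ := exists_eq_nat_mul_pi_mul_of_root root
    have n_large : IsLargeFrequency a b α (n * Real.pi) :=
      large.mono (by linarith [norm_natCast_mul_pi_mul hu n])
    constructor
    · simpa only [one_mul] using
        n_large.existsUnique_eigenvalue_pair_mul ha hξ (one_pow 2) hu
    · simpa only [neg_mul, one_mul, neg_pos] using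
        n_large.existsUnique_eigenvalue_pair_mul ha hξ (neg_one_sq (R := ℝ)) hu
  · refine large.geomMult_eq_one_and_algMult_eq_one_of_lt_norm ha hξ eigenvalue
      (lt_of_le_of_lt ?_ norm_μ)
    have := large.pos
    gcongr
    linarith

theorem mainTheorem5 (a b α : ℝ) (ξ : Ioo (0 : ℝ) 1) (ha : 0 < a) (hb : 0 < b) (hα : 0 < α)
    (hαb : α * b < 6) (hξ : Irrational (ξ : ℝ)) :
    (∀ z : ℂ, Complex.sinh z * Complex.sin z = 0 ↔
      ∃ n : ℤ, z = n * Real.pi ∨ z = Complex.I * n * Real.pi) ∧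
    ∃ C ρ R : ℝ, 0 < C ∧ 0 < ρ ∧ 0 < R ∧
      (∀ μ : ℂ, IsEigenvalueOf (beamOperator a b α ξ) μ →
        (R < ‖μ‖ ↔ ∀ l : ℂ, l ^ 4 = -(b * μ + μ ^ 2) / a →
          ∃ z : ℂ, Complex.sinh z * Complex.sin z = 0 ∧ ρ ≤ ‖z‖ ∧ ‖l - z‖ ≤ C / ‖z‖)) ∧
      (∀ z : ℂ, Complex.sinh z * Complex.sin z = 0 → ρ ≤ ‖z‖ →
        (∃! p : ℂ × ℂ, IsEigenvalueOf (beamOperator a b α ξ) p.1 ∧ 0 < p.1.im ∧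
          p.2 ^ 4 = -(b * p.1 + p.1 ^ 2) / a ∧ ‖p.2 - z‖ ≤ C / ‖z‖) ∧
        (∃! p : ℂ × ℂ, IsEigenvalueOf (beamOperator a b α ξ) p.1 ∧ p.1.im < 0 ∧
          p.2 ^ 4 = -(b * p.1 + p.1 ^ 2) / a ∧ ‖p.2 - z‖ ≤ C / ‖z‖)) ∧
      (∀ μ : ℂ, IsEigenvalueOf (beamOperator a b α ξ) μ → R < ‖μ‖ →
        geomMult (beamOperator a b α ξ) μ = 1 ∧ algMult (beamOperator a b α ξ) μ = 1) :=
  mainTheorem5_general a b α ξ ha hξ
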